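/- **Setting.** Let $d_1\ge 1$, let $\pi$ be a prior probability density on $\mathbb R^{d_1}$, let $p(\mathbb Y_n,\theta_2\mid\theta_1)$ be the likelihood of the observed data $\mathbb Y_n$ and the block $\theta_2\in\mathbb R^{d_2}$ given $\theta_1\in\mathbb R^{d_1}$, and let $q_{2,n}^\dagger$ be a fixed probability density for $\theta_2$ (the current variational factor). Put $$\ell_n(\theta_1)=\int q_{2,n}^\dagger(\theta_2)\log p(\mathbb Y_n,\theta_2\mid\theta_1)\,d\theta_2,\qquad \tilde f_n(\theta_1)=\ell_n(\theta_1)+\log\pi(\theta_1),$$ where the integral is assumed to be finite for every $\theta_1$ and $\log 0=-\infty$. The exact CAVI update $q_n^{VI}$ is the probability law with density proportional to $\exp\tilde f_n$. The Laplace update is $q_n^{L}=\mathcal N(\hat\theta_n,[-\tilde f_n''(\hat\theta_n)]^{-1})$, where $\hat\theta_n$ is the maximizer of $\tilde f_n$. Let $\overline{q_n^{VI}},\overline{q_n^{L}}$ be the laws of $\sqrt n(\theta_1-\hat\theta_n)$ under $q_n^{VI}$, $q_n^L$. Norms are Euclidean, $\|\cdot\|_{\rm op}$ is the operator norm of matrices,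 $\|g'''\|^*$ is the norm of the third derivative as a trilinear form, $\lambda_{\min}$ is the smallest eigenvalue, $\mathcal B(x,\delta)$ is a closed ball, and $d_{TV}(\mu,\nu)=\sup_A|\mu(A)-\nu(A)|$. **Assumptions** (with constants $\bar\delta,\hat\delta,\bar M_1,\bar M_2,\hat M_1,\hat\kappa>0$). 1. $\ell_n$ has a unique maximizer $\bar\theta_n$, is $C^3$ on $\mathcal B(\bar\theta_n,\bar\delta)$, and $\|\ell_n'''\|^*/n\le\bar M_1$ there. 2. $\pi>0$ and $1/\pi\le\bar M_2$ on $\mathcal B(\bar\theta_n,\bar\delta)$. 3. $\tilde f_n$ has a unique maximizer $\hat\theta_n$; on $\mathcal B(\hat\theta_n,\hat\delta)$ one has $\pi>0$, $\log\pi$ and $\tilde f_n$ are $C^3$, and $\|\tilde f_n'''\|^*/n\le\hat M_1$; and $\lambda_{\min}(-\tilde f_n''(\hat\theta_n)/n)>\hat\delta\hat M_1$. 4. $\max\{\|\bar\theta_n-\hat\theta_n\|,\sqrt{\operatorname{tr}[-\tilde f_n''(\hat\theta_n)^{-1}]}\}<\hat\delta$; $\ell_n''(\bar\theta_n)$ is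 invertible and $\sqrt{\operatorname{tr}[-\ell_n''(\bar\theta_n)^{-1}]}<\bar\delta$. 5. $(\ell_n(\theta)-\ell_n(\bar\theta_n))/n\le-\hat\kappa$ whenever $\|\theta-\bar\theta_n\|>\hat\delta-\|\bar\theta_n-\hat\theta_n\|$. **Notation.** $H_f=-\tilde f_n''(\hat\theta_n)/n$, $H_\ell=-\ell_n''(\bar\theta_n)/n$, $J=H_\ell+\tfrac{\bar M_1\bar\delta}{3}I$, $$\hat{\mathcal T}_n=-\tfrac12\Big(\hat\delta\sqrt n-\sqrt{\operatorname{tr}[H_f^{-1}]}\Big)^2\|H_f^{-1}\|_{\rm op}^{-1},\qquad \bar{\mathcal T}_J=-\tfrac12\Big(\bar\delta\sqrt n-\sqrt{\operatorname{tr}[J^{-1}]}\Big)^2\|J^{-1}\|_{\rm op}^{-1},$$ $$C_1=\frac{\sqrt3\,\operatorname{tr}[H_f^{-1}]\,\hat M_1}{4\sqrt{(\lambda_{\min}(H_f)-\hat\delta\hat M_1)(1-e^{\hat{\mathcal T}_n})}},\qquad C_2=\frac{2\,|\det(J^{-1})|^{-1/2}\,\bar M_2}{(2\pi)^{d_1/2}(1-e^{\bar{\mathcal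 T}_J})}\quad(\text{here } 2\pi \text{ is the number}).$$ **Theorem.** (i) For every $n\ge1$ and every realization of the data for which Assumptions 1–5 hold (the constants may depend on $n$ and on the data), $-\tilde f_n''(\hat\theta_n)$ is positive definite, $\exp\tilde f_n$ can be normalized to a probability law, and $$d_{TV}\big(\overline{q_n^{L}},\overline{q_n^{VI}}\big)\le C_1n^{-1/2}+2e^{\hat{\mathcal T}_n}+C_2\,n^{d_1/2}e^{-n\hat\kappa}.$$ (ii) Let $n\to\infty$ with $d_1,d_2,\pi$ and the constants $\bar\delta,\hat\delta,\bar M_1,\bar M_2,\hat M_1,\hat\kappa$ not depending on $n$, suppose that Assumptions 1–5 hold with probability tending to one, and that the normalized curvature $\|H_\ell\|_{\rm op}$ is bounded in probability. Then $d_{TV}(\overline{q_n^{L}},\overline{q_n^{VI}})\to0$ in probability. If moreover $\lambda_{\min}(H_f)-\hat\delta\hat M_1$ is bounded away from zero in probability, then the right-hand side of the bound in (i) also tends to $0$ in probability. -/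

import Mathlib

open MeasureTheory ProbabilityTheory Filter Topology
open scoped ENNReal

noncomputable section

namespace CALVI

/-- The parameter space `ℝ^d` with its Euclidean norm. -/
abbrev Param (d : ℕ) : Type := EuclideanSpace ℝ (Fin d)

/-! ### Mean-field setting -/

/-- `f` is a probability density with respect to Lebesgue measure. -/
structure IsProbDensity {d : ℕ} (f : Param d → ℝ) : Prop where
  measurable : Measurable f
  nonneg : ∀ x, 0 ≤ f x
  lintegral_eq_one : ∫⁻ x, ENNReal.ofReal (f x) = 1

/-- The ingredients of one coordinate update of the block `θ₁ ∈ ℝ^d₁`, at the observed data `y`: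
the prior density `π(θ₁)`, the likelihood `p(y, θ₂ ∣ θ₁)` as a function of `(θ₁, θ₂)`, and the
density `q₂` of the variational factor of the other block `θ₂ ∈ ℝ^d₂`, which is held fixed. -/
structure Block (d₁ d₂ : ℕ) where
  prior : Param d₁ → ℝ
  lik : Param d₁ → Param d₂ → ℝ
  factor : Param d₂ → ℝ

namespace Block

variable {d₁ d₂ : ℕ}

/-- `π` and `q₂` are probability densities, and the integral
`∫ q₂(θ₂) log p(y, θ₂ ∣ θ₁) dθ₂` is a genuine finite number for every `θ₁`. -/
structure WellPosed (B : Block d₁ d₂) : Prop where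
  prior_density : IsProbDensity B.prior
  factor_density : IsProbDensity B.factor
  lik_measurable : Measurable (Function.uncurry B.lik)
  lik_nonneg : ∀ θ₁ θ₂, 0 ≤ B.lik θ₁ θ₂
  lik_pos : ∀ θ₁, ∀ᵐ θ₂, 0 < B.factor θ₂ → 0 < B.lik θ₁ θ₂
  integrable : ∀ θ₁, Integrable fun θ₂ => B.factor θ₂ * Real.log (B.lik θ₁ θ₂)

/-- Variational log-likelihood `ℓ(θ₁) = ∫ q₂(θ₂) log p(y, θ₂ ∣ θ₁) dθ₂`. -/
def logLik (B : Block d₁ d₂) (θ₁ : Param d₁) : ℝ :=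
  ∫ θ₂, B.factor θ₂ * Real.log (B.lik θ₁ θ₂)

/-- Log prior as a real function; only meaningful where `π > 0`. -/
def logPrior (B : Block d₁ d₂) (θ₁ : Param d₁) : ℝ := Real.log (B.prior θ₁)

/-- Variational log-posterior `f̃ = ℓ + log π` as a real function (used for derivatives); only
meaningful where `π > 0`. -/
def logPost (B : Block d₁ d₂) (θ₁ : Param d₁) : ℝ := B.logLik θ₁ + B.logPrior θ₁

/-- Variational log-posterior `f̃ = ℓ + log π`, with value `-∞` where `π = 0`. -/
def logPostE (B : Block d₁ d₂) (θ₁ : Param d₁) : EReal :=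
  (B.logLik θ₁ : EReal) + ENNReal.log (ENNReal.ofReal (B.prior θ₁))

/-- Exact CAVI update `q^VI`: the normalized law with Lebesgue density proportional to `exp f̃`. -/
def exactUpdate (B : Block d₁ d₂) : Measure (Param d₁) :=
  (∫⁻ θ, EReal.exp (B.logPostE θ))⁻¹ • volume.withDensity fun θ => EReal.exp (B.logPostE θ)

end Block

/-! ### Derivatives, matrices, total variation -/

/-- Hessian matrix of second partial derivatives. -/
def hessian {d : ℕ} (f : Param d → ℝ) (x : Param d) : Matrix (Fin d) (Fin d) ℝ :=
  Matrix.of fun i j =>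
    iteratedFDeriv ℝ 2 f x ![EuclideanSpace.single i 1, EuclideanSpace.single j 1]

/-- `‖f'''(x)‖* = sup_{‖a‖, ‖b‖, ‖c‖ ≤ 1} |f'''(x)[a, b, c]|`, the operator norm of the third
derivative as a trilinear form. At boundary points of `s` the derivative is taken within `s`. -/
def thirdDerivNorm {d : ℕ} (f : Param d → ℝ) (s : Set (Param d)) (x : Param d) : ℝ :=
  ‖iteratedFDerivWithin ℝ 3 f s x‖

/-- Smallest eigenvalue (of a symmetric matrix). -/
def lambdaMin {d : ℕ} (A : Matrix (Fin d) (Fin d) ℝ) : ℝ := sInf (spectrum ℝ A)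

/-- Operator norm with respect to the Euclidean norm. -/
def opNorm {d : ℕ} (A : Matrix (Fin d) (Fin d) ℝ) : ℝ := ‖Matrix.toEuclideanCLM (𝕜 := ℝ) A‖

/-- Total variation distance `sup_A |μ A - ν A|` of two probability measures. -/
def tvDist {X : Type*} [MeasurableSpace X] (μ ν : Measure X) : ℝ :=
  ⨆ A : {A : Set X // MeasurableSet A}, |μ.real A - ν.real A|

/-- `x` is the unique global maximizer of `f`. -/
def IsUniqueMax {X Y : Type*} [Preorder Y] (f : X → Y) (x : X) : Prop := ∀ y, y ≠ x → f y < f x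

/-! ### Assumptions -/

/-- Radii `δ̄, δ̂` and bounds `M̄₁, M̄₂, M̂₁, κ̂` in the assumptions. -/
structure Consts where
  δbar : ℝ
  δhat : ℝ
  Mbar₁ : ℝ
  Mbar₂ : ℝ
  Mhat₁ : ℝ
  κhat : ℝ

variable {d₁ d₂ : ℕ}

/-- The variational log-likelihood has the unique maximizer `θbar`, is `C³` on the closed ball of
radius `δ̄` around it, and its third derivative there is at most `n M̄₁`. -/
structure LikelihoodRegular (n : ℕ) (B : Block d₁ d₂) (θbar : Param d₁) (c : Consts) : Prop where
  unique_max : IsUniqueMax B.logLik θbar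
  δbar_pos : 0 < c.δbar
  contDiffOn : ContDiffOn ℝ 3 B.logLik (Metric.closedBall θbar c.δbar)
  Mbar₁_pos : 0 < c.Mbar₁
  third_le : ∀ θ ∈ Metric.closedBall θbar c.δbar,
    thirdDerivNorm B.logLik (Metric.closedBall θbar c.δbar) θ / n ≤ c.Mbar₁

/-- The prior density is bounded away from zero on the ball of radius `δ̄` around `θbar`. -/
structure PriorBoundedBelow (B : Block d₁ d₂) (θbar : Param d₁) (c : Consts) : Prop where
  Mbar₂_pos : 0 < c.Mbar₂
  prior_pos : ∀ θ ∈ Metric.closedBall θbar c.δbar, 0 < B.prior θ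
  inv_le : ∀ θ ∈ Metric.closedBall θbar c.δbar, |1 / B.prior θ| ≤ c.Mbar₂

/-- The variational log-posterior has the unique maximizer `θhat`; on the closed ball of radius `δ̂`
around it the log prior is (finite and) `C³`, the log-posterior has a continuous third derivative
bounded by `n M̂₁`; and the normalized negative Hessian at `θhat` has smallest eigenvalue larger
than `δ̂ M̂₁`. -/
structure PosteriorRegular (n : ℕ) (B : Block d₁ d₂) (θhat : Param d₁) (c : Consts) : Prop where
  unique_max : IsUniqueMax B.logPostE θhat
  δhat_pos : 0 < c.δhat
  prior_pos : ∀ θ ∈ Metric.closedBall θhat c.δhat, 0 < B.prior θ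
  contDiffOn_logPrior : ContDiffOn ℝ 3 B.logPrior (Metric.closedBall θhat c.δhat)
  contDiffOn_logPost : ContDiffOn ℝ 3 B.logPost (Metric.closedBall θhat c.δhat)
  Mhat₁_pos : 0 < c.Mhat₁
  third_le : ∀ θ ∈ Metric.closedBall θhat c.δhat,
    thirdDerivNorm B.logPost (Metric.closedBall θhat c.δhat) θ / n ≤ c.Mhat₁
  lt_lambdaMin : c.δhat * c.Mhat₁ < lambdaMin (-((n : ℝ)⁻¹ • hessian B.logPost θhat))

/-- Trace and proximity conditions; the Hessian of the log-likelihood at `θbar` is invertible. -/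
structure TraceProximity (B : Block d₁ d₂) (θbar θhat : Param d₁) (c : Consts) : Prop where
  post_lt : max ‖θbar - θhat‖ √(-(hessian B.logPost θhat)⁻¹).trace < c.δhat
  lik_isUnit : IsUnit (hessian B.logLik θbar)
  lik_lt : √(-(hessian B.logLik θbar)⁻¹).trace < c.δbar

/-- Tail decay of the variational log-likelihood. -/
structure TailDecay (n : ℕ) (B : Block d₁ d₂) (θbar θhat : Param d₁) (c : Consts) : Prop where
  κhat_pos : 0 < c.κhat
  decay : ∀ θ, c.δhat - ‖θbar - θhat‖ < ‖θ - θbar‖ →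
    (B.logLik θ - B.logLik θbar) / n ≤ -c.κhat

/-- All the assumptions at sample size `n`. -/
structure Assumptions (n : ℕ) (B : Block d₁ d₂) (θbar θhat : Param d₁) (c : Consts) : Prop where
  likelihood : LikelihoodRegular n B θbar c
  prior : PriorBoundedBelow B θbar c
  posterior : PosteriorRegular n B θhat c
  trace : TraceProximity B θbar θhat c
  tail : TailDecay n B θbar θhat c

/-! ### The two updates on the rescaled `n^{-1/2}` scale -/

/-- Laplace update `N(θhat, [-f̃''(θhat)]⁻¹)`. -/
def laplaceUpdate (B : Block d₁ d₂) (θhat : Param d₁) : Measure (Param d₁) :=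
  multivariateGaussian θhat (-hessian B.logPost θhat)⁻¹

/-- Law of `√n (θ - θhat)` when `θ` has law `μ`. -/
def rescale (n : ℕ) (θhat : Param d₁) (μ : Measure (Param d₁)) : Measure (Param d₁) :=
  μ.map fun θ => √(n : ℝ) • (θ - θhat)

/-- Total variation distance between the rescaled Laplace update and the rescaled exact update. -/
def laplaceError (n : ℕ) (B : Block d₁ d₂) (θhat : Param d₁) : ℝ :=
  tvDist (rescale n θhat (laplaceUpdate B θhat)) (rescale n θhat B.exactUpdate)

/-! ### The explicit bound -/

/-- `H_f = -f̃''(θhat) / n`. -/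
def Hf (n : ℕ) (B : Block d₁ d₂) (θhat : Param d₁) : Matrix (Fin d₁) (Fin d₁) ℝ :=
  -((n : ℝ)⁻¹ • hessian B.logPost θhat)

/-- `H_ℓ = -ℓ''(θbar) / n`. -/
def Hl (n : ℕ) (B : Block d₁ d₂) (θbar : Param d₁) : Matrix (Fin d₁) (Fin d₁) ℝ :=
  -((n : ℝ)⁻¹ • hessian B.logLik θbar)

/-- `J = H_ℓ + (M̄₁ δ̄ / 3) I`. -/
def Jmat (n : ℕ) (B : Block d₁ d₂) (θbar : Param d₁) (c : Consts) : Matrix (Fin d₁) (Fin d₁) ℝ :=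
  Hl n B θbar + (c.Mbar₁ * c.δbar / 3) • (1 : Matrix (Fin d₁) (Fin d₁) ℝ)

/-- `-(1/2) (δ √n - √(tr A⁻¹))² ‖A⁻¹‖⁻¹`. -/
def tailExponent (n : ℕ) (δ : ℝ) (A : Matrix (Fin d₁) (Fin d₁) ℝ) : ℝ :=
  -(1 / 2) * (δ * √(n : ℝ) - √(A⁻¹).trace) ^ 2 * (opNorm A⁻¹)⁻¹

/-- `T̂_n`. -/
def That (n : ℕ) (B : Block d₁ d₂) (θhat : Param d₁) (c : Consts) : ℝ :=
  tailExponent n c.δhat (Hf n B θhat)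

/-- `T̄_J`. -/
def TbarJ (n : ℕ) (B : Block d₁ d₂) (θbar : Param d₁) (c : Consts) : ℝ :=
  tailExponent n c.δbar (Jmat n B θbar c)

/-- `C₁`. -/
def C₁ (n : ℕ) (B : Block d₁ d₂) (θhat : Param d₁) (c : Consts) : ℝ :=
  √3 * ((Hf n B θhat)⁻¹).trace * c.Mhat₁ /
    (4 * √((lambdaMin (Hf n B θhat) - c.δhat * c.Mhat₁) * (1 - Real.exp (That n B θhat c))))

/-- `C₂`. -/
def C₂ (n : ℕ) (B : Block d₁ d₂) (θbar : Param d₁) (c : Consts) : ℝ :=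
  2 * |((Jmat n B θbar c)⁻¹).det| ^ (-(1 / 2) : ℝ) * c.Mbar₂ /
    ((2 * Real.pi) ^ ((d₁ : ℝ) / 2) * (1 - Real.exp (TbarJ n B θbar c)))

/-- `C₁ n^{-1/2} + 2 exp(T̂_n) + C₂ n^{d₁/2} exp(-n κ̂)`. -/
def errorBound (n : ℕ) (B : Block d₁ d₂) (θbar θhat : Param d₁) (c : Consts) : ℝ :=
  C₁ n B θhat c * (n : ℝ) ^ (-(1 / 2) : ℝ) + 2 * Real.exp (That n B θhat c)
    + C₂ n B θbar c * (n : ℝ) ^ ((d₁ : ℝ) / 2) * Real.exp (-(n * c.κhat))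

/-! ### Stochastic order -/

/-- The real random variables `Z n` are bounded in probability, `Z n = O_P(1)`, from above. -/
def BoundedAboveInProb {Ω : Type*} [MeasurableSpace Ω] (P : Measure Ω) (Z : ℕ → Ω → ℝ) : Prop :=
  ∀ ε : ℝ≥0∞, 0 < ε → ∃ K : ℝ, ∀ᶠ n in atTop, P {ω | K < Z n ω} ≤ ε

/-- The real random variables `Z n` are bounded away from zero (from below) in probability. -/
def BoundedAwayFromZeroInProb {Ω : Type*} [MeasurableSpace Ω] (P : Measure Ω) (Z : ℕ → Ω → ℝ) :
    Prop :=
  ∀ ε : ℝ≥0∞, 0 < ε → ∃ η : ℝ, 0 < η ∧ ∀ᶠ n in atTop, P {ω | Z n ω < η} ≤ ε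

end CALVI

end

namespace CALVI

/-! ### The Prékopa–Leindler inequality for midpoints -/

/-! Let K be the ball of radius δ̂ around θ̂, γ the Laplace law and ν the exact update. The triangle
inequality through the conditioned laws γ|K and ν|K leaves three errors: γ(Kᶜ), ν(Kᶜ) and the
distance of the conditioned laws (`laplaceError_le_of_ball`).

The third-derivative bound moves the Hessian of f̃ by at most n δ̂ M̂₁ on K, so ν|K is strongly
log-concave with constant ρ = n (λ_min(H_f) - δ̂ M̂₁). Write γ|K = e^w ν|K. The function e^{w/2} has
mean square 1 under ν|K, so its variance is 1 - b², where b is the Hellinger affinity of the two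
laws. The Poincaré inequality with constant 1/ρ bounds 1 - b² by ∫ |∇w|² dγ|K / (4ρ), and total
variation is at most √(1 - b²); this is `MidpointLogConcave.abs_real_sub_le`. Here ∇w is minus the
first-order Taylor remainder of ∇f̃ at θ̂, of size at most n M̂₁ ‖θ - θ̂‖² / 2. Hence only the
fourth moment of a Gaussian enters, and it is at most three times the squared trace of the
covariance. This yields the term C₁ n^{-1/2}.

The Poincaré inequality comes from Prékopa–Leindler for midpoints. Applied to p e^u, p e^v and p, it
bounds a product of exponential integrals by 1 when u(x) + v(y) is dominated by the strong
log-concavity gain ρ/4 ‖x - y‖². Taking u and v of order ε and comparing the terms of order ε² gives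
the variance bound.

The mass γ(Kᶜ) is a Chernoff bound for the norm of a Gaussian vector
(`multivariateGaussian_norm_ge_le`). For ν(Kᶜ), the unnormalized mass outside K is at most exp(ℓ(θ̄)
- n κ̂), because the prior has mass 1. The normalizing integral is bounded below by a Gaussian
integral with precision n J: on the ball of radius δ̄ the cubic Taylor term of ℓ at θ̄ is dominated
by a quadratic one, and this is the multiple of the identity in J (`le_lintegral_weight`).

For the limit, λ_min(H_f) - δ̂ M̂₁ is positive but may tend to 0, which ruins the bound on K. On the
ball of half the radius the gap is at least δ̂ M̂₁ / 2. The price is the mass of ν in the annulus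
between the balls, exponentially small by concavity of f̃ on K
(`Assumptions.exactUpdate_annulus_le`). When the full gap stays away from 0, each term of the
explicit bound itself has a deterministic null majorant. -/

theorem volume_add_le_of_isCompact {K L D : Set ℝ} (hK : IsCompact K) (hL : IsCompact L)
    (hKne : K.Nonempty) (hLne : L.Nonempty) (h : ∀ x ∈ K, ∀ y ∈ L, x + y ∈ D) :
    volume K + volume L ≤ volume D := by
  obtain ⟨a, ha, hamax⟩ := hK.exists_isGreatest hKne
  obtain ⟨b, hb, hbmin⟩ := hL.exists_isLeast hLne
  -- The translates K + min L and max K + L both lie in K + L and meet at most in the point max K +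
  -- min L, so their measures add up.
  set K' : Set ℝ := (fun t => -b + t) ⁻¹' K
  set L' : Set ℝ := (fun t => -a + t) ⁻¹' L
  have hKv : volume K' = volume K := measure_preimage_add volume (-b) K
  have hLv : volume L' = volume L := measure_preimage_add volume (-a) L
  have hL'm : MeasurableSet L' := hL.measurableSet.preimage (by fun_prop)
  have hsub : K' ∪ L' ⊆ D := by
    rintro z (hz | hz)
    · simpa using h _ hz b hb
    · simpa using h a ha _ hz
  have hint : K' ∩ L' ⊆ {a + b} := by
    rintro z ⟨h1, h2⟩
    have e1 : -b + z ≤ a := hamax h1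
    have e2 : b ≤ -a + z := hbmin h2
    simp only [Set.mem_singleton_iff]
    linarith
  have hzero : volume (K' ∩ L') = 0 := measure_mono_null hint (by simp)
  calc volume K + volume L = volume (K' ∪ L') := by
        rw [← hKv, ← hLv, ← measure_union_add_inter K' hL'm, hzero, add_zero]
    _ ≤ volume D := measure_mono hsub

/-- One-dimensional Brunn–Minkowski inequality for midpoints. -/
theorem volume_add_le_two_mul_volume {A B C : Set ℝ} (hA : MeasurableSet A) (hB : MeasurableSet B)
    (hAne : A.Nonempty) (hBne : B.Nonempty) (h : ∀ x ∈ A, ∀ y ∈ B, (x + y) / 2 ∈ C) :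
    volume A + volume B ≤ 2 * volume C := by
  set D : Set ℝ := (fun t => (1 / 2) * t) ⁻¹' C
  have hD : volume D = 2 * volume C := by
    rw [Real.volume_preimage_mul_left (by norm_num)]
    norm_num
  rw [← hD]
  obtain ⟨a, ha⟩ := hAne
  obtain ⟨b, hb⟩ := hBne
  rw [hA.measure_eq_iSup_isCompact, hB.measure_eq_iSup_isCompact]
  have hemp : ∀ S : Set ℝ, ∃ K, K ⊆ S ∧ IsCompact K := fun S =>
    ⟨∅, Set.empty_subset _, isCompact_empty⟩
  simp only [iSup_and']
  refine ENNReal.biSup_add_biSup_le' (p := fun K => K ⊆ A ∧ IsCompact K)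
    (q := fun L => L ⊆ B ∧ IsCompact L) (hemp A) (hemp B) ?_
  rintro K ⟨hKA, hK⟩ L ⟨hLB, hL⟩
  -- Compact sets supplied by inner regularity may be empty; inserting a point of `A` and of `B`
  -- keeps them compact and makes the compact case applicable.
  calc volume K + volume L ≤ volume (insert a K) + volume (insert b L) :=
        add_le_add (measure_mono (Set.subset_insert _ _)) (measure_mono (Set.subset_insert _ _))
    _ ≤ volume D := by
        refine volume_add_le_of_isCompact (hK.insert a) (hL.insert b) (Set.insert_nonempty _ _)
          (Set.insert_nonempty _ _) fun x hx y hy => ?_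
        have hxA : x ∈ A := Set.insert_subset ha hKA hx
        have hyB : y ∈ B := Set.insert_subset hb hLB hy
        have := h x hxA y hyB
        simp only [D, Set.mem_preimage]
        convert this using 1
        ring

/-- Layer-cake formula and one-dimensional Brunn–Minkowski at each level t. The common supremum 1
makes the superlevel sets of `F` and `G` nonempty for the same t, namely t < 1; from t = 1 on both
are empty. -/
theorem lintegral_add_le_two_mul_of_iSup_eq_one {F G H : ℝ → ℝ} (hF : Measurable F)
    (hG : Measurable G) (hH : Measurable H) (hF0 : ∀ x, 0 ≤ F x) (hG0 : ∀ x, 0 ≤ G x)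
    (hH0 : ∀ x, 0 ≤ H x) (hF1 : ∀ x, F x ≤ 1) (hG1 : ∀ x, G x ≤ 1)
    (hFs : ∀ t < 1, ∃ x, t < F x) (hGs : ∀ t < 1, ∃ x, t < G x)
    (h : ∀ x y, F x * G y ≤ H ((x + y) / 2) ^ 2) :
    (∫⁻ x, ENNReal.ofReal (F x)) + ∫⁻ x, ENNReal.ofReal (G x) ≤
      2 * ∫⁻ x, ENNReal.ofReal (H x) := by
  rw [lintegral_eq_lintegral_meas_lt _ (.of_forall hF0) hF.aemeasurable,
    lintegral_eq_lintegral_meas_lt _ (.of_forall hG0) hG.aemeasurable,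
    lintegral_eq_lintegral_meas_lt _ (.of_forall hH0) hH.aemeasurable]
  have hanti : Antitone fun t : ℝ => volume {a | t < F a} := fun s t hst =>
    measure_mono fun a (ha : t < F a) => lt_of_le_of_lt hst ha
  have hantiH : Antitone fun t : ℝ => volume {a | t < H a} := fun s t hst =>
    measure_mono fun a (ha : t < H a) => lt_of_le_of_lt hst ha
  rw [← lintegral_add_left hanti.measurable, ← lintegral_const_mul _ hantiH.measurable]
  refine setLIntegral_mono' measurableSet_Ioi fun t ht => ?_
  have ht0 : (0 : ℝ) < t := ht
  rcases lt_or_ge t 1 with ht1 | ht1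
  · refine volume_add_le_two_mul_volume (measurableSet_lt measurable_const hF)
      (measurableSet_lt measurable_const hG) (hFs t ht1) (hGs t ht1) fun x hx y hy => ?_
    have hx' : t < F x := hx
    have hy' : t < G y := hy
    have h1 : t ^ 2 < H ((x + y) / 2) ^ 2 := by
      refine lt_of_lt_of_le ?_ (h x y)
      rw [sq]
      exact mul_lt_mul'' hx' hy' ht0.le ht0.le
    exact lt_of_pow_lt_pow_left₀ 2 (hH0 _) h1
  · have e1 : {a | t < F a} = ∅ := by
      ext a; simpa using (hF1 a).trans ht1
    have e2 : {a | t < G a} = ∅ := by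
      ext a; simpa using (hG1 a).trans ht1
    simp [e1, e2]

theorem mul_le_sq_of_add_le_two_mul {a b c : ℝ≥0∞} (h : a + b ≤ 2 * c) : a * b ≤ c ^ 2 := by
  rcases eq_or_ne c ∞ with rfl | hc
  · simp
  have hab : a + b ≠ ∞ := ne_top_of_le_ne_top (ENNReal.mul_ne_top (by simp) hc) h
  have ha : a ≠ ∞ := fun h => by simp [h] at hab
  have hb : b ≠ ∞ := fun h => by simp [h] at hab
  lift a to NNReal using ha
  lift b to NNReal using hb
  lift c to NNReal using hc
  norm_cast at *
  have h' : (a : ℝ) + b ≤ 2 * c := by exact_mod_cast h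
  have : (a : ℝ) * b ≤ (c : ℝ) ^ 2 := by
    nlinarith [sq_nonneg ((a : ℝ) - b), a.coe_nonneg, b.coe_nonneg, c.coe_nonneg]
  exact_mod_cast this

/-- Dividing `F`, `G` by their suprema a, b and `H` by √(ab) preserves the hypothesis. The additive
inequality then becomes the multiplicative one through the arithmetic-geometric mean inequality. -/
theorem prekopa_leindler_real_of_bounded {F G H : ℝ → ℝ≥0∞} (hF : Measurable F)
    (hG : Measurable G) (hH : Measurable H) (k : ℝ≥0∞) (hk : k ≠ ∞) (hFk : ∀ x, F x ≤ k)
    (hGk : ∀ x, G x ≤ k) (h : ∀ x y, F x * G y ≤ H ((x + y) / 2) ^ 2) :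
    (∫⁻ x, F x) * ∫⁻ x, G x ≤ (∫⁻ x, H x) ^ 2 := by
  set a := ⨆ x, F x with ha_def
  set b := ⨆ x, G x with hb_def
  have haF : ∀ x, F x ≤ a := fun x => le_iSup F x
  have hbG : ∀ x, G x ≤ b := fun x => le_iSup G x
  have ha : a ≠ ∞ := ne_top_of_le_ne_top hk (iSup_le hFk)
  have hb : b ≠ ∞ := ne_top_of_le_ne_top hk (iSup_le hGk)
  rcases eq_or_ne a 0 with ha0 | ha0
  · have : ∀ x, F x = 0 := fun x => le_antisymm ((haF x).trans ha0.le) bot_le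
    simp [this]
  rcases eq_or_ne b 0 with hb0 | hb0
  · have : ∀ x, G x = 0 := fun x => le_antisymm ((hbG x).trans hb0.le) bot_le
    simp [this]
  have har : 0 < a.toReal := ENNReal.toReal_pos ha0 ha
  have hbr : 0 < b.toReal := ENNReal.toReal_pos hb0 hb
  set c : ℝ := √(a.toReal * b.toReal)
  have hc : 0 < c := Real.sqrt_pos.2 (mul_pos har hbr)
  have hc2 : c ^ 2 = a.toReal * b.toReal := Real.sq_sqrt (mul_pos har hbr).le
  -- Capping `H` at c keeps the hypothesis, since F(x) G(y) never exceeds ab = c², and makes it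
  -- finite, hence representable by a real function.
  set H' : ℝ → ℝ≥0∞ := fun x => min (H x) (ENNReal.ofReal c)
  have hH'top : ∀ x, H' x ≠ ∞ := fun x =>
    ne_top_of_le_ne_top ENNReal.ofReal_ne_top (min_le_right _ _)
  have hFtop : ∀ x, F x ≠ ∞ := fun x => ne_top_of_le_ne_top ha (haF x)
  have hGtop : ∀ x, G x ≠ ∞ := fun x => ne_top_of_le_ne_top hb (hbG x)
  have hFr : ∀ x, (F x).toReal ≤ a.toReal := fun x => ENNReal.toReal_mono ha (haF x)
  have hGr : ∀ x, (G x).toReal ≤ b.toReal := fun x => ENNReal.toReal_mono hb (hbG x)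
  have key : ∀ x y, (F x).toReal * (G y).toReal ≤ (H' ((x + y) / 2)).toReal ^ 2 := by
    intro x y
    have h1 : F x * G y ≤ H' ((x + y) / 2) ^ 2 := by
      simp only [H']
      rcases min_cases (H ((x + y) / 2)) (ENNReal.ofReal c) with ⟨e, -⟩ | ⟨e, -⟩
      · rw [e]; exact h x y
      · rw [e, ← ENNReal.ofReal_pow hc.le, hc2, ENNReal.ofReal_mul har.le,
          ENNReal.ofReal_toReal ha, ENNReal.ofReal_toReal hb]
        exact mul_le_mul' (haF x) (hbG y)
    rw [← ENNReal.toReal_mul, ← ENNReal.toReal_pow]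
    exact ENNReal.toReal_mono (ENNReal.pow_ne_top (hH'top _)) h1
  have main := lintegral_add_le_two_mul_of_iSup_eq_one
    (F := fun x => (F x).toReal / a.toReal) (G := fun x => (G x).toReal / b.toReal)
    (H := fun x => (H' x).toReal / c) (hF.ennreal_toReal.div_const _)
    (hG.ennreal_toReal.div_const _) ((hH.min measurable_const).ennreal_toReal.div_const _)
    (fun x => by positivity) (fun x => by positivity) (fun x => by positivity)
    (fun x => (div_le_one har).2 (hFr x)) (fun x => (div_le_one hbr).2 (hGr x))
    (fun t ht => by
      have : ENNReal.ofReal (t * a.toReal) < a := by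
        rw [← ENNReal.ofReal_toReal ha, ENNReal.ofReal_lt_ofReal_iff har,
          ENNReal.toReal_ofReal har.le]
        nlinarith
      obtain ⟨x, hx⟩ := lt_iSup_iff.1 this
      refine ⟨x, ?_⟩
      rw [lt_div_iff₀ har]
      rw [← ENNReal.ofReal_toReal (hFtop x)] at hx
      exact lt_of_not_ge fun hle => absurd (ENNReal.ofReal_le_ofReal hle) (not_le.2 hx))
    (fun t ht => by
      have : ENNReal.ofReal (t * b.toReal) < b := by
        rw [← ENNReal.ofReal_toReal hb, ENNReal.ofReal_lt_ofReal_iff hbr,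
          ENNReal.toReal_ofReal hbr.le]
        nlinarith
      obtain ⟨x, hx⟩ := lt_iSup_iff.1 this
      refine ⟨x, ?_⟩
      rw [lt_div_iff₀ hbr]
      rw [← ENNReal.ofReal_toReal (hGtop x)] at hx
      exact lt_of_not_ge fun hle => absurd (ENNReal.ofReal_le_ofReal hle) (not_le.2 hx))
    (fun x y => by
      rw [div_mul_div_comm, div_pow, hc2]
      gcongr
      exact key x y)
  have e : ∀ (Q : ℝ → ℝ≥0∞) (q : ℝ), Measurable Q → 0 < q → (∀ x, Q x ≠ ∞) →
      ∫⁻ x, ENNReal.ofReal ((Q x).toReal / q) = (∫⁻ x, Q x) / ENNReal.ofReal q := by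
    intro Q q hQ hq hQt
    simp_rw [ENNReal.ofReal_div_of_pos hq, ENNReal.ofReal_toReal (hQt _), div_eq_mul_inv]
    rw [lintegral_mul_const _ hQ]
  rw [e F _ hF har hFtop, e G _ hG hbr hGtop, e H' _ (hH.min measurable_const) hc hH'top] at main
  have main2 := mul_le_sq_of_add_le_two_mul main
  have hc2' : ENNReal.ofReal c ^ 2 = ENNReal.ofReal a.toReal * ENNReal.ofReal b.toReal := by
    rw [← ENNReal.ofReal_pow hc.le, hc2, ENNReal.ofReal_mul har.le]
  have hA0 : ENNReal.ofReal a.toReal ≠ 0 := by simpa using har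
  have hB0 : ENNReal.ofReal b.toReal ≠ 0 := by simpa using hbr
  calc (∫⁻ x, F x) * ∫⁻ x, G x
      = ((∫⁻ x, F x) / ENNReal.ofReal a.toReal * ((∫⁻ x, G x) / ENNReal.ofReal b.toReal)) *
          (ENNReal.ofReal a.toReal * ENNReal.ofReal b.toReal) := by
        rw [mul_mul_mul_comm, ENNReal.div_mul_cancel hA0 (by simp),
          ENNReal.div_mul_cancel hB0 (by simp)]
    _ ≤ ((∫⁻ x, H' x) / ENNReal.ofReal c) ^ 2 * ENNReal.ofReal c ^ 2 := by
        rw [hc2']; gcongr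
    _ = (∫⁻ x, H' x) ^ 2 := by
        rw [← mul_pow, ENNReal.div_mul_cancel (by simpa using hc) (by simp)]
    _ ≤ (∫⁻ x, H x) ^ 2 := by
        gcongr with x; exact min_le_left _ _

theorem prekopa_leindler_real {F G H : ℝ → ℝ≥0∞} (hF : Measurable F)
    (hG : Measurable G) (hH : Measurable H) (h : ∀ x y, F x * G y ≤ H ((x + y) / 2) ^ 2) :
    (∫⁻ x, F x) * ∫⁻ x, G x ≤ (∫⁻ x, H x) ^ 2 := by
  have trunc : ∀ Q : ℝ → ℝ≥0∞, Measurable Q →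
      Tendsto (fun k : ℕ => ∫⁻ x, min (Q x) k) atTop (𝓝 (∫⁻ x, Q x)) := by
    intro Q hQ
    refine lintegral_tendsto_of_tendsto_of_monotone
      (fun k => (hQ.min measurable_const).aemeasurable) (.of_forall fun x i j hij => ?_)
      (.of_forall fun x => ?_)
    · exact min_le_min le_rfl (by exact_mod_cast hij)
    · have := (tendsto_const_nhds (x := Q x)).min ENNReal.tendsto_nat_nhds_top
      simpa using this
  have hb : ∀ k : ℕ, (∫⁻ x, min (F x) k) * ∫⁻ x, min (G x) k ≤ (∫⁻ x, H x) ^ 2 := fun k =>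
    prekopa_leindler_real_of_bounded (hF.min measurable_const) (hG.min measurable_const) hH k
      (by simp) (fun x => min_le_right _ _) (fun x => min_le_right _ _)
      (fun x y => (mul_le_mul' (min_le_left _ _) (min_le_left _ _)).trans (h x y))
  have hmono : ∀ Q : ℝ → ℝ≥0∞, Measurable Q → ∫⁻ x, Q x = ⨆ k : ℕ, ∫⁻ x, min (Q x) k := by
    intro Q hQ
    refine tendsto_nhds_unique (trunc Q hQ) (tendsto_atTop_iSup fun i j hij => ?_)
    exact lintegral_mono fun x => min_le_min le_rfl (by exact_mod_cast hij)
  rw [hmono F hF, hmono G hG]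
  rw [ENNReal.iSup_mul]
  refine iSup_le fun i => ?_
  rw [ENNReal.mul_iSup]
  refine iSup_le fun j => ?_
  refine le_trans (mul_le_mul' ?_ ?_) (hb (max i j))
  · exact lintegral_mono fun x => min_le_min le_rfl (by exact_mod_cast le_max_left i j)
  · exact lintegral_mono fun x => min_le_min le_rfl (by exact_mod_cast le_max_right i j)

/-- Induction on the dimension. Slices at first coordinates s, t and (s + t)/2 satisfy the
hypothesis in one dimension less, so by induction the slice integrals satisfy the hypothesis of the
real case. -/
theorem prekopa_leindler_pi : ∀ {d : ℕ} {F G H : (Fin d → ℝ) → ℝ≥0∞}, Measurable F →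
    Measurable G → Measurable H →
    (∀ x y, F x * G y ≤ H ((1 / 2 : ℝ) • (x + y)) ^ 2) →
    (∫⁻ x, F x) * ∫⁻ x, G x ≤ (∫⁻ x, H x) ^ 2
  | 0, F, G, H, hF, hG, hH, h => by
    simp only [lintegral_unique]
    have := h default default
    rw [Subsingleton.elim ((1 / 2 : ℝ) • (default + default)) (default : Fin 0 → ℝ)] at this
    have hv : (volume : Measure (Fin 0 → ℝ)) Set.univ = 1 := by
      simp [volume_pi]
    rw [hv]
    simp only [mul_one]
    convert this
  | d + 1, F, G, H, hF, hG, hH, h => by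
    set e := MeasurableEquiv.piFinSuccAbove (fun _ : Fin (d + 1) => ℝ) 0
    have he := volume_preserving_piFinSuccAbove (fun _ : Fin (d + 1) => ℝ) 0
    have split : ∀ Q : (Fin (d + 1) → ℝ) → ℝ≥0∞, Measurable Q →
        ∫⁻ x, Q x = ∫⁻ t : ℝ, ∫⁻ z : Fin d → ℝ, Q (e.symm (t, z)) := by
      intro Q hQ
      have hQe : Measurable fun p => Q (e.symm p) := hQ.comp e.symm.measurable
      have h1 : ∫⁻ x, Q x = ∫⁻ x, Q (e.symm (e x)) := by simp
      rw [h1]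
      rw [he.lintegral_comp (f := fun p => Q (e.symm p)) hQe]
      exact lintegral_prod _ hQe.aemeasurable
    have meas : ∀ Q : (Fin (d + 1) → ℝ) → ℝ≥0∞, Measurable Q →
        Measurable fun p : ℝ × (Fin d → ℝ) => Q (e.symm p) := fun Q hQ =>
      hQ.comp e.symm.measurable
    rw [split F hF, split G hG, split H hH]
    refine prekopa_leindler_real (meas F hF).lintegral_prod_right'
      (meas G hG).lintegral_prod_right' (meas H hH).lintegral_prod_right' fun s t => ?_
    refine prekopa_leindler_pi ((meas F hF).comp measurable_prodMk_left)
      ((meas G hG).comp measurable_prodMk_left) ((meas H hH).comp measurable_prodMk_left)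
      fun x y => ?_
    have := h (e.symm (s, x)) (e.symm (t, y))
    convert this using 3
    simp only [e, MeasurableEquiv.piFinSuccAbove_symm_apply]
    ext i
    refine Fin.cases ?_ (fun j => ?_) i
    · simp; ring
    · simp; ring

/-- Prékopa–Leindler inequality for midpoints. -/
theorem prekopa_leindler {d : ℕ} {F G H : Param d → ℝ≥0∞} (hF : Measurable F)
    (hG : Measurable G) (hH : Measurable H)
    (h : ∀ x y, F x * G y ≤ H ((1 / 2 : ℝ) • (x + y)) ^ 2) :
    (∫⁻ x, F x) * ∫⁻ x, G x ≤ (∫⁻ x, H x) ^ 2 := by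
  have hp := PiLp.volume_preserving_toLp (Fin d)
  rw [← hp.lintegral_comp hF, ← hp.lintegral_comp hG, ← hp.lintegral_comp hH]
  refine prekopa_leindler_pi (hF.comp hp.measurable) (hG.comp hp.measurable)
    (hH.comp hp.measurable) fun x y => ?_
  simpa using h (WithLp.toLp 2 x) (WithLp.toLp 2 y)

/-! ### Poincaré inequality for strongly log-concave densities -/

section Poincare

/-- Subtract 1, divide by ε² and let ε tend to 0. The two nonnegativity premises inside `h` hold for
all small ε and allow lower bounds of integrals to be multiplied when `h` is verified. -/
theorem add_nonpos_of_forall_mul_le_one {a b E ε₀ : ℝ} (hε₀ : 0 < ε₀)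
    (h : ∀ ε, 0 < ε → ε ≤ ε₀ → 0 ≤ 1 + ε ^ 2 * a - ε ^ 3 * E → 0 ≤ 1 + ε ^ 2 * b - ε ^ 3 * E →
      (1 + ε ^ 2 * a - ε ^ 3 * E) * (1 + ε ^ 2 * b - ε ^ 3 * E) ≤ 1) : a + b ≤ 0 := by
  have hlim : Tendsto (fun ε : ℝ => (a - ε * E) + (b - ε * E) +
      ε ^ 2 * ((a - ε * E) * (b - ε * E))) (𝓝[>] 0) (𝓝 (a + b)) := by
    have : Continuous fun ε : ℝ => (a - ε * E) + (b - ε * E) +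
      ε ^ 2 * ((a - ε * E) * (b - ε * E)) := by fun_prop
    have h1 := this.tendsto 0
    simp only [zero_mul, sub_zero, ne_eq, OfNat.ofNat_ne_zero, not_false_eq_true, zero_pow,
      add_zero] at h1
    exact h1.mono_left nhdsWithin_le_nhds
  have pos : ∀ c : ℝ, ∀ᶠ ε : ℝ in 𝓝[>] 0, 0 ≤ 1 + ε ^ 2 * c - ε ^ 3 * E := by
    intro c
    have : Continuous fun ε : ℝ => 1 + ε ^ 2 * c - ε ^ 3 * E := by fun_prop
    have h1 : Tendsto (fun ε : ℝ => 1 + ε ^ 2 * c - ε ^ 3 * E) (𝓝[>] 0) (𝓝 1) := by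
      have := this.tendsto 0
      simp only [ne_eq, OfNat.ofNat_ne_zero, not_false_eq_true, zero_pow, zero_mul, add_zero,
        sub_zero] at this
      exact this.mono_left nhdsWithin_le_nhds
    filter_upwards [h1.eventually (lt_mem_nhds zero_lt_one)] with ε hε using hε.le
  refine le_of_tendsto hlim ?_
  filter_upwards [pos a, pos b, Ioc_mem_nhdsGT hε₀] with ε ha hb hε
  have hm := h ε hε.1 hε.2 ha hb
  have he2 : 0 < ε ^ 2 := pow_pos hε.1 2
  have : ε ^ 2 * ((a - ε * E) + (b - ε * E) + ε ^ 2 * ((a - ε * E) * (b - ε * E))) ≤ 0 := by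
    nlinarith
  by_contra hcon
  push Not at hcon
  exact absurd this (not_le.2 (mul_pos he2 hcon))

theorem le_exp_of_abs_le_one {u : ℝ} (hu : |u| ≤ 1) : 1 + u + u ^ 2 / 2 - |u| ^ 3 ≤ Real.exp u := by
  have h := Real.exp_bound hu (n := 3) (by norm_num)
  simp only [Finset.sum_range_succ, Finset.sum_range_zero] at h
  norm_num [Nat.factorial] at h
  have h3 : 0 ≤ |u| ^ 3 := by positivity
  have := (abs_le.1 h).1
  nlinarith

variable {d : ℕ}

/-- A density `p` on `s` is strongly log-concave with constant `ρ` in the midpoint sense. -/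
def MidpointLogConcave (s : Set (Param d)) (ρ : ℝ) (p : Param d → ℝ) : Prop :=
  ∀ x ∈ s, ∀ y ∈ s, p x * p y ≤ Real.exp (-(ρ / 4 * ‖x - y‖ ^ 2)) * p ((1 / 2 : ℝ) • (x + y)) ^ 2

/-- Prékopa–Leindler for p e^u, p e^v and p: the factor exp(-ρ/4 ‖x - y‖²) gained from strong
log-concavity pays for exp(u(x) + v(y)), and p has integral 1. -/
theorem MidpointLogConcave.integral_exp_mul_integral_exp_le {s : Set (Param d)} {ρ : ℝ}
    {p : Param d → ℝ} (hlc : MidpointLogConcave s ρ p) (hp : Measurable p) (hp0 : ∀ x, 0 ≤ p x)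
    (hps : ∀ x ∉ s, p x = 0)
    [IsProbabilityMeasure (volume.withDensity fun x => ENNReal.ofReal (p x))]
    {u v : Param d → ℝ} (hu : Measurable u) (hv : Measurable v)
    (hui : Integrable (fun x => Real.exp (u x))
      (volume.withDensity fun x => ENNReal.ofReal (p x)))
    (hvi : Integrable (fun x => Real.exp (v x))
      (volume.withDensity fun x => ENNReal.ofReal (p x)))
    (huv : ∀ x ∈ s, ∀ y ∈ s, u x + v y ≤ ρ / 4 * ‖x - y‖ ^ 2) :
    (∫ x, Real.exp (u x) ∂(volume.withDensity fun x => ENNReal.ofReal (p x))) *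
      (∫ x, Real.exp (v x) ∂(volume.withDensity fun x => ENNReal.ofReal (p x))) ≤ 1 := by
  set P := volume.withDensity fun x => ENNReal.ofReal (p x) with hP
  have hpm : Measurable fun x => ENNReal.ofReal (p x) := hp.ennreal_ofReal
  have conv : ∀ w : Param d → ℝ, Measurable w → ∫⁻ x, ENNReal.ofReal (Real.exp (w x)) ∂P =
      ∫⁻ x, ENNReal.ofReal (p x) * ENNReal.ofReal (Real.exp (w x)) := by
    intro w hw
    rw [hP, lintegral_withDensity_eq_lintegral_mul _ hpm (by fun_prop)]
    rfl
  have hone : ∫⁻ x, ENNReal.ofReal (p x) = 1 := by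
    have := measure_univ (μ := P)
    rwa [hP, withDensity_apply _ MeasurableSet.univ, Measure.restrict_univ] at this
  have hpl := prekopa_leindler (F := fun x => ENNReal.ofReal (p x) * ENNReal.ofReal (Real.exp (u x)))
    (G := fun x => ENNReal.ofReal (p x) * ENNReal.ofReal (Real.exp (v x)))
    (H := fun x => ENNReal.ofReal (p x)) (by fun_prop) (by fun_prop) hpm (fun x y => by
      rw [← ENNReal.ofReal_mul (hp0 x), ← ENNReal.ofReal_mul (hp0 y), ← ENNReal.ofReal_mul
        (mul_nonneg (hp0 x) (Real.exp_pos _).le), ← ENNReal.ofReal_pow (hp0 _)]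
      refine ENNReal.ofReal_le_ofReal ?_
      by_cases hx : x ∈ s
      · by_cases hy : y ∈ s
        · have h1 := hlc x hx y hy
          have h2 := huv x hx y hy
          have h3 : Real.exp (u x) * Real.exp (v y) ≤ Real.exp (ρ / 4 * ‖x - y‖ ^ 2) := by
            rw [← Real.exp_add]; exact Real.exp_le_exp.2 h2
          calc p x * Real.exp (u x) * (p y * Real.exp (v y))
              = (p x * p y) * (Real.exp (u x) * Real.exp (v y)) := by ring
            _ ≤ (Real.exp (-(ρ / 4 * ‖x - y‖ ^ 2)) * p ((1 / 2 : ℝ) • (x + y)) ^ 2) *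
                Real.exp (ρ / 4 * ‖x - y‖ ^ 2) := by
                apply mul_le_mul h1 h3 (by positivity) (by positivity)
            _ = (Real.exp (-(ρ / 4 * ‖x - y‖ ^ 2)) * Real.exp (ρ / 4 * ‖x - y‖ ^ 2)) *
                p ((1 / 2 : ℝ) • (x + y)) ^ 2 := by ring
            _ = p ((1 / 2 : ℝ) • (x + y)) ^ 2 := by
                rw [← Real.exp_add]; simp
        · simp [hps y hy]; positivity
      · simp [hps x hx]; positivity)
  rw [hone, ← conv u hu, ← conv v hv, one_pow,
    ← ofReal_integral_eq_lintegral_ofReal hui (.of_forall fun x => (Real.exp_pos _).le),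
    ← ofReal_integral_eq_lintegral_ofReal hvi (.of_forall fun x => (Real.exp_pos _).le),
    ← ENNReal.ofReal_mul (integral_nonneg fun x => (Real.exp_pos _).le)] at hpl
  simpa using hpl

/-- Take u = εf - ε² g²/ρ' and v = -εf with ρ' < ρ. Writing r = ‖x - y‖, the inequality ε g r ≤ ε²
g²/ρ' + ρ' r²/4 shows that u(x) + v(y) is at most ρ' r²/4 + ε L r², hence at most ρ r²/4 for small
ε. The first-order terms vanish because f has mean zero, and order ε² reads ∫ f² ≤ ∫ g² / ρ'.
Finally ρ' tends to ρ. -/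
theorem MidpointLogConcave.integral_sq_le_of_integral_eq_zero {s : Set (Param d)} {ρ : ℝ}
    {p : Param d → ℝ} (hlc : MidpointLogConcave s ρ p) (hρ : 0 < ρ) (hp : Measurable p)
    (hp0 : ∀ x, 0 ≤ p x) (hps : ∀ x ∉ s, p x = 0)
    [IsProbabilityMeasure (volume.withDensity fun x => ENNReal.ofReal (p x))]
    {f g : Param d → ℝ} (hf : Measurable f) (hg : Measurable g) {B L : ℝ} (hL : 0 ≤ L)
    (hfB : ∀ x, |f x| ≤ B) (hg0 : ∀ x, 0 ≤ g x) (hgB : ∀ x, g x ≤ B)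
    (hfg : ∀ x ∈ s, ∀ y ∈ s, f x - g x * ‖x - y‖ - L * ‖x - y‖ ^ 2 ≤ f y)
    (hf0 : ∫ x, f x ∂(volume.withDensity fun x => ENNReal.ofReal (p x)) = 0) :
    ρ * ∫ x, f x ^ 2 ∂(volume.withDensity fun x => ENNReal.ofReal (p x)) ≤
      ∫ x, g x ^ 2 ∂(volume.withDensity fun x => ENNReal.ofReal (p x)) := by
  set P := volume.withDensity fun x => ENNReal.ofReal (p x) with hP
  set m := ∫ x, f x ^ 2 ∂P
  set I := ∫ x, g x ^ 2 ∂P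
  have bint : ∀ (q : Param d → ℝ) (C : ℝ), Measurable q → (∀ x, |q x| ≤ C) → Integrable q P :=
    fun q C hq hC => Integrable.of_bound hq.aestronglyMeasurable C (.of_forall hC)
  have hB0 : 0 ≤ B := (hg0 0).trans (hgB 0)
  have hfi := bint f B hf hfB
  have hf2 : ∀ x, f x ^ 2 ≤ B ^ 2 := fun x => sq_le_sq' (abs_le.1 (hfB x)).1 (abs_le.1 (hfB x)).2
  have hg2 : ∀ x, g x ^ 2 ≤ B ^ 2 := fun x => pow_le_pow_left₀ (hg0 x) (hgB x) 2
  have hf2i := bint (fun x => f x ^ 2) (B ^ 2) (hf.pow_const 2) fun x => by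
    rw [abs_of_nonneg (sq_nonneg _)]; exact hf2 x
  have hg2i := bint (fun x => g x ^ 2) (B ^ 2) (hg.pow_const 2) fun x => by
    rw [abs_of_nonneg (sq_nonneg _)]; exact hg2 x
  suffices H : ∀ ρ', 0 < ρ' → ρ' < ρ → ρ' * m ≤ I by
    have : Tendsto (fun r : ℝ => r * m) (𝓝[<] ρ) (𝓝 (ρ * m)) :=
      ((continuous_id.mul continuous_const).tendsto ρ).mono_left nhdsWithin_le_nhds
    refine le_of_tendsto this ?_
    filter_upwards [Ioo_mem_nhdsLT hρ] with r hr using H r hr.1 hr.2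
  intro ρ' hρ' hρ'ρ
  set D := B + B ^ 2 / ρ' with hD
  have hD0 : 0 ≤ D := by positivity
  have hBD : B ≤ D := by rw [hD]; linarith [div_nonneg (sq_nonneg B) hρ'.le]
  have hgD : ∀ x, g x ^ 2 / ρ' ≤ D := fun x => by
    have : g x ^ 2 / ρ' ≤ B ^ 2 / ρ' := div_le_div_of_nonneg_right (hg2 x) hρ'.le
    linarith
  -- `D` dominates both |f| and g²/ρ'. Of the cubic errors, D² comes from the cross term of u²/2 and
  -- D³ from the remainder of the exponential series.
  set E := D ^ 2 + D ^ 3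
  -- The three bounds give ε² ≤ ε, then |u|, |v| ≤ εD ≤ 1 for the expansion of the exponential, and
  -- 4εL ≤ ρ - ρ', which absorbs the quadratic error of `hfg`.
  set ε₀ := min (min 1 (1 / (D + 1))) ((ρ - ρ') / (4 * (L + 1))) with hε₀def
  have hε₀ : 0 < ε₀ := by
    have : 0 < ρ - ρ' := by linarith
    rw [hε₀def]; positivity
  have key := add_nonpos_of_forall_mul_le_one (a := m / 2 - I / ρ') (b := m / 2) (E := E) hε₀
    (fun ε hε hεε ha hb => by
      have hε1 : ε ≤ 1 := hεε.trans ((min_le_left _ _).trans (min_le_left _ _))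
      have hεD : ε * D ≤ 1 := by
        have : ε ≤ 1 / (D + 1) := hεε.trans ((min_le_left _ _).trans (min_le_right _ _))
        rw [le_div_iff₀ (by positivity)] at this
        nlinarith
      have hεL : 4 * ε * L ≤ ρ - ρ' := by
        have : ε ≤ (ρ - ρ') / (4 * (L + 1)) := hεε.trans (min_le_right _ _)
        rw [le_div_iff₀ (by positivity)] at this
        nlinarith
      set u : Param d → ℝ := fun x => ε * f x - ε ^ 2 * (g x ^ 2 / ρ') with hu_def
      set v : Param d → ℝ := fun x => -(ε * f x) with hv_def
      have hum : Measurable u := by fun_prop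
      have hvm : Measurable v := by fun_prop
      have hq0 : ∀ x, 0 ≤ g x ^ 2 / ρ' := fun x => by positivity
      have huD : ∀ x, |u x| ≤ ε * D := fun x => by
        have h1 := abs_le.1 (hfB x)
        have h2 : g x ^ 2 / ρ' ≤ B ^ 2 / ρ' := div_le_div_of_nonneg_right (hg2 x) hρ'.le
        rw [abs_le]
        constructor
        · have : ε ^ 2 * (g x ^ 2 / ρ') ≤ ε * (B ^ 2 / ρ') := by
            have : ε ^ 2 ≤ ε := by nlinarith
            exact mul_le_mul this h2 (hq0 x) hε.le
          have : ε * (-B) ≤ ε * f x := mul_le_mul_of_nonneg_left h1.1 hε.le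
          simp only [hu_def, hD]
          linarith
        · have : ε * f x ≤ ε * B := mul_le_mul_of_nonneg_left h1.2 hε.le
          have h3 : ε * B ≤ ε * D := mul_le_mul_of_nonneg_left hBD hε.le
          have : 0 ≤ ε ^ 2 * (g x ^ 2 / ρ') := mul_nonneg (sq_nonneg _) (hq0 x)
          simp only [hu_def]
          linarith
      have hvD : ∀ x, |v x| ≤ ε * D := fun x => by
        rw [hv_def]
        simp only [abs_neg, abs_mul, abs_of_pos hε]
        exact mul_le_mul_of_nonneg_left ((hfB x).trans hBD) hε.le
      have hexpi : ∀ w : Param d → ℝ, Measurable w → (∀ x, |w x| ≤ ε * D) →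
          Integrable (fun x => Real.exp (w x)) P := fun w hw hwD =>
        bint _ (Real.exp (ε * D)) (by fun_prop) fun x => by
          rw [abs_of_pos (Real.exp_pos _)]
          exact Real.exp_le_exp.2 ((abs_le.1 (hwD x)).2)
      have hprod := hlc.integral_exp_mul_integral_exp_le hp hp0 hps hum hvm (hexpi u hum huD)
        (hexpi v hvm hvD) (fun x hx y hy => by
          have h1 := hfg x hx y hy
          set r := ‖x - y‖
          have hmul : ε * (f x - f y) ≤ ε * (g x * r + L * r ^ 2) :=
            mul_le_mul_of_nonneg_left (by linarith) hε.le
          have h2 : ε * (g x * r) ≤ ε ^ 2 * (g x ^ 2 / ρ') + ρ' / 4 * r ^ 2 := by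
            have : 0 ≤ (ε * g x - ρ' / 2 * r) ^ 2 / ρ' := by positivity
            have e : (ε * g x - ρ' / 2 * r) ^ 2 / ρ' =
                ε ^ 2 * (g x ^ 2 / ρ') + ρ' / 4 * r ^ 2 - ε * (g x * r) := by
              field_simp; ring
            linarith
          have h3 : ε * L * r ^ 2 ≤ (ρ - ρ') / 4 * r ^ 2 :=
            mul_le_mul_of_nonneg_right (by linarith) (sq_nonneg r)
          simp only [hu_def, hv_def]
          nlinarith)
      have hXlow : 1 + ε ^ 2 * (m / 2 - I / ρ') - ε ^ 3 * E ≤ ∫ x, Real.exp (u x) ∂P := by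
        have hlow : ∀ x, (1 - ε ^ 3 * E) + (ε * f x + (ε ^ 2 / 2 * f x ^ 2 -
            ε ^ 2 / ρ' * g x ^ 2)) ≤ Real.exp (u x) := by
          intro x
          have h1 := le_exp_of_abs_le_one ((huD x).trans hεD)
          have h2 : |u x| ^ 3 ≤ (ε * D) ^ 3 := pow_le_pow_left₀ (abs_nonneg _) (huD x) 3
          have h3 : f x * (g x ^ 2 / ρ') ≤ D * D :=
            mul_le_mul ((le_abs_self _).trans ((hfB x).trans hBD)) (hgD x) (hq0 x) hD0
          have h4 : ε ^ 2 * f x ^ 2 - 2 * ε ^ 3 * (D * D) ≤ u x ^ 2 := by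
            have : u x ^ 2 = ε ^ 2 * f x ^ 2 - 2 * ε ^ 3 * (f x * (g x ^ 2 / ρ')) +
                (ε ^ 2 * (g x ^ 2 / ρ')) ^ 2 := by simp only [hu_def]; ring
            rw [this]
            have : 2 * ε ^ 3 * (f x * (g x ^ 2 / ρ')) ≤ 2 * ε ^ 3 * (D * D) :=
              mul_le_mul_of_nonneg_left h3 (by positivity)
            nlinarith [sq_nonneg (ε ^ 2 * (g x ^ 2 / ρ'))]
          have e1 : ε ^ 2 / ρ' * g x ^ 2 = ε ^ 2 * (g x ^ 2 / ρ') := by ring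
          rw [e1]
          have e2 : u x = ε * f x - ε ^ 2 * (g x ^ 2 / ρ') := rfl
          have e3 : ε ^ 3 * E = ε ^ 3 * (D * D) + (ε * D) ^ 3 := by simp only [E]; ring
          rw [e3]
          linarith
        have hmono := integral_mono (μ := P) (((integrable_const (1 - ε ^ 3 * E)).add
          ((hfi.const_mul ε).add ((hf2i.const_mul (ε ^ 2 / 2)).sub
            (hg2i.const_mul (ε ^ 2 / ρ')))))) (hexpi u hum huD) hlow
        refine le_trans (le_of_eq ?_) hmono
        rw [integral_add' (integrable_const _) ((hfi.const_mul ε).add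
          ((hf2i.const_mul (ε ^ 2 / 2)).sub (hg2i.const_mul (ε ^ 2 / ρ')))),
          integral_add' (hfi.const_mul ε)
          ((hf2i.const_mul (ε ^ 2 / 2)).sub (hg2i.const_mul (ε ^ 2 / ρ'))),
          integral_sub' (hf2i.const_mul (ε ^ 2 / 2)) (hg2i.const_mul (ε ^ 2 / ρ')),
          integral_const_mul, integral_const_mul, integral_const_mul, hf0]
        simp only [integral_const, probReal_univ, one_smul]
        change _ = 1 - ε ^ 3 * E + (ε * 0 + (ε ^ 2 / 2 * m - ε ^ 2 / ρ' * I))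
        ring
      have hYlow : 1 + ε ^ 2 * (m / 2) - ε ^ 3 * E ≤ ∫ x, Real.exp (v x) ∂P := by
        have hlow : ∀ x, (1 - ε ^ 3 * E) + ((-ε) * f x + ε ^ 2 / 2 * f x ^ 2) ≤
            Real.exp (v x) := by
          intro x
          have h1 := le_exp_of_abs_le_one ((hvD x).trans hεD)
          have h2 : |v x| ^ 3 ≤ (ε * D) ^ 3 := pow_le_pow_left₀ (abs_nonneg _) (hvD x) 3
          have e2 : v x = -(ε * f x) := rfl
          have e3 : ε ^ 3 * E = ε ^ 3 * (D * D) + (ε * D) ^ 3 := by simp only [E]; ring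
          have e4 : v x ^ 2 = ε ^ 2 * f x ^ 2 := by rw [e2]; ring
          have e5 : 0 ≤ ε ^ 3 * (D * D) := by positivity
          rw [e3]
          rw [e4] at h1
          linarith
        have hmono := integral_mono (μ := P) ((integrable_const (1 - ε ^ 3 * E)).add
          ((hfi.const_mul (-ε)).add (hf2i.const_mul (ε ^ 2 / 2)))) (hexpi v hvm hvD) hlow
        refine le_trans (le_of_eq ?_) hmono
        rw [integral_add' (integrable_const _) ((hfi.const_mul (-ε)).add
          (hf2i.const_mul (ε ^ 2 / 2))), integral_add' (hfi.const_mul (-ε))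
          (hf2i.const_mul (ε ^ 2 / 2)), integral_const_mul, integral_const_mul, hf0]
        simp only [integral_const, probReal_univ, one_smul]
        change _ = 1 - ε ^ 3 * E + (-ε * 0 + ε ^ 2 / 2 * m)
        ring
      exact (mul_le_mul hXlow hYlow hb (integral_nonneg fun x => (Real.exp_pos _).le)).trans hprod)
  have h1 : m ≤ I / ρ' := by linarith
  rw [le_div_iff₀ hρ'] at h1
  linarith

/-- Poincaré inequality with constant `1 / ρ` for a `ρ`-strongly log-concave density on `s`. The
function `g` plays the role of the norm of the gradient of `f`. -/
theorem MidpointLogConcave.poincare {s : Set (Param d)} {ρ : ℝ}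
    {p : Param d → ℝ} (hlc : MidpointLogConcave s ρ p) (hρ : 0 < ρ) (hp : Measurable p)
    (hp0 : ∀ x, 0 ≤ p x) (hps : ∀ x ∉ s, p x = 0)
    [IsProbabilityMeasure (volume.withDensity fun x => ENNReal.ofReal (p x))]
    {f g : Param d → ℝ} (hf : Measurable f) (hg : Measurable g) {B L : ℝ} (hL : 0 ≤ L)
    (hfB : ∀ x, |f x| ≤ B) (hg0 : ∀ x, 0 ≤ g x) (hgB : ∀ x, g x ≤ B)
    (hfg : ∀ x ∈ s, ∀ y ∈ s, f x - g x * ‖x - y‖ - L * ‖x - y‖ ^ 2 ≤ f y) :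
    ρ * (∫ x, f x ^ 2 ∂(volume.withDensity fun x => ENNReal.ofReal (p x)) -
        (∫ x, f x ∂(volume.withDensity fun x => ENNReal.ofReal (p x))) ^ 2) ≤
      ∫ x, g x ^ 2 ∂(volume.withDensity fun x => ENNReal.ofReal (p x)) := by
  set P := volume.withDensity fun x => ENNReal.ofReal (p x) with hP
  set m := ∫ x, f x ∂P
  have hfi : Integrable f P := Integrable.of_bound hf.aestronglyMeasurable B (.of_forall hfB)
  have hf2i : Integrable (fun x => f x ^ 2) P :=
    Integrable.of_bound (hf.pow_const 2).aestronglyMeasurable (B ^ 2) (.of_forall fun x => by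
      rw [Real.norm_eq_abs, abs_pow]; exact pow_le_pow_left₀ (abs_nonneg _) (hfB x) 2)
  have h := hlc.integral_sq_le_of_integral_eq_zero hρ hp hp0 hps (f := fun x => f x - m) (g := g)
    (hf.sub_const m) hg (B := B + |m|) hL
    (fun x => (abs_sub _ _).trans (add_le_add_left (hfB x) _)) hg0
    (fun x => (hgB x).trans (le_add_of_nonneg_right (abs_nonneg m)))
    (fun x hx y hy => by linarith [hfg x hx y hy])
    (by rw [integral_sub hfi (integrable_const m)]; simp [m, P])
  have e : ∫ x, (f x - m) ^ 2 ∂P = ∫ x, f x ^ 2 ∂P - m ^ 2 := by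
    have : (fun x => (f x - m) ^ 2) = fun x => f x ^ 2 - 2 * m * f x + m ^ 2 := by
      ext x; ring
    have e1 := integral_add (f := fun x => f x ^ 2 - 2 * m * f x) (hf2i.sub (hfi.const_mul (2 * m)))
      (integrable_const (m ^ 2))
    rw [this, e1, integral_sub hf2i (hfi.const_mul _), integral_const_mul]
    simp only [integral_const, probReal_univ, one_smul]
    change _ - 2 * m * m + m ^ 2 = _
    ring
  rwa [← e]

end Poincare

/-! ### Total variation bounds -/

section TotalVariation

variable {X : Type*} [MeasurableSpace X]

theorem sq_integral_mul_le {P : Measure X} {a b : X → ℝ}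
    (ha : Integrable (fun x => a x ^ 2) P) (hb : Integrable (fun x => b x ^ 2) P)
    (hab : Integrable (fun x => a x * b x) P) :
    (∫ x, a x * b x ∂P) ^ 2 ≤ (∫ x, a x ^ 2 ∂P) * ∫ x, b x ^ 2 ∂P := by
  have h : ∀ t : ℝ, 0 ≤ (∫ x, a x ^ 2 ∂P) * (t * t) + (2 * ∫ x, a x * b x ∂P) * t +
      ∫ x, b x ^ 2 ∂P := by
    intro t
    have e1 := integral_add (f := fun x => t ^ 2 * a x ^ 2 + 2 * t * (a x * b x))
      ((ha.const_mul (t ^ 2)).add (hab.const_mul (2 * t))) hb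
    have e2 := integral_add (ha.const_mul (t ^ 2)) (hab.const_mul (2 * t))
    have e3 : ∫ x, (t * a x + b x) ^ 2 ∂P =
        ∫ x, t ^ 2 * a x ^ 2 + 2 * t * (a x * b x) + b x ^ 2 ∂P := by
      congr 1; ext x; ring
    have e4 : 0 ≤ ∫ x, (t * a x + b x) ^ 2 ∂P := integral_nonneg fun x => sq_nonneg _
    rw [e3, e1, e2, integral_const_mul, integral_const_mul] at e4
    linarith
  have := discrim_le_zero h
  rw [discrim] at this
  nlinarith

/-- Total variation is controlled by the Hellinger affinity `∫ f dP` of `P` and `f² P`. -/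
theorem abs_setIntegral_sq_sub_le {P : Measure X} [IsProbabilityMeasure P] {f : X → ℝ} {B : ℝ}
    (hf : Measurable f) (hf0 : ∀ x, 0 ≤ f x) (hfB : ∀ x, f x ≤ B) (h1 : ∫ x, f x ^ 2 ∂P = 1)
    {A : Set X} (hA : MeasurableSet A) :
    |∫ x in A, f x ^ 2 ∂P - P.real A| ≤ √(1 - (∫ x, f x ∂P) ^ 2) := by
  have bint : ∀ (q : X → ℝ) (C : ℝ), Measurable q → (∀ x, |q x| ≤ C) → Integrable q P :=
    fun q C hq hC => Integrable.of_bound hq.aestronglyMeasurable C (.of_forall hC)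
  have habs : ∀ x, |f x| ≤ B := fun x => by rw [abs_of_nonneg (hf0 x)]; exact hfB x
  have hfi := bint f B hf habs
  have hf2i := bint (fun x => f x ^ 2) (B ^ 2) (hf.pow_const 2) fun x => by
    rw [abs_pow]; exact pow_le_pow_left₀ (abs_nonneg _) (habs x) 2
  set b := ∫ x, f x ∂P
  set D := ∫ x in A, f x ^ 2 ∂P - P.real A
  have hd : Integrable (fun x => f x ^ 2 - 1) P := hf2i.sub (integrable_const _)
  have hDA : D = ∫ x in A, (f x ^ 2 - 1) ∂P := by
    rw [integral_sub hf2i.integrableOn (integrable_const _)]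
    simp [D, Measure.real]
  have htot : ∫ x in A, (f x ^ 2 - 1) ∂P + ∫ x in Aᶜ, (f x ^ 2 - 1) ∂P = 0 := by
    rw [integral_add_compl hA hd, integral_sub hf2i (integrable_const _), h1]
    simp
  -- Since f² - 1 has integral zero, its integrals over `A` and the complement are opposite, and
  -- each has absolute value |D|.
  have habsD : 2 * |D| ≤ ∫ x, |f x ^ 2 - 1| ∂P := by
    rw [← integral_add_compl hA hd.abs]
    have h2 : |∫ x in A, (f x ^ 2 - 1) ∂P| ≤ ∫ x in A, |f x ^ 2 - 1| ∂P :=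
      abs_integral_le_integral_abs
    have h3 : |∫ x in Aᶜ, (f x ^ 2 - 1) ∂P| ≤ ∫ x in Aᶜ, |f x ^ 2 - 1| ∂P :=
      abs_integral_le_integral_abs
    have h4 : ∫ x in Aᶜ, (f x ^ 2 - 1) ∂P = -D := by rw [hDA]; linarith
    rw [h4, abs_neg] at h3
    rw [← hDA] at h2
    linarith
  have hm1 : Integrable (fun x => |f x - 1| ^ 2) P := by
    have : (fun x => |f x - 1| ^ 2) = fun x => f x ^ 2 - 2 * f x + 1 := by
      ext x; rw [sq_abs]; ring
    rw [this]
    exact (hf2i.sub (hfi.const_mul 2)).add (integrable_const _)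
  have hp1 : Integrable (fun x => (f x + 1) ^ 2) P := by
    have : (fun x => (f x + 1) ^ 2) = fun x => f x ^ 2 + 2 * f x + 1 := by
      ext x; ring
    rw [this]
    exact (hf2i.add (hfi.const_mul 2)).add (integrable_const _)
  have hprod : (fun x => |f x - 1| * (f x + 1)) = fun x => |f x ^ 2 - 1| := by
    ext x
    have : f x ^ 2 - 1 = (f x - 1) * (f x + 1) := by ring
    rw [this, abs_mul, abs_of_nonneg (by linarith [hf0 x] : 0 ≤ f x + 1)]
  have em : ∫ x, |f x - 1| ^ 2 ∂P = 2 - 2 * b := by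
    have e1 := integral_add (f := fun x => f x ^ 2 - 2 * f x) (hf2i.sub (hfi.const_mul 2))
      (integrable_const (1 : ℝ))
    have e2 := integral_sub hf2i (hfi.const_mul 2)
    have e3 : ∫ x, |f x - 1| ^ 2 ∂P = ∫ x, f x ^ 2 - 2 * f x + 1 ∂P := by
      congr 1; ext x; rw [sq_abs]; ring
    rw [e3, e1, e2, h1, integral_const_mul]
    simp; ring
  have ep : ∫ x, (f x + 1) ^ 2 ∂P = 2 + 2 * b := by
    have e1 := integral_add (f := fun x => f x ^ 2 + 2 * f x) (hf2i.add (hfi.const_mul 2))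
      (integrable_const (1 : ℝ))
    have e2 := integral_add hf2i (hfi.const_mul 2)
    have e3 : ∫ x, (f x + 1) ^ 2 ∂P = ∫ x, f x ^ 2 + 2 * f x + 1 ∂P := by
      congr 1; ext x; ring
    rw [e3, e1, e2, h1, integral_const_mul]
    simp; ring
  -- Cauchy–Schwarz for |f² - 1| = |f - 1| (f + 1): the right-hand side is (2 - 2b)(2 + 2b) = 4(1 -
  -- b²).
  have hcs := sq_integral_mul_le hm1 hp1 (by rw [hprod]; exact hd.abs)
  rw [em, ep, hprod] at hcs
  refine Real.le_sqrt_of_sq_le ?_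
  have : (2 * |D|) ^ 2 ≤ (∫ x, |f x ^ 2 - 1| ∂P) ^ 2 :=
    pow_le_pow_left₀ (by positivity) habsD 2
  nlinarith

theorem tvDist_nonneg (μ ν : Measure X) : 0 ≤ tvDist μ ν :=
  Real.iSup_nonneg fun _ => abs_nonneg _

theorem tvDist_le {μ ν : Measure X} {C : ℝ}
    (h : ∀ A, MeasurableSet A → |μ.real A - ν.real A| ≤ C) : tvDist μ ν ≤ C :=
  have : Nonempty {A : Set X // MeasurableSet A} := ⟨⟨∅, MeasurableSet.empty⟩⟩
  ciSup_le fun A => h A A.2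

/-- Conditioning loses the mass of `A` outside `K` and inflates the mass inside. Each effect is at
most μ(Kᶜ), and they have opposite signs, so no factor 2 appears. -/
theorem abs_real_sub_cond_le {μ : Measure X} [IsProbabilityMeasure μ] {K : Set X}
    (hK : MeasurableSet K) (hK0 : μ K ≠ 0) (A : Set X) :
    |μ.real A - (μ[|K]).real A| ≤ μ.real Kᶜ := by
  have hKr : 0 < μ.real K := by
    rw [Measure.real, ENNReal.toReal_pos_iff]; exact ⟨hK0.bot_lt, measure_lt_top _ _⟩
  have hc : (μ[|K]).real A = (μ.real K)⁻¹ * μ.real (K ∩ A) := by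
    rw [Measure.real, cond_apply hK, ENNReal.toReal_mul, ENNReal.toReal_inv]; rfl
  have h1 : μ.real A = μ.real (A ∩ K) + μ.real (A \ K) :=
    (measureReal_inter_add_sdiff hK).symm
  have h2 : μ.real (A \ K) ≤ μ.real Kᶜ := measureReal_mono fun x hx => hx.2
  have h3 : μ.real Kᶜ = 1 - μ.real K := probReal_compl_eq_one_sub hK
  have h4 : μ.real (A ∩ K) ≤ μ.real K := measureReal_mono Set.inter_subset_right
  have h5 : 0 ≤ μ.real (A \ K) := measureReal_nonneg
  have h6 : 0 ≤ μ.real (A ∩ K) := measureReal_nonneg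
  rw [hc, Set.inter_comm K A]
  set k := μ.real K
  set a := μ.real (A ∩ K)
  have hk1 : k ≤ 1 := by linarith [measureReal_nonneg (μ := μ) (s := Kᶜ)]
  have h7 : k⁻¹ * a - a ≤ 1 - k := by
    have : k⁻¹ * a - a = (a / k) * (1 - k) := by field_simp
    rw [this]
    have : a / k ≤ 1 := (div_le_one hKr).2 h4
    nlinarith
  have h8 : a ≤ k⁻¹ * a := by
    have : 1 ≤ k⁻¹ := (one_le_inv₀ hKr).2 hk1
    nlinarith
  rw [abs_le]
  constructor <;> linarith

end TotalVariation

/-- A `ρ`-strongly log-concave law `P` on `s` and its perturbation `e^w P` are close in total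
variation if the gradient of `w`, whose norm is at most `γ`, is small under `e^w P`. -/
theorem MidpointLogConcave.abs_real_sub_le {d : ℕ} {s : Set (Param d)} {ρ : ℝ}
    {p : Param d → ℝ} (hlc : MidpointLogConcave s ρ p) (hρ : 0 < ρ) (hs : MeasurableSet s)
    (hp : Measurable p) (hp0 : ∀ x, 0 ≤ p x) (hps : ∀ x ∉ s, p x = 0)
    {P Q : Measure (Param d)} [IsProbabilityMeasure P] [IsProbabilityMeasure Q]
    (hP : P = volume.withDensity fun x => ENNReal.ofReal (p x))
    {w γ : Param d → ℝ} (hw : Measurable w) (hγ : Measurable γ)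
    (hQ : Q = P.withDensity fun x => ENNReal.ofReal (Real.exp (w x)))
    {B L : ℝ} (hL : 0 ≤ L) (hwB : ∀ x ∈ s, |w x| ≤ B)
    (hγ0 : ∀ x, 0 ≤ γ x) (hγB : ∀ x ∈ s, γ x ≤ B)
    (hwγ : ∀ x ∈ s, ∀ y ∈ s, w x - γ x * ‖x - y‖ - L * ‖x - y‖ ^ 2 ≤ w y)
    {A : Set (Param d)} (hA : MeasurableSet A) :
    |Q.real A - P.real A| ≤ √((∫ x, γ x ^ 2 ∂Q) / ρ) / 2 := by
  -- `f` is the square root of dQ/dP, so its variance under `P` is one minus the squared affinity.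
  -- Its gradient bound `g` is e^{w/2} γ/2, whose square integrates to ∫ γ² dQ / 4.
  set f : Param d → ℝ := s.indicator fun x => Real.exp (w x / 2) with hf_def
  set g : Param d → ℝ := s.indicator fun x => Real.exp (w x / 2) / 2 * γ x with hg_def
  have hf : Measurable f := (by fun_prop : Measurable fun x => Real.exp (w x / 2)).indicator hs
  have hg : Measurable g :=
    (by fun_prop : Measurable fun x => Real.exp (w x / 2) / 2 * γ x).indicator hs
  set C := Real.exp (B / 2)
  have hC : 0 < C := Real.exp_pos _
  have hexpC : ∀ x ∈ s, Real.exp (w x / 2) ≤ C := fun x hx =>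
    Real.exp_le_exp.2 (by linarith [(abs_le.1 (hwB x hx)).2])
  have hf0 : ∀ x, 0 ≤ f x := fun x => Set.indicator_nonneg (fun x _ => (Real.exp_pos _).le) x
  have hg0 : ∀ x, 0 ≤ g x := fun x => Set.indicator_nonneg (fun x _ => by
    have := hγ0 x; positivity) x
  have hfC : ∀ x, f x ≤ C + C * |B| := fun x => by
    by_cases hx : x ∈ s
    · rw [hf_def, Set.indicator_of_mem hx]
      have : 0 ≤ C * |B| := by positivity
      linarith [hexpC x hx]
    · rw [hf_def, Set.indicator_of_notMem hx]; positivity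
  have hgC : ∀ x, g x ≤ C + C * |B| := fun x => by
    by_cases hx : x ∈ s
    · rw [hg_def, Set.indicator_of_mem hx]
      have h1 : Real.exp (w x / 2) / 2 ≤ C := by
        have := hexpC x hx
        have := Real.exp_pos (w x / 2)
        linarith
      have h2 : γ x ≤ |B| := (hγB x hx).trans (le_abs_self B)
      have : Real.exp (w x / 2) / 2 * γ x ≤ C * |B| := mul_le_mul h1 h2 (hγ0 x) hC.le
      linarith
    · rw [hg_def, Set.indicator_of_notMem hx]; positivity
  have hPs : ∀ᵐ x ∂P, x ∈ s := by
    rw [ae_iff]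
    change P sᶜ = 0
    rw [hP, withDensity_apply _ hs.compl]
    refine (setLIntegral_congr_fun hs.compl (g := fun _ => 0) fun x hx => ?_).trans (by simp)
    simp [hps x hx]
  have hpm : Measurable fun x => ENNReal.ofReal (p x) := hp.ennreal_ofReal
  have hf2 : ∀ᵐ x ∂P, f x ^ 2 = Real.exp (w x) := by
    filter_upwards [hPs] with x hx
    rw [hf_def, Set.indicator_of_mem hx, ← Real.exp_nat_mul]
    congr 1; push_cast; ring
  have hQint : ∀ q : Param d → ℝ, ∫ x, q x ∂Q = ∫ x, f x ^ 2 * q x ∂P := by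
    intro q
    rw [hQ, integral_withDensity_eq_integral_toReal_smul (by fun_prop)
      (.of_forall fun x => ENNReal.ofReal_lt_top)]
    refine integral_congr_ae ?_
    filter_upwards [hf2] with x hx
    rw [hx, ENNReal.toReal_ofReal (Real.exp_pos _).le, smul_eq_mul]
  have h1 : ∫ x, f x ^ 2 ∂P = 1 := by
    have := hQint fun _ => 1
    simpa using this.symm
  have hQA : Q.real A = ∫ x in A, f x ^ 2 ∂P := by
    have := hQint (A.indicator fun _ => 1)
    rw [integral_indicator_const _ hA, smul_eq_mul, mul_one] at this
    rw [this, ← integral_indicator hA]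
    congr 1; ext x
    by_cases hx : x ∈ A <;> simp [hx]
  have hg2 : ∫ x, g x ^ 2 ∂P = (∫ x, γ x ^ 2 ∂Q) / 4 := by
    rw [hQint, ← integral_div]
    congr 1; ext x
    by_cases hx : x ∈ s
    · rw [hg_def, hf_def, Set.indicator_of_mem hx, Set.indicator_of_mem hx]; ring
    · rw [hg_def, hf_def, Set.indicator_of_notMem hx, Set.indicator_of_notMem hx]; ring
  subst hP
  -- The tangent-line bound for the exponential turns the lower estimate of w(y) into one for
  -- e^{w(y)/2}. Its quadratic error is multiplied by e^{w(x)/2}/2 ≤ C/2.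
  have hpoin := hlc.poincare hρ hp hp0 hps hf hg (B := C + C * |B|) (L := C * L / 2)
    (by positivity) (fun x => by rw [abs_of_nonneg (hf0 x)]; exact hfC x) hg0 hgC
    (fun x hx y hy => by
      rw [hg_def, hf_def, Set.indicator_of_mem hx, Set.indicator_of_mem hx,
        Set.indicator_of_mem hy]
      set r := ‖x - y‖
      have h2 := hwγ x hx y hy
      have h3 : Real.exp (w x / 2) * (1 + (w y - w x) / 2) ≤ Real.exp (w y / 2) := by
        have e : Real.exp (w y / 2) = Real.exp (w x / 2) * Real.exp ((w y - w x) / 2) := by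
          rw [← Real.exp_add]; congr 1; ring
        rw [e]
        refine mul_le_mul_of_nonneg_left ?_ (Real.exp_pos _).le
        linarith [Real.add_one_le_exp ((w y - w x) / 2)]
      have h4 : Real.exp (w x / 2) * (-(γ x * r + L * r ^ 2)) ≤
          Real.exp (w x / 2) * (w y - w x) :=
        mul_le_mul_of_nonneg_left (by linarith) (Real.exp_pos _).le
      have h5 : Real.exp (w x / 2) * (L * r ^ 2) ≤ C * (L * r ^ 2) :=
        mul_le_mul_of_nonneg_right (hexpC x hx) (by positivity)
      nlinarith)
  have htv := abs_setIntegral_sq_sub_le hf hf0 hfC h1 hA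
  rw [← hQA] at htv
  refine htv.trans ?_
  rw [h1, hg2] at hpoin
  have h3 : (√((∫ x, γ x ^ 2 ∂Q) / ρ) / 2) = √((∫ x, γ x ^ 2 ∂Q) / ρ / 4) := by
    rw [Real.sqrt_div' _ (by norm_num : (0 : ℝ) ≤ 4)]
    congr 1
    rw [show (4 : ℝ) = 2 ^ 2 by norm_num, Real.sqrt_sq (by norm_num)]
  rw [h3]
  refine Real.sqrt_le_sqrt ?_
  rw [div_right_comm, le_div_iff₀ hρ]
  linarith

/-! ### Symmetric matrices -/

section Matrices

variable {d : ℕ} {A : Matrix (Fin d) (Fin d) ℝ}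

/-- The quadratic form `xᵀ A x`. -/
noncomputable def quadForm (A : Matrix (Fin d) (Fin d) ℝ) (x : Param d) : ℝ :=
  inner ℝ x (Matrix.toEuclideanCLM (𝕜 := ℝ) A x)

theorem quadForm_eq_dotProduct (A : Matrix (Fin d) (Fin d) ℝ) (x : Param d) :
    quadForm A x = x.ofLp ⬝ᵥ A.mulVec x.ofLp :=
  Matrix.inner_toEuclideanCLM A x x

@[fun_prop]
theorem continuous_quadForm (A : Matrix (Fin d) (Fin d) ℝ) : Continuous (quadForm A) := by
  unfold quadForm; fun_prop

theorem quadForm_add_smul_one (A : Matrix (Fin d) (Fin d) ℝ) (c : ℝ) (x : Param d) :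
    quadForm (A + c • 1) x = quadForm A x + c * ‖x‖ ^ 2 := by
  simp only [quadForm, map_add, map_smul, map_one, add_apply,
    smul_apply, inner_add_right, inner_smul_right,
    one_apply_eq_self, real_inner_self_eq_norm_sq]

theorem quadForm_smul_matrix (A : Matrix (Fin d) (Fin d) ℝ) (c : ℝ) (x : Param d) :
    quadForm (c • A) x = c * quadForm A x := by
  simp only [quadForm, map_smul, smul_apply, inner_smul_right]

theorem posDef_of_quadForm_pos (hA : A.IsHermitian) (h : ∀ x : Param d, x ≠ 0 → 0 < quadForm A x) :
    A.PosDef := by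
  refine Matrix.PosDef.of_dotProduct_mulVec_pos hA fun x hx => ?_
  have := h (WithLp.toLp 2 x) (by simpa using hx)
  rw [quadForm_eq_dotProduct] at this
  simpa using this

/-- A shift by a scalar keeps the eigenvectors. Negative shifts occur in the Chernoff bound,
positive ones in the matrix J. -/
theorem add_smul_one_eq_conj (hA : A.IsHermitian) (c : ℝ) :
    A + c • 1 = Unitary.conjStarAlgAut ℝ _ hA.eigenvectorUnitary
      (Matrix.diagonal fun i => hA.eigenvalues i + c) := by
  have : (Matrix.diagonal fun i => hA.eigenvalues i + c) =
      Matrix.diagonal (RCLike.ofReal ∘ hA.eigenvalues) + c • 1 := by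
    ext i j
    by_cases hij : i = j
    · subst hij; simp
    · simp [hij]
  rw [this, map_add, map_smul, map_one, ← hA.spectral_theorem]

theorem det_add_smul_one (hA : A.IsHermitian) (c : ℝ) :
    (A + c • 1).det = ∏ i, (hA.eigenvalues i + c) := by
  rw [add_smul_one_eq_conj hA c, Unitary.conjStarAlgAut_apply, Matrix.det_mul_comm, ← mul_assoc]
  simp

theorem trace_inv_add_smul_one (hA : A.IsHermitian) {c : ℝ} (hc : ∀ i, 0 < hA.eigenvalues i + c) :
    (A + c • 1)⁻¹.trace = ∑ i, (hA.eigenvalues i + c)⁻¹ := by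
  have hinv : (A + c • 1)⁻¹ = Unitary.conjStarAlgAut ℝ _ hA.eigenvectorUnitary
      (Matrix.diagonal fun i => (hA.eigenvalues i + c)⁻¹) := by
    refine Matrix.inv_eq_right_inv ?_
    rw [add_smul_one_eq_conj hA c, ← map_mul, Matrix.diagonal_mul_diagonal]
    have : (fun i => (hA.eigenvalues i + c) * (hA.eigenvalues i + c)⁻¹) = fun _ => 1 := by
      ext i; exact mul_inv_cancel₀ (hc i).ne'
    rw [this, Matrix.diagonal_one, map_one]
  rw [hinv, Unitary.conjStarAlgAut_apply, Matrix.trace_mul_comm, ← mul_assoc]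
  simp [Matrix.trace]

theorem det_eq_prod_eigenvalues (hA : A.IsHermitian) : A.det = ∏ i, hA.eigenvalues i := by
  simpa using det_add_smul_one hA 0

theorem trace_inv_eq_sum (hA : A.PosDef) :
    A⁻¹.trace = ∑ i, (hA.isHermitian.eigenvalues i)⁻¹ := by
  simpa using trace_inv_add_smul_one hA.isHermitian (c := 0) (by simpa using hA.eigenvalues_pos)

theorem mul_norm_sq_le_quadForm (hA : A.IsHermitian) {c : ℝ} (hc : ∀ i, c ≤ hA.eigenvalues i)
    (x : Param d) : c * ‖x‖ ^ 2 ≤ quadForm A x := by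
  have h : (A + (-c) • 1).PosSemidef := by
    rw [add_smul_one_eq_conj hA (-c), Unitary.conjStarAlgAut_apply]
    refine Matrix.PosSemidef.mul_mul_conjTranspose_same ?_ _
    exact Matrix.PosSemidef.diagonal fun i => by simpa using hc i
  have h1 := h.dotProduct_mulVec_nonneg x.ofLp
  have h2 : 0 ≤ quadForm (A + (-c) • 1) x := by
    rw [quadForm_eq_dotProduct]; simpa using h1
  rw [quadForm_add_smul_one] at h2
  linarith

theorem toEuclideanCLM_eigenvector (hA : A.IsHermitian) (i : Fin d) :
    Matrix.toEuclideanCLM (𝕜 := ℝ) A (hA.eigenvectorBasis i) =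
      hA.eigenvalues i • hA.eigenvectorBasis i := by
  have := hA.mulVec_eigenvectorBasis i
  apply (WithLp.equiv 2 _).injective
  simpa using this

theorem quadForm_eigenvector (hA : A.IsHermitian) (i : Fin d) :
    quadForm A (hA.eigenvectorBasis i) = hA.eigenvalues i := by
  rw [quadForm, toEuclideanCLM_eigenvector, inner_smul_right, real_inner_self_eq_norm_sq,
    hA.eigenvectorBasis.norm_eq_one]
  simp

theorem le_eigenvalues_of_mul_norm_sq_le_quadForm (hA : A.IsHermitian) {c : ℝ}
    (h : ∀ x : Param d, c * ‖x‖ ^ 2 ≤ quadForm A x) (i : Fin d) : c ≤ hA.eigenvalues i := by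
  have := h (hA.eigenvectorBasis i)
  rw [quadForm_eigenvector, hA.eigenvectorBasis.norm_eq_one] at this
  simpa using this

theorem lambdaMin_le_eigenvalues (hA : A.IsHermitian) (i : Fin d) :
    lambdaMin A ≤ hA.eigenvalues i :=
  csInf_le Matrix.finite_real_spectrum.bddBelow (hA.eigenvalues_mem_spectrum_real i)

theorem lambdaMin_mul_norm_sq_le_quadForm (hA : A.IsHermitian) (x : Param d) :
    lambdaMin A * ‖x‖ ^ 2 ≤ quadForm A x :=
  mul_norm_sq_le_quadForm hA (lambdaMin_le_eigenvalues hA) x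

theorem posDef_of_lambdaMin_pos (hA : A.IsHermitian) (h : 0 < lambdaMin A) : A.PosDef :=
  hA.posDef_iff_eigenvalues_pos.2 fun i => h.trans_le (lambdaMin_le_eigenvalues hA i)

theorem eigenvalues_le_opNorm (hA : A.IsHermitian) (i : Fin d) :
    hA.eigenvalues i ≤ opNorm A := by
  have h := (Matrix.toEuclideanCLM (𝕜 := ℝ) A).le_opNorm (hA.eigenvectorBasis i)
  rw [toEuclideanCLM_eigenvector, norm_smul, hA.eigenvectorBasis.norm_eq_one] at h
  simp only [mul_one] at h
  exact (le_abs_self _).trans h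

theorem inv_eigenvalues_le_opNorm_inv (hA : A.PosDef) (i : Fin d) :
    (hA.isHermitian.eigenvalues i)⁻¹ ≤ opNorm A⁻¹ := by
  set v := hA.isHermitian.eigenvectorBasis i
  have hpos := hA.eigenvalues_pos i
  have hv : Matrix.toEuclideanCLM (𝕜 := ℝ) A⁻¹ v = (hA.isHermitian.eigenvalues i)⁻¹ • v := by
    have h1 : Matrix.toEuclideanCLM (𝕜 := ℝ) A⁻¹ (Matrix.toEuclideanCLM (𝕜 := ℝ) A v) = v := by
      rw [← mul_apply_eq_comp, ← map_mul,
        Matrix.nonsing_inv_mul _ ((Matrix.isUnit_iff_isUnit_det _).1 hA.isUnit), map_one]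
      rfl
    rw [toEuclideanCLM_eigenvector, map_smul] at h1
    rw [eq_inv_smul_iff₀ hpos.ne']
    exact h1
  have h := (Matrix.toEuclideanCLM (𝕜 := ℝ) A⁻¹).le_opNorm v
  rw [hv, norm_smul, hA.isHermitian.eigenvectorBasis.norm_eq_one] at h
  simp only [mul_one] at h
  exact (le_abs_self _).trans h

theorem opNorm_inv_pos (hd : 1 ≤ d) (hA : A.PosDef) : 0 < opNorm A⁻¹ :=
  (inv_pos.2 (hA.eigenvalues_pos ⟨0, hd⟩)).trans_le (inv_eigenvalues_le_opNorm_inv hA _)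

theorem opNorm_inv_le (hA : A.PosDef) {c : ℝ} (hc : 0 < c)
    (h : ∀ x : Param d, c * ‖x‖ ^ 2 ≤ quadForm A x) : opNorm A⁻¹ ≤ c⁻¹ := by
  refine ContinuousLinearMap.opNorm_le_bound _ (inv_pos.2 hc).le fun x => ?_
  set y := Matrix.toEuclideanCLM (𝕜 := ℝ) A⁻¹ x
  have hy : Matrix.toEuclideanCLM (𝕜 := ℝ) A y = x := by
    rw [← mul_apply_eq_comp, ← map_mul,
      Matrix.mul_nonsing_inv _ ((Matrix.isUnit_iff_isUnit_det _).1 hA.isUnit), map_one]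
    rfl
  have h1 := h y
  have h2 : quadForm A y ≤ ‖y‖ * ‖x‖ := by
    rw [quadForm, hy]; exact real_inner_le_norm y x
  rw [inv_mul_eq_div, le_div_iff₀ hc]
  rcases (norm_nonneg y).eq_or_lt with h0 | h0
  · rw [← h0]; simp
  · have : ‖y‖ * (‖y‖ * c) ≤ ‖y‖ * ‖x‖ := by nlinarith
    exact le_of_mul_le_mul_left this h0

theorem trace_inv_le (hA : A.PosDef) {c : ℝ} (hc : 0 < c)
    (h : ∀ x : Param d, c * ‖x‖ ^ 2 ≤ quadForm A x) : A⁻¹.trace ≤ d * c⁻¹ := by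
  rw [trace_inv_eq_sum hA]
  calc ∑ i, (hA.isHermitian.eigenvalues i)⁻¹ ≤ ∑ _i : Fin d, c⁻¹ :=
        Finset.sum_le_sum fun i _ =>
          inv_anti₀ hc (le_eigenvalues_of_mul_norm_sq_le_quadForm hA.isHermitian h i)
    _ = d * c⁻¹ := by simp

theorem trace_inv_add_smul_one_le (hA : A.PosDef) {c : ℝ} (hc : 0 ≤ c) :
    (A + c • 1)⁻¹.trace ≤ A⁻¹.trace := by
  have hpos := hA.eigenvalues_pos
  rw [trace_inv_add_smul_one hA.isHermitian fun i => add_pos_of_pos_of_nonneg (hpos i) hc,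
    trace_inv_eq_sum hA]
  exact Finset.sum_le_sum fun i _ => inv_anti₀ (hpos i) (le_add_of_nonneg_right hc)

theorem trace_inv_pos (hd : 1 ≤ d) (hA : A.PosDef) : 0 < A⁻¹.trace :=
  have : Nonempty (Fin d) := ⟨⟨0, hd⟩⟩
  hA.inv.trace_pos

theorem det_add_smul_one_le (hA : A.PosDef) {c K : ℝ} (hc : 0 ≤ c) (hK : opNorm A ≤ K) :
    (A + c • 1).det ≤ (K + c) ^ d := by
  rw [det_add_smul_one hA.isHermitian]
  calc ∏ i, (hA.isHermitian.eigenvalues i + c) ≤ ∏ _i : Fin d, (K + c) :=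
        Finset.prod_le_prod (fun i _ => add_nonneg (hA.eigenvalues_pos i).le hc) fun i _ =>
          add_le_add_left ((eigenvalues_le_opNorm hA.isHermitian i).trans hK) c
    _ = (K + c) ^ d := by simp

theorem posDef_add_smul_one (hA : A.PosDef) {c : ℝ} (hc : 0 ≤ c) : (A + c • 1).PosDef :=
  hA.add_posSemidef (Matrix.PosSemidef.one.smul hc)

end Matrices

/-! ### Multivariate Gaussian laws -/

section Gaussian

variable {d : ℕ}

theorem pi_gaussianReal_apply (s : Fin d → Set ℝ) (hs : ∀ i, MeasurableSet (s i)) :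
    ∏ i, gaussianReal 0 1 (s i) = ∫⁻ x in Set.univ.pi s,
      ENNReal.ofReal (∏ i, gaussianPDFReal 0 1 (x i)) := by
  have h1 : ∀ i, gaussianReal 0 1 (s i) =
      ENNReal.ofReal (∫ t, (s i).indicator (gaussianPDFReal 0 1) t) := fun i => by
    rw [gaussianReal_apply_eq_integral _ one_ne_zero, integral_indicator (hs i)]
  have hind : ∀ i t, 0 ≤ (s i).indicator (gaussianPDFReal 0 1) t := fun i t =>
    Set.indicator_nonneg (fun t _ => gaussianPDFReal_nonneg 0 1 t) t
  have hint : ∀ i, Integrable ((s i).indicator (gaussianPDFReal 0 1)) := fun i =>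
    (integrable_gaussianPDFReal 0 1).indicator (hs i)
  simp_rw [h1]
  rw [← ENNReal.ofReal_prod_of_nonneg fun i _ => integral_nonneg (hind i),
    ← integral_fintype_prod_eq_prod, ← lintegral_indicator (MeasurableSet.univ_pi hs),
    ofReal_integral_eq_lintegral_ofReal]
  · refine lintegral_congr fun x => ?_
    by_cases hx : x ∈ Set.univ.pi s
    · rw [Set.indicator_of_mem hx]
      congr 1
      exact Finset.prod_congr rfl fun i _ => Set.indicator_of_mem (hx i (Set.mem_univ i)) _
    · rw [Set.indicator_of_notMem hx]
      simp only [Set.mem_pi, Set.mem_univ, true_imp_iff, not_forall] at hx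
      obtain ⟨i, hi⟩ := hx
      rw [Finset.prod_eq_zero (Finset.mem_univ i) (Set.indicator_of_notMem hi _)]
      simp
  · exact Integrable.fintype_prod hint
  · exact .of_forall fun x => Finset.prod_nonneg fun i _ => hind i _

/-- Density of the standard Gaussian law. -/
theorem stdGaussian_eq_withDensity :
    stdGaussian (Param d) = volume.withDensity fun x =>
      ENNReal.ofReal ((√(2 * Real.pi) ^ d)⁻¹ * Real.exp (-‖x‖ ^ 2 / 2)) := by
  have hpi : Measure.pi (fun _ : Fin d => gaussianReal 0 1) =
      volume.withDensity fun x => ENNReal.ofReal (∏ i, gaussianPDFReal 0 1 (x i)) := by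
    refine Measure.pi_eq fun s hs => ?_
    rw [withDensity_apply _ (MeasurableSet.univ_pi hs), pi_gaussianReal_apply s hs]
  have hp := PiLp.volume_preserving_toLp (Fin d)
  ext B hB
  rw [← map_pi_eq_stdGaussian, Measure.map_apply hp.measurable hB, hpi,
    withDensity_apply _ (hp.measurable hB), withDensity_apply _ hB,
    ← hp.setLIntegral_comp_preimage hB (by fun_prop)]
  refine setLIntegral_congr_fun (hp.measurable hB) fun x _ => ?_
  simp only [gaussianPDFReal, NNReal.coe_one, mul_one, sub_zero, Finset.prod_mul_distrib,
    Finset.prod_const, Finset.card_univ, Fintype.card_fin, ← Real.exp_sum, inv_pow,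
    EuclideanSpace.real_norm_sq_eq, Finset.sum_neg_distrib, ← Finset.sum_div, neg_div]

/-- Normalizing constant of the Gaussian density with precision matrix `A`. -/
noncomputable def gaussConst (A : Matrix (Fin d) (Fin d) ℝ) : ℝ :=
  √A.det * (√(2 * Real.pi) ^ d)⁻¹

theorem gaussConst_pos {A : Matrix (Fin d) (Fin d) ℝ} (hA : A.PosDef) : 0 < gaussConst A := by
  have := hA.det_pos
  unfold gaussConst
  have := Real.pi_pos
  positivity

/-- The law is the image of the standard Gaussian under x ↦ m + S x with S the square root of A⁻¹.
Since S A S = 1, the quadratic form of `A` at S x is ‖x‖², and the Jacobian |det S| is (det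
A)^{-1/2}. -/
theorem multivariateGaussian_eq_withDensity {A : Matrix (Fin d) (Fin d) ℝ} (hA : A.PosDef)
    (m : Param d) :
    multivariateGaussian m A⁻¹ = volume.withDensity fun x =>
      ENNReal.ofReal (gaussConst A * Real.exp (-(1 / 2) * quadForm A (x - m))) := by
  open scoped MatrixOrder in
  set S := CFC.sqrt A⁻¹ with hS
  have hSS : S * S = A⁻¹ := CFC.sqrt_mul_sqrt_self _ hA.inv.posSemidef.nonneg
  have hSsa : IsSelfAdjoint S := (CFC.sqrt_nonneg A⁻¹).isSelfAdjoint
  have hAdet : A.det ≠ 0 := hA.det_pos.ne'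
  have hdet2 : S.det ^ 2 = (A.det)⁻¹ := by
    rw [sq, ← Matrix.det_mul, hSS, Matrix.det_nonsing_inv, Ring.inverse_eq_inv']
  have hSdet : S.det ≠ 0 := fun h => by
    rw [h] at hdet2
    exact inv_ne_zero hAdet (by simpa using hdet2.symm)
  have hSAS : S * A * S = 1 := by
    have h1 : S * (S * A) = 1 := by
      rw [← mul_assoc, hSS]
      exact Matrix.nonsing_inv_mul _ (isUnit_iff_ne_zero.2 hAdet)
    exact (mul_eq_one_comm.1 h1)
  set T := Matrix.toEuclideanCLM (𝕜 := ℝ) S with hT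
  have hTdet : LinearMap.det (T : Param d →ₗ[ℝ] Param d) = S.det := by
    have : (T : Param d →ₗ[ℝ] Param d) =
        Matrix.toLin (EuclideanSpace.basisFun (Fin d) ℝ).toBasis
          (EuclideanSpace.basisFun (Fin d) ℝ).toBasis S := by
      rw [hT, Matrix.coe_toEuclideanCLM_eq_toEuclideanLin,
        Matrix.toEuclideanLin_eq_toLin_orthonormal]
    rw [this, LinearMap.det_toLin]
  have hquad : ∀ x, quadForm A (T x) = ‖x‖ ^ 2 := by
    intro x
    have hadj : ∀ y, inner ℝ (T x) y = inner ℝ x (T y) := fun y => by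
      have h1 : IsSelfAdjoint T := hSsa.map _
      rw [← ContinuousLinearMap.adjoint_inner_right, h1.adjoint_eq]
    rw [quadForm, hadj, ← mul_apply_eq_comp, ← mul_apply_eq_comp, hT, ← map_mul, ← map_mul,
      hSAS, map_one, one_apply_eq_self, real_inner_self_eq_norm_sq]
  have hconst : |S.det| * gaussConst A = (√(2 * Real.pi) ^ d)⁻¹ := by
    have h1 : |S.det| * √A.det = 1 := by
      rw [← Real.sqrt_sq_eq_abs, hdet2, Real.sqrt_inv, inv_mul_cancel₀]
      exact (Real.sqrt_pos.2 hA.det_pos).ne'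
    rw [gaussConst, ← mul_assoc, h1, one_mul]
  have hmap := Measure.map_linearMap_addHaar_eq_smul_addHaar (volume : Measure (Param d))
    (f := (T : Param d →ₗ[ℝ] Param d)) (by rwa [hTdet])
  rw [hTdet] at hmap
  have hTm : Measurable T := T.continuous.measurable
  have hshift : Measurable fun x => m + T x := by fun_prop
  ext B hB
  rw [multivariateGaussian, ← hS, ← hT, stdGaussian_eq_withDensity,
    Measure.map_apply hshift hB, withDensity_apply _ (hshift hB), withDensity_apply _ hB]
  set F : Param d → ℝ≥0∞ := B.indicator fun x =>
    ENNReal.ofReal (gaussConst A * Real.exp (-(1 / 2) * quadForm A (x - m))) with hF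
  have hFm : Measurable F := Measurable.indicator (by fun_prop) hB
  have e1 : ∫⁻ y, F (m + y) = ∫⁻ x, F x := lintegral_add_left_eq_self F m
  have e2 : ∫⁻ y, F (m + y) = ENNReal.ofReal |S.det| * ∫⁻ x, F (m + T x) := by
    have h1 : ∫⁻ x, F (m + T x) = ∫⁻ y, F (m + y) ∂(Measure.map T volume) :=
      (lintegral_map (f := fun y => F (m + y)) (by fun_prop) hTm).symm
    have h2 : Measure.map T volume = ENNReal.ofReal |S.det⁻¹| • (volume : Measure (Param d)) := hmap
    rw [h1, h2, lintegral_smul_measure, smul_eq_mul, ← mul_assoc, ← ENNReal.ofReal_mul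
      (abs_nonneg _), ← abs_mul, mul_inv_cancel₀ hSdet]
    simp
  rw [← lintegral_indicator hB, ← hF, ← e1, e2, ← lintegral_const_mul _ (by fun_prop),
    ← lintegral_indicator (hshift hB)]
  refine lintegral_congr fun x => ?_
  by_cases hx : m + T x ∈ B
  · rw [hF, Set.indicator_of_mem (show x ∈ (fun x => m + T x) ⁻¹' B from hx),
      Set.indicator_of_mem hx, ← ENNReal.ofReal_mul (abs_nonneg _), ← mul_assoc, hconst,
      add_sub_cancel_left, hquad]
    congr 3; ring
  · rw [hF, Set.indicator_of_notMem (show x ∉ (fun x => m + T x) ⁻¹' B from hx),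
      Set.indicator_of_notMem hx, mul_zero]

theorem lintegral_exp_quadForm {A : Matrix (Fin d) (Fin d) ℝ} (hA : A.PosDef) (m : Param d) :
    ∫⁻ x, ENNReal.ofReal (gaussConst A * Real.exp (-(1 / 2) * quadForm A (x - m))) = 1 := by
  have h := measure_univ (μ := multivariateGaussian m A⁻¹)
  rwa [multivariateGaussian_eq_withDensity hA, withDensity_apply _ MeasurableSet.univ,
    Measure.restrict_univ] at h

/-- The factor exp(s (‖x - m‖² - r²)/2) is at least 1 on the event and changes the precision from A
to A - s. What remains is a ratio of Gaussian normalizing constants. -/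
theorem multivariateGaussian_norm_ge_le_chernoff {A : Matrix (Fin d) (Fin d) ℝ} (hA : A.PosDef)
    (m : Param d) {s : ℝ} (hs : 0 ≤ s) (hAs : (A + (-s) • 1).PosDef) (r : ℝ) (hr : 0 ≤ r) :
    multivariateGaussian m A⁻¹ {x | r ≤ ‖x - m‖} ≤
      ENNReal.ofReal (Real.exp (-(s / 2 * r ^ 2)) * (gaussConst A / gaussConst (A + (-s) • 1))) := by
  have hm : MeasurableSet {x : Param d | r ≤ ‖x - m‖} :=
    measurableSet_le measurable_const (by fun_prop)
  have hc := gaussConst_pos hAs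
  have hcA := gaussConst_pos hA
  rw [multivariateGaussian_eq_withDensity hA, withDensity_apply _ hm]
  set c := Real.exp (-(s / 2 * r ^ 2)) * (gaussConst A / gaussConst (A + (-s) • 1))
  have hc0 : 0 ≤ c := by positivity
  calc ∫⁻ x in {x | r ≤ ‖x - m‖},
        ENNReal.ofReal (gaussConst A * Real.exp (-(1 / 2) * quadForm A (x - m)))
      ≤ ∫⁻ x in {x | r ≤ ‖x - m‖}, ENNReal.ofReal c * ENNReal.ofReal
          (gaussConst (A + (-s) • 1) * Real.exp (-(1 / 2) * quadForm (A + (-s) • 1) (x - m))) := by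
        refine setLIntegral_mono' hm fun x hx => ?_
        rw [← ENNReal.ofReal_mul hc0]
        refine ENNReal.ofReal_le_ofReal ?_
        have e : c * (gaussConst (A + (-s) • 1) *
            Real.exp (-(1 / 2) * quadForm (A + (-s) • 1) (x - m))) = gaussConst A *
            Real.exp (-(1 / 2) * quadForm A (x - m) + s / 2 * (‖x - m‖ ^ 2 - r ^ 2)) := by
          rw [quadForm_add_smul_one]
          have e1 : -(1 / 2) * quadForm A (x - m) + s / 2 * (‖x - m‖ ^ 2 - r ^ 2) =
              -(s / 2 * r ^ 2) + -(1 / 2) * (quadForm A (x - m) + -s * ‖x - m‖ ^ 2) := by ring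
          rw [e1, Real.exp_add]
          simp only [c]
          field_simp
        rw [e]
        gcongr
        have hx' : r ≤ ‖x - m‖ := hx
        have : r ^ 2 ≤ ‖x - m‖ ^ 2 := pow_le_pow_left₀ hr hx' 2
        have : 0 ≤ s / 2 * (‖x - m‖ ^ 2 - r ^ 2) := mul_nonneg (by linarith) (by linarith)
        linarith
    _ ≤ ∫⁻ x, ENNReal.ofReal c * ENNReal.ofReal
          (gaussConst (A + (-s) • 1) * Real.exp (-(1 / 2) * quadForm (A + (-s) • 1) (x - m))) :=
        setLIntegral_le_lintegral _ _
    _ = ENNReal.ofReal c := by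
        rw [lintegral_const_mul _ (by fun_prop), lintegral_exp_quadForm hAs, mul_one]

/-- Gaussian concentration of the norm, with the sharp exponent. -/
theorem multivariateGaussian_norm_ge_le {A : Matrix (Fin d) (Fin d) ℝ} (hd : 1 ≤ d)
    (hA : A.PosDef) (m : Param d) {r : ℝ} (hr : √A⁻¹.trace < r) :
    (multivariateGaussian m A⁻¹).real {x | r ≤ ‖x - m‖} ≤
      Real.exp (-(1 / 2) * (r - √A⁻¹.trace) ^ 2 * (opNorm A⁻¹)⁻¹) := by
  set τ := A⁻¹.trace with hτ_def
  set σ := opNorm A⁻¹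
  set a := hA.isHermitian.eigenvalues with ha_def
  have ha : ∀ i, 0 < a i := hA.eigenvalues_pos
  have hτ : 0 < τ := trace_inv_pos hd hA
  have hσ : 0 < σ := opNorm_inv_pos hd hA
  have haσ : ∀ i, (a i)⁻¹ ≤ σ := inv_eigenvalues_le_opNorm_inv hA
  have hr0 : 0 < r := (Real.sqrt_nonneg _).trans_lt hr
  have hτr : τ < r ^ 2 := (Real.sqrt_lt' hr0).1 hr
  -- With s = t/σ the logarithm of the Chernoff bound is at most -t r²/(2σ) - (τ/(2σ)) log(1 - t),
  -- which is minimal at 1 - t = τ/r². As t < 1, the matrix A - s stays positive definite.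
  set t := 1 - τ / r ^ 2
  have hr2 : 0 < r ^ 2 := by positivity
  have ht0 : 0 < t := by
    have : τ / r ^ 2 < 1 := (div_lt_one hr2).2 hτr
    simp only [t]; linarith
  have ht1 : t < 1 := by
    have : 0 < τ / r ^ 2 := by positivity
    simp only [t]; linarith
  set s := t / σ
  have hs : 0 < s := by positivity
  have has : ∀ i, 0 < a i + -s := fun i => by
    have h1 : σ⁻¹ ≤ a i := inv_le_of_inv_le₀ (ha i) (haσ i)
    have h2 : s < σ⁻¹ := by
      rw [← one_div]; exact div_lt_div_of_pos_right ht1 hσ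
    linarith
  have hAs : (A + (-s) • 1).PosDef := by
    have hherm : (A + (-s) • 1).IsHermitian := by
      refine hA.isHermitian.add ?_
      simp [Matrix.IsHermitian]
    obtain ⟨c, hc0, hc⟩ : ∃ c, 0 < c ∧ ∀ i, c ≤ a i + -s := by
      have : Nonempty (Fin d) := ⟨⟨0, hd⟩⟩
      obtain ⟨i, hi⟩ := Finite.exists_min fun i => a i + -s
      exact ⟨_, has i, hi⟩
    refine posDef_of_quadForm_pos hherm fun x hx => ?_
    rw [quadForm_add_smul_one]
    have h1 := mul_norm_sq_le_quadForm hA.isHermitian (c := c + s)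
      (fun i => by have := hc i; linarith) x
    have h2 : 0 < c * ‖x‖ ^ 2 := mul_pos hc0 (pow_pos (norm_pos_iff.2 hx) 2)
    nlinarith
  have hch := multivariateGaussian_norm_ge_le_chernoff hA m hs.le hAs r hr0.le
  have hratio : gaussConst A / gaussConst (A + (-s) • 1) =
      √(∏ i, (a i / (a i + -s))) := by
    rw [gaussConst, gaussConst, det_eq_prod_eigenvalues hA.isHermitian,
      det_add_smul_one hA.isHermitian, mul_div_mul_right _ _ (by positivity), ← Real.sqrt_div
      (Finset.prod_nonneg fun i _ => (ha i).le), Finset.prod_div_distrib]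
  -- With b = aᵢ⁻¹/σ in [0, 1], concavity of the logarithm gives log(1 - bt) ≥ b log(1 - t). The
  -- weights b add up to τ/σ, so only the trace and the norm of A⁻¹ survive.
  have hlog : ∀ i, a i / (a i + -s) ≤ Real.exp (-((a i)⁻¹ / σ) * Real.log (1 - t)) := by
    intro i
    have h1 : a i / (a i + -s) = (1 - s * (a i)⁻¹)⁻¹ := by
      have := (ha i).ne'
      rw [eq_comm, inv_eq_iff_eq_inv, inv_div]
      field_simp
      ring
    set b := (a i)⁻¹ / σ
    have hb0 : 0 ≤ b := div_nonneg (inv_nonneg.2 (ha i).le) hσ.le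
    have hb1 : b ≤ 1 := (div_le_one hσ).2 (haσ i)
    have h2 : s * (a i)⁻¹ = b * t := by simp only [s, b]; ring
    have h3 : 0 < 1 - b * t := by nlinarith
    have h4 : b * Real.log (1 - t) ≤ Real.log (1 - b * t) := by
      have hcc := strictConcaveOn_log_Ioi.concaveOn.2 (x := 1 - t) (y := 1)
        (by simpa using ht1) (by simp) hb0 (by linarith : 0 ≤ 1 - b) (by ring)
      simp only [smul_eq_mul, Real.log_one, mul_zero, add_zero, mul_one] at hcc
      refine hcc.trans (le_of_eq ?_)
      congr 1; ring
    rw [h1, h2, ← Real.exp_log h3, ← Real.exp_neg, Real.exp_le_exp]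
    linarith
  have hprod : ∏ i, (a i / (a i + -s)) ≤ Real.exp (-(τ / σ) * Real.log (1 - t)) := by
    calc ∏ i, (a i / (a i + -s)) ≤ ∏ i, Real.exp (-((a i)⁻¹ / σ) * Real.log (1 - t)) :=
          Finset.prod_le_prod (fun i _ => (div_pos (ha i) (has i)).le) fun i _ => hlog i
      _ = Real.exp (-(τ / σ) * Real.log (1 - t)) := by
          rw [← Real.exp_sum, ← Finset.sum_mul, Finset.sum_neg_distrib, ← Finset.sum_div,
            hτ_def, trace_inv_eq_sum hA]
  have hexp : Real.exp (-(s / 2 * r ^ 2)) * √(∏ i, (a i / (a i + -s))) ≤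
      Real.exp (-(1 / 2) * (r - √τ) ^ 2 * σ⁻¹) := by
    have h1 : √(∏ i, (a i / (a i + -s))) ≤ Real.exp (-(τ / σ) * Real.log (1 - t) / 2) := by
      rw [Real.exp_half]
      exact Real.sqrt_le_sqrt hprod
    refine (mul_le_mul_of_nonneg_left h1 (Real.exp_pos _).le).trans ?_
    rw [← Real.exp_add, Real.exp_le_exp]
    have h2 : 1 - t = (√τ / r) ^ 2 := by
      simp only [t]; rw [div_pow, Real.sq_sqrt hτ.le]; ring
    have hq : 0 < √τ := Real.sqrt_pos.2 hτ
    -- The inequality log y ≤ y - 1 at y = r/√τ completes the square: -(r² - τ)/2 + (√τ r - τ) = -(r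
    -- - √τ)²/2.
    have h3 : -Real.log (1 - t) ≤ 2 * (r / √τ - 1) := by
      rw [h2, Real.log_pow]
      have : -Real.log (√τ / r) = Real.log (r / √τ) := by rw [← Real.log_inv, inv_div]
      have h5 := Real.log_le_sub_one_of_pos (div_pos hr0 hq)
      push_cast
      linarith
    have h4 : τ * (r / √τ - 1) = √τ * r - τ := by
      have : τ = √τ * √τ := (Real.mul_self_sqrt hτ.le).symm
      rw [mul_sub, mul_one]
      congr 1
      nth_rewrite 1 [this]
      field_simp
    have h6 : s * r ^ 2 = (r ^ 2 - τ) * σ⁻¹ := by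
      simp only [s, t]; field_simp
    have h7 : -(τ / σ) * Real.log (1 - t) / 2 ≤ (√τ * r - τ) * σ⁻¹ := by
      have h8 := mul_le_mul_of_nonneg_left h3 (by positivity : 0 ≤ τ * σ⁻¹ / 2)
      have h9 : τ * σ⁻¹ / 2 * (2 * (r / √τ - 1)) = (τ * (r / √τ - 1)) * σ⁻¹ := by ring
      rw [h9, h4] at h8
      refine le_trans (le_of_eq ?_) h8
      rw [div_eq_mul_inv τ σ]; ring
    have h10 : (r - √τ) ^ 2 = r ^ 2 - 2 * √τ * r + τ := by
      rw [sub_sq, Real.sq_sqrt hτ.le]; ring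
    have h11 : -(s / 2 * r ^ 2) = -(1 / 2) * ((r ^ 2 - τ) * σ⁻¹) := by rw [← h6]; ring
    rw [h10, h11]
    linarith
  rw [hratio] at hch
  refine ENNReal.toReal_le_of_le_ofReal (Real.exp_pos _).le (hch.trans ?_)
  exact ENNReal.ofReal_le_ofReal hexp

theorem integral_sub_pow_four_gaussianReal (μ : ℝ) (v : NNReal) :
    Integrable (fun x => (x - μ) ^ 4) (gaussianReal μ v) ∧
      ∫ x, (x - μ) ^ 4 ∂(gaussianReal μ v) = 3 * (v : ℝ) ^ 2 := by
  have hmap : (gaussianReal μ v).map (fun x => x - μ) = gaussianReal 0 v := by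
    rw [gaussianReal_map_sub_const, sub_self]
  have hmem : MemLp (fun x : ℝ => x) 4 (gaussianReal 0 v) := memLp_id_gaussianReal 4
  have hint : Integrable (fun x : ℝ => x ^ 4) (gaussianReal 0 v) := by
    have := hmem.integrable_norm_pow (by norm_num)
    refine this.congr (.of_forall fun x => ?_)
    simp only [Real.norm_eq_abs]
    exact (by decide : Even 4).pow_abs x
  have hm : AEMeasurable (fun x : ℝ => x - μ) (gaussianReal μ v) := by fun_prop
  constructor
  · have h := (integrable_map_measure (f := fun x : ℝ => x - μ) (g := fun x : ℝ => x ^ 4)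
      (μ := gaussianReal μ v) (by fun_prop) hm).1 (by rwa [hmap])
    exact h
  have h1 : ∫ x, (x - μ) ^ 4 ∂(gaussianReal μ v) = ∫ x, x ^ 4 ∂(gaussianReal 0 v) := by
    rw [← hmap, integral_map hm (by fun_prop)]
  have hmgf : mgf id (gaussianReal 0 v) = fun t => Real.exp (v * t ^ 2 / 2) := by
    ext t
    rw [mgf_gaussianReal (X := id) (μ := 0) (v := v) (by simp)]
    simp
  have hset : integrableExpSet id (gaussianReal 0 v) = Set.univ := by
    ext t
    simpa [integrableExpSet] using integrable_exp_mul_gaussianReal t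
  have h2 := iteratedDeriv_mgf_zero (X := id) (μ := gaussianReal 0 v) (by rw [hset]; simp) 4
  -- Differentiating P(t) e^{vt²/2} maps the polynomial P to P' + v t P. Four applications to P = 1,
  -- evaluated at 0, give the fourth moment 3v².
  have d0 : ∀ P P' : ℝ → ℝ, (∀ t, HasDerivAt P (P' t) t) →
      deriv (fun t => P t * Real.exp (v * t ^ 2 / 2)) =
        fun t => (P' t + P t * (v * t)) * Real.exp (v * t ^ 2 / 2) := by
    intro P P' hP
    ext t
    have he : HasDerivAt (fun t : ℝ => Real.exp (v * t ^ 2 / 2))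
        (Real.exp (v * t ^ 2 / 2) * (v * t)) t := by
      have h := ((hasDerivAt_pow 2 t).const_mul (v : ℝ)).div_const 2
      have h' : HasDerivAt (fun t : ℝ => (v : ℝ) * t ^ 2 / 2) (v * t) t := by
        convert! h using 1
        push_cast; ring
      exact h'.exp
    refine (((hP t).mul he).deriv).trans ?_
    ring
  have h3 : iteratedDeriv 4 (fun t : ℝ => Real.exp (v * t ^ 2 / 2)) 0 = 3 * (v : ℝ) ^ 2 := by
    have e0 : (fun t : ℝ => Real.exp (v * t ^ 2 / 2)) =
        fun t => (1 : ℝ) * Real.exp (v * t ^ 2 / 2) := by ext; simp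
    have p1 : ∀ t : ℝ, HasDerivAt (fun _ : ℝ => (1 : ℝ)) 0 t := fun t => hasDerivAt_const t 1
    have p2 : ∀ t : ℝ, HasDerivAt (fun t : ℝ => 0 + 1 * ((v : ℝ) * t)) v t := fun t => by
      simpa using (hasDerivAt_id t).const_mul (v : ℝ)
    have p3 : ∀ t : ℝ, HasDerivAt (fun t : ℝ => (v : ℝ) + (0 + 1 * ((v : ℝ) * t)) * (v * t))
        (2 * v ^ 2 * t) t := fun t => by
      have h := ((hasDerivAt_pow 2 t).const_mul ((v : ℝ) ^ 2)).const_add (v : ℝ)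
      convert! h using 1
      · ext t; ring
      · simp; ring
    have p4 : ∀ t : ℝ, HasDerivAt (fun t : ℝ => 2 * (v : ℝ) ^ 2 * t +
        ((v : ℝ) + (0 + 1 * ((v : ℝ) * t)) * (v * t)) * (v * t))
        (3 * v ^ 2 + 3 * v ^ 3 * t ^ 2) t := fun t => by
      have h := ((hasDerivAt_id t).const_mul (3 * (v : ℝ) ^ 2)).add
        ((hasDerivAt_pow 3 t).const_mul ((v : ℝ) ^ 3))
      convert! h using 1
      · ext t; simp; ring
      · simp; ring
    rw [e0, iteratedDeriv_succ', d0 _ _ p1, iteratedDeriv_succ', d0 _ _ p2, iteratedDeriv_succ',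
      d0 _ _ p3, iteratedDeriv_succ', d0 _ _ p4]
    simp
  rw [hmgf, h3] at h2
  rw [h1, h2]
  simp

/-- Cauchy–Schwarz with weights Sᵢᵢ gives (∑ yᵢ²)² ≤ tr S · ∑ yᵢ⁴/Sᵢᵢ. Hence only the
one-dimensional marginals matter, each with fourth moment 3Sᵢᵢ². The constant √3 of `C₁` originates
here. -/
theorem integral_norm_pow_four_multivariateGaussian_le {S : Matrix (Fin d) (Fin d) ℝ}
    (hS : S.PosDef) (m : Param d) :
    Integrable (fun x => ‖x - m‖ ^ 4) (multivariateGaussian m S) ∧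
      ∫ x, ‖x - m‖ ^ 4 ∂(multivariateGaussian m S) ≤ 3 * S.trace ^ 2 := by
  have hdiag : ∀ i, 0 < S i i := fun i => hS.diag_pos
  have hcoord : ∀ i, Integrable (fun x : Param d => (x i - m i) ^ 4) (multivariateGaussian m S) ∧
      ∫ x : Param d, (x i - m i) ^ 4 ∂(multivariateGaussian m S) = 3 * S i i ^ 2 := by
    intro i
    have hmp := measurePreserving_eval_multivariateGaussian (μ := m) hS.posSemidef (i := i)
    obtain ⟨h1, h2⟩ := integral_sub_pow_four_gaussianReal (m i) (S i i).toNNReal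
    refine ⟨(hmp.integrable_comp h1.aestronglyMeasurable).2 h1, ?_⟩
    rw [Real.coe_toNNReal _ (hdiag i).le] at h2
    rw [← h2, ← hmp.map_eq, integral_map hmp.measurable.aemeasurable (by fun_prop)]
  have hsumi : Integrable (fun x : Param d => S.trace * ∑ i, (x i - m i) ^ 4 / S i i)
      (multivariateGaussian m S) :=
    (integrable_finsetSum _ fun i _ => (hcoord i).1.div_const _).const_mul _
  have hpt : ∀ x : Param d, ‖x - m‖ ^ 4 ≤ S.trace * ∑ i, (x i - m i) ^ 4 / S i i := by
    intro x
    have h1 : ‖x - m‖ ^ 4 = (∑ i, (x i - m i) ^ 2) ^ 2 := by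
      have h2 : ‖x - m‖ ^ 2 = ∑ i, (x i - m i) ^ 2 := EuclideanSpace.real_norm_sq_eq (x - m)
      rw [← h2]
      ring
    rw [h1, Matrix.trace]
    refine Finset.sum_sq_le_sum_mul_sum_of_sq_le_mul _ (fun i _ => (hdiag i).le)
      (fun i _ => div_nonneg (by positivity) (hdiag i).le) fun i _ => ?_
    have := (hdiag i).ne'
    simp only [Matrix.diag_apply]
    refine le_of_eq ?_
    field_simp
  have hint : Integrable (fun x => ‖x - m‖ ^ 4) (multivariateGaussian m S) :=
    hsumi.mono' (by fun_prop) (.of_forall fun x => by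
      rw [Real.norm_of_nonneg (by positivity)]; exact hpt x)
  refine ⟨hint, (integral_mono hint hsumi hpt).trans (le_of_eq ?_)⟩
  rw [integral_const_mul, integral_finsetSum _ fun i _ => (hcoord i).1.div_const _]
  simp_rw [integral_div, (hcoord _).2]
  have : ∀ i, 3 * S i i ^ 2 / S i i = 3 * S i i := fun i => by
    have := (hdiag i).ne'
    field_simp
  simp_rw [this, ← Finset.mul_sum]
  simp only [Matrix.trace, Matrix.diag_apply]
  ring

end Gaussian

/-! ### Taylor estimates from a bound on the third derivative -/

section Calculus

/-- Mean value theorem for φ minus a primitive of the quadratic. All Taylor estimates below except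
the Hessian increment bound follow by restriction to segments, without integration. -/
theorem le_sub_of_quadratic_le_deriv {φ φ' : ℝ → ℝ} {a b c : ℝ}
    (hφ : ∀ t ∈ Set.Icc (0 : ℝ) 1, HasDerivAt φ (φ' t) t)
    (h : ∀ t ∈ Set.Icc (0 : ℝ) 1, a + b * t + c * t ^ 2 ≤ φ' t) :
    a + b / 2 + c / 3 ≤ φ 1 - φ 0 := by
  set q : ℝ → ℝ := fun t => a * t + b / 2 * t ^ 2 + c / 3 * t ^ 3
  have hq : ∀ t, HasDerivAt q (a + b * t + c * t ^ 2) t := fun t => by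
    have h1 := (((hasDerivAt_id t).const_mul a).add ((hasDerivAt_pow 2 t).const_mul (b / 2))).add
      ((hasDerivAt_pow 3 t).const_mul (c / 3))
    convert! h1 using 1
    simp; ring
  have hd : ∀ t ∈ Set.Icc (0 : ℝ) 1,
      HasDerivAt (fun t => φ t - q t) (φ' t - (a + b * t + c * t ^ 2)) t := fun t ht =>
    (hφ t ht).sub (hq t)
  obtain ⟨t, ht, hslope⟩ := exists_hasDerivAt_eq_slope (fun t => φ t - q t)
    (fun t => φ' t - (a + b * t + c * t ^ 2)) zero_lt_one
    (fun t ht => (hd t ht).continuousAt.continuousWithinAt)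
    (fun t ht => hd t (Set.Ioo_subset_Icc_self ht))
  have h1 := h t (Set.Ioo_subset_Icc_self ht)
  have h2 : q 1 = a + b / 2 + c / 3 := by simp [q]
  have h3 : q 0 = 0 := by simp [q]
  rw [h2, h3] at hslope
  norm_num at hslope
  linarith

variable {E : Type*} [NormedAddCommGroup E] [NormedSpace ℝ E] {f : E → ℝ} {c : E} {R M : ℝ}

/-- `f` is `C³` on the open ball with third derivative bounded by `M`. -/
structure ThirdDerivBound (f : E → ℝ) (c : E) (R M : ℝ) : Prop where
  contDiffAt : ∀ x ∈ Metric.ball c R, ContDiffAt ℝ 3 f x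
  norm_le : ∀ x ∈ Metric.ball c R, ‖iteratedFDeriv ℝ 3 f x‖ ≤ M

namespace ThirdDerivBound

theorem of_contDiffOn (hf : ContDiffOn ℝ 3 f (Metric.closedBall c R))
    (hM : ∀ x ∈ Metric.closedBall c R,
      ‖iteratedFDerivWithin ℝ 3 f (Metric.closedBall c R) x‖ ≤ M) :
    ThirdDerivBound f c R M := by
  have hn : ∀ x ∈ Metric.ball c R, Metric.closedBall c R ∈ 𝓝 x := fun x hx =>
    mem_of_superset (Metric.isOpen_ball.mem_nhds hx) Metric.ball_subset_closedBall
  refine ⟨fun x hx => hf.contDiffAt (hn x hx), fun x hx => ?_⟩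
  have h := hM x (Metric.ball_subset_closedBall hx)
  have h1 : iteratedFDerivWithin ℝ 3 f (Metric.closedBall c R) x = iteratedFDeriv ℝ 3 f x := by
    rw [← iteratedFDerivWithin_univ]
    refine iteratedFDerivWithin_congr_set ?_ 3
    rw [eventuallyEq_univ]
    exact hn x hx
  rwa [h1] at h

theorem mono {r : ℝ} (h : ThirdDerivBound f c R M) (hr : r ≤ R) : ThirdDerivBound f c r M :=
  ⟨fun x hx => h.contDiffAt x (Metric.ball_subset_ball hr hx),
    fun x hx => h.norm_le x (Metric.ball_subset_ball hr hx)⟩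

variable (h : ThirdDerivBound f c R M)

include h

theorem hasFDerivAt {x : E} (hx : x ∈ Metric.ball c R) : HasFDerivAt f (fderiv ℝ f x) x :=
  ((h.contDiffAt x hx).differentiableAt (by norm_num)).hasFDerivAt

theorem hasFDerivAt_fderiv {x : E} (hx : x ∈ Metric.ball c R) :
    HasFDerivAt (fderiv ℝ f) (fderiv ℝ (fderiv ℝ f) x) x :=
  (((h.contDiffAt x hx).fderiv_right (m := 2) (by norm_num)).differentiableAt
    (by norm_num)).hasFDerivAt

theorem norm_hess_sub_le {x : E} (hx : x ∈ Metric.ball c R) :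
    ‖fderiv ℝ (fderiv ℝ f) x - fderiv ℝ (fderiv ℝ f) c‖ ≤ M * ‖x - c‖ := by
  have hR : 0 < R := dist_nonneg.trans_lt hx
  have hdiff : ∀ y ∈ Metric.ball c R, DifferentiableAt ℝ (fderiv ℝ (fderiv ℝ f)) y := fun y hy =>
    (((h.contDiffAt y hy).fderiv_right (m := 2) (by norm_num)).fderiv_right (m := 1)
      (by norm_num)).differentiableAt (by norm_num)
  refine (convex_ball c R).norm_image_sub_le_of_norm_fderiv_le (𝕜 := ℝ)
    (G := E →L[ℝ] E →L[ℝ] ℝ) (f := fderiv ℝ (fderiv ℝ f)) hdiff (fun y hy => ?_)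
    (Metric.mem_ball_self hR) hx
  rw [← norm_iteratedFDeriv_one, norm_iteratedFDeriv_fderiv, norm_iteratedFDeriv_fderiv]
  exact h.norm_le y hy

theorem norm_hess_le (hM : 0 ≤ M) {x : E} (hx : x ∈ Metric.ball c R) :
    ‖fderiv ℝ (fderiv ℝ f) x‖ ≤ ‖fderiv ℝ (fderiv ℝ f) c‖ + M * R := by
  have h1 := h.norm_hess_sub_le hx
  have h2 : ‖x - c‖ ≤ R := by rw [← dist_eq_norm]; exact (Metric.mem_ball.1 hx).le
  have h3 := norm_le_norm_add_norm_sub' (fderiv ℝ (fderiv ℝ f) x) (fderiv ℝ (fderiv ℝ f) c)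
  have h4 : M * ‖x - c‖ ≤ M * R := mul_le_mul_of_nonneg_left h2 hM
  linarith

omit h in
theorem lineMap_mem {x y : E} (hx : x ∈ Metric.ball c R) (hy : y ∈ Metric.ball c R) {t : ℝ}
    (ht : t ∈ Set.Icc (0 : ℝ) 1) : x + t • (y - x) ∈ Metric.ball c R :=
  (convex_ball c R).add_smul_sub_mem hx hy ht

omit h in
theorem hasDerivAt_line (x v : E) (t : ℝ) : HasDerivAt (fun t : ℝ => x + t • v) v t := by
  simpa using ((hasDerivAt_id t).smul_const v).const_add x

theorem hasDerivAt_comp_line {x v : E} {t : ℝ} (hx : x + t • v ∈ Metric.ball c R) :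
    HasDerivAt (fun t : ℝ => f (x + t • v)) (fderiv ℝ f (x + t • v) v) t :=
  (h.hasFDerivAt hx).comp_hasDerivAt t (hasDerivAt_line x v t)

theorem hasDerivAt_fderiv_comp_line {x v k : E} {t : ℝ} (hx : x + t • v ∈ Metric.ball c R) :
    HasDerivAt (fun t : ℝ => fderiv ℝ f (x + t • v) k)
      (fderiv ℝ (fderiv ℝ f) (x + t • v) v k) t := by
  have h1 := (h.hasFDerivAt_fderiv hx).comp_hasDerivAt t (hasDerivAt_line x v t)
  simpa using h1.clm_apply (hasDerivAt_const t k)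

/-- First-order Taylor estimate for the gradient at the centre. -/
theorem abs_fderiv_sub_le {x : E} (hx : x ∈ Metric.ball c R) (k : E) :
    |fderiv ℝ f x k - fderiv ℝ f c k - fderiv ℝ (fderiv ℝ f) c (x - c) k| ≤
      M / 2 * ‖x - c‖ ^ 2 * ‖k‖ := by
  have hR : 0 < R := dist_nonneg.trans_lt hx
  have hc : c ∈ Metric.ball c R := Metric.mem_ball_self hR
  have hb : ∀ t ∈ Set.Icc (0 : ℝ) 1, |fderiv ℝ (fderiv ℝ f) (c + t • (x - c)) (x - c) k -
      fderiv ℝ (fderiv ℝ f) c (x - c) k| ≤ M * ‖x - c‖ ^ 2 * ‖k‖ * t := by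
    intro t ht
    have h1 := h.norm_hess_sub_le (lineMap_mem hc hx ht)
    rw [add_sub_cancel_left, norm_smul, Real.norm_of_nonneg ht.1] at h1
    have h2 := (fderiv ℝ (fderiv ℝ f) (c + t • (x - c)) -
      fderiv ℝ (fderiv ℝ f) c).le_opNorm₂ (x - c) k
    simp only [sub_apply, Real.norm_eq_abs] at h2
    refine h2.trans ?_
    calc _ ≤ M * (t * ‖x - c‖) * ‖x - c‖ * ‖k‖ := by gcongr
      _ = M * ‖x - c‖ ^ 2 * ‖k‖ * t := by ring
  have hder : ∀ t ∈ Set.Icc (0 : ℝ) 1, HasDerivAt (fun t : ℝ => fderiv ℝ f (c + t • (x - c)) k)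
      (fderiv ℝ (fderiv ℝ f) (c + t • (x - c)) (x - c) k) t := fun t ht =>
    h.hasDerivAt_fderiv_comp_line (lineMap_mem hc hx ht)
  have hlow := le_sub_of_quadratic_le_deriv (a := fderiv ℝ (fderiv ℝ f) c (x - c) k)
    (b := -(M * ‖x - c‖ ^ 2 * ‖k‖)) (c := 0) hder
    fun t ht => by have := (abs_le.1 (hb t ht)).1; linarith
  have hup := le_sub_of_quadratic_le_deriv (a := -fderiv ℝ (fderiv ℝ f) c (x - c) k)
    (b := -(M * ‖x - c‖ ^ 2 * ‖k‖)) (c := 0) (fun t ht => (hder t ht).neg)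
    fun t ht => by have := (abs_le.1 (hb t ht)).2; linarith
  simp only [one_smul, zero_smul, add_zero, add_sub_cancel, zero_div, Pi.neg_apply] at hlow hup
  rw [abs_le]
  constructor <;> linarith

/-- Second-order Taylor lower bound at the centre. -/
theorem taylor_lower {x : E} (hx : x ∈ Metric.ball c R) :
    f c + fderiv ℝ f c (x - c) + fderiv ℝ (fderiv ℝ f) c (x - c) (x - c) / 2 -
      M / 6 * ‖x - c‖ ^ 3 ≤ f x := by
  have hR : 0 < R := dist_nonneg.trans_lt hx
  have hc : c ∈ Metric.ball c R := Metric.mem_ball_self hR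
  have hlow := le_sub_of_quadratic_le_deriv (φ := fun t : ℝ => f (c + t • (x - c)))
    (a := fderiv ℝ f c (x - c))
    (b := fderiv ℝ (fderiv ℝ f) c (x - c) (x - c)) (c := -(M / 2 * ‖x - c‖ ^ 3))
    (fun t ht => h.hasDerivAt_comp_line (lineMap_mem hc hx ht)) fun t ht => by
      have h1 := (abs_le.1 (h.abs_fderiv_sub_le (lineMap_mem hc hx ht) (x - c))).1
      rw [add_sub_cancel_left, norm_smul, Real.norm_of_nonneg ht.1, map_smul, smul_apply,
        smul_eq_mul] at h1
      nlinarith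
  simp only [one_smul, zero_smul, add_zero, add_sub_cancel] at hlow
  linarith

/-- First-order Taylor estimate from a bound on the Hessian. -/
theorem abs_sub_sub_fderiv_le {L : ℝ} (hL : ∀ x ∈ Metric.ball c R,
    ‖fderiv ℝ (fderiv ℝ f) x‖ ≤ 2 * L) {x y : E} (hx : x ∈ Metric.ball c R)
    (hy : y ∈ Metric.ball c R) : |f y - f x - fderiv ℝ f x (y - x)| ≤ L * ‖y - x‖ ^ 2 := by
  have hb : ∀ t ∈ Set.Icc (0 : ℝ) 1, |fderiv ℝ f (x + t • (y - x)) (y - x) -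
      fderiv ℝ f x (y - x)| ≤ 2 * L * ‖y - x‖ ^ 2 * t := by
    intro t ht
    have h1 := (convex_ball c R).norm_image_sub_le_of_norm_fderiv_le (𝕜 := ℝ)
      (fun y hy => (h.hasFDerivAt_fderiv hy).differentiableAt) hL hx (lineMap_mem hx hy ht)
    rw [add_sub_cancel_left, norm_smul, Real.norm_of_nonneg ht.1] at h1
    have h2 := (fderiv ℝ f (x + t • (y - x)) - fderiv ℝ f x).le_opNorm (y - x)
    simp only [sub_apply, Real.norm_eq_abs] at h2
    refine h2.trans ?_
    calc _ ≤ 2 * L * (t * ‖y - x‖) * ‖y - x‖ := by gcongr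
      _ = 2 * L * ‖y - x‖ ^ 2 * t := by ring
  have hder : ∀ t ∈ Set.Icc (0 : ℝ) 1, HasDerivAt (fun t : ℝ => f (x + t • (y - x)))
      (fderiv ℝ f (x + t • (y - x)) (y - x)) t := fun t ht =>
    h.hasDerivAt_comp_line (lineMap_mem hx hy ht)
  have hlow := le_sub_of_quadratic_le_deriv (a := fderiv ℝ f x (y - x))
    (b := -(2 * L * ‖y - x‖ ^ 2)) (c := 0) hder
    fun t ht => by have := (abs_le.1 (hb t ht)).1; linarith
  have hup := le_sub_of_quadratic_le_deriv (a := -fderiv ℝ f x (y - x))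
    (b := -(2 * L * ‖y - x‖ ^ 2)) (c := 0) (fun t ht => (hder t ht).neg)
    fun t ht => by have := (abs_le.1 (hb t ht)).2; linarith
  simp only [one_smul, zero_smul, add_zero, add_sub_cancel, zero_div, Pi.neg_apply] at hlow hup
  rw [abs_le]
  constructor <;> linarith

/-- Strong concavity on the ball, in midpoint form. -/
theorem midpoint_strongConcave (hM : 0 ≤ M) {lam : ℝ}
    (hlam : ∀ v, fderiv ℝ (fderiv ℝ f) c v v ≤ -(lam * ‖v‖ ^ 2)) {x y : E}
    (hx : x ∈ Metric.ball c R) (hy : y ∈ Metric.ball c R) :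
    f x + f y + (lam - R * M) / 4 * ‖x - y‖ ^ 2 ≤ 2 * f ((1 / 2 : ℝ) • (x + y)) := by
  -- On the ball the Hessian differs from the one at the centre by at most R M in norm.
  set ρ := lam - R * M with hρ
  have hhess : ∀ z ∈ Metric.ball c R, ∀ v, fderiv ℝ (fderiv ℝ f) z v v ≤ -(ρ * ‖v‖ ^ 2) := by
    intro z hz v
    have h1 := h.norm_hess_sub_le hz
    have h2 := (fderiv ℝ (fderiv ℝ f) z - fderiv ℝ (fderiv ℝ f) c).le_opNorm₂ v v
    simp only [sub_apply, Real.norm_eq_abs] at h2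
    have h3 : ‖z - c‖ ≤ R := by rw [← dist_eq_norm]; exact (Metric.mem_ball.1 hz).le
    have h4 : ‖fderiv ℝ (fderiv ℝ f) z - fderiv ℝ (fderiv ℝ f) c‖ * ‖v‖ * ‖v‖ ≤
        M * R * ‖v‖ * ‖v‖ := by
      gcongr
      exact h1.trans (mul_le_mul_of_nonneg_left h3 hM)
    have h5 := hlam v
    have h6 := (le_abs_self _).trans (h2.trans h4)
    rw [hρ]
    nlinarith
  set m := (1 / 2 : ℝ) • (x + y) with hm
  set k := (1 / 2 : ℝ) • (x - y) with hk
  have hmem : m ∈ Metric.ball c R := by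
    have := lineMap_mem hx hy (t := 1 / 2) ⟨by norm_num, by norm_num⟩
    convert this using 1
    rw [hm]; module
  have hmx : m + (1 : ℝ) • k = x := by rw [hm, hk]; module
  have hmy : m + (1 : ℝ) • (-k) = y := by rw [hm, hk]; module
  have hplus : ∀ t ∈ Set.Icc (0 : ℝ) 1, m + t • k ∈ Metric.ball c R := fun t ht => by
    have := lineMap_mem hmem hx ht
    convert this using 2
    rw [← hmx]; module
  have hminus : ∀ t ∈ Set.Icc (0 : ℝ) 1, m + t • (-k) ∈ Metric.ball c R := fun t ht => by
    have := lineMap_mem hmem hy ht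
    convert this using 2
    rw [← hmy]; module
  have hgrad : ∀ t ∈ Set.Icc (0 : ℝ) 1,
      2 * ρ * ‖k‖ ^ 2 * t ≤ fderiv ℝ f (m + t • (-k)) k - fderiv ℝ f (m + t • k) k := by
    intro t ht
    have e : ∀ s ∈ Set.Icc (0 : ℝ) 1, m + t • (-k) + s • ((2 * t) • k) ∈ Metric.ball c R := by
      intro s hs
      have := lineMap_mem (hminus t ht) (hplus t ht) hs
      convert this using 2
      module
    have h1 := le_sub_of_quadratic_le_deriv
      (φ := fun s : ℝ => -(fderiv ℝ f (m + t • (-k) + s • ((2 * t) • k)) k))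
      (a := 2 * t * (ρ * ‖k‖ ^ 2)) (b := 0) (c := 0)
      (fun s hs => (h.hasDerivAt_fderiv_comp_line (e s hs)).neg) fun s hs => by
        have h2 := hhess _ (e s hs) k
        have h4 : fderiv ℝ (fderiv ℝ f) (m + t • (-k) + s • ((2 * t) • k)) ((2 * t) • k) k =
            2 * t * fderiv ℝ (fderiv ℝ f) (m + t • (-k) + s • ((2 * t) • k)) k k := by
          rw [(fderiv ℝ (fderiv ℝ f) _).map_smul, smul_apply, smul_eq_mul]
        rw [h4]
        have h3 := mul_le_mul_of_nonneg_left h2 (by linarith [ht.1] : 0 ≤ 2 * t)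
        linarith
    have e1 : m + t • (-k) + (1 : ℝ) • ((2 * t) • k) = m + t • k := by module
    simp only [e1, zero_smul, add_zero, zero_div] at h1
    linarith
  -- The symmetric sum f(m + tk) + f(m - tk) decreases at rate at least 2ρ‖k‖² t, hence drops by
  -- ρ‖k‖² on [0, 1]. Here ‖k‖² = ‖x - y‖²/4.
  have hmain := le_sub_of_quadratic_le_deriv
    (φ := fun t : ℝ => -(f (m + t • k) + f (m + t • (-k))))
    (a := 0) (b := 2 * ρ * ‖k‖ ^ 2) (c := 0)
    (fun t ht => ((h.hasDerivAt_comp_line (hplus t ht)).add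
      (h.hasDerivAt_comp_line (hminus t ht))).neg) fun t ht => by
      have := hgrad t ht
      rw [map_neg]
      linarith
  simp only [hmx, hmy, zero_smul, add_zero, zero_div] at hmain
  have hkn : ‖k‖ ^ 2 = ‖x - y‖ ^ 2 / 4 := by
    rw [hk, norm_smul, mul_pow]; norm_num; ring
  rw [hkn] at hmain
  linarith

end ThirdDerivBound

end Calculus

/-! ### Hessian matrices and second Fréchet derivatives -/

section Hessian

variable {d : ℕ} {f : Param d → ℝ}

theorem quadForm_hessian (f : Param d → ℝ) (x v : Param d) :
    quadForm (hessian f x) v = fderiv ℝ (fderiv ℝ f) x v v := by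
  have hv : v = ∑ i, v i • EuclideanSpace.single i (1 : ℝ) := by
    ext j
    simp [Finset.sum_apply, Pi.single_apply]
  rw [quadForm_eq_dotProduct]
  conv_rhs => rw [hv]
  simp only [map_sum, map_smul, sum_apply, smul_apply, smul_eq_mul,
    dotProduct, Matrix.mulVec, hessian, Matrix.of_apply, iteratedFDeriv_two_apply, Finset.mul_sum]
  rw [Finset.sum_comm]
  refine Finset.sum_congr rfl fun i _ => Finset.sum_congr rfl fun j _ => ?_
  simp
  ring

theorem isHermitian_hessian {x : Param d} (hf : ContDiffAt ℝ 3 f x) :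
    (hessian f x).IsHermitian := by
  have hs : IsSymmSndFDerivAt ℝ f x := hf.isSymmSndFDerivAt (by simp; norm_num)
  ext i j
  simp only [hessian, Matrix.conjTranspose_apply, Matrix.of_apply, iteratedFDeriv_two_apply,
    star_trivial]
  simpa using hs _ _

end Hessian

/-! ### Laplace approximation on a ball -/

section Truncated

variable {d : ℕ}

theorem quadForm_neg_hessian (f : Param d → ℝ) (x v : Param d) :
    quadForm (-hessian f x) v = -fderiv ℝ (fderiv ℝ f) x v v := by
  have := quadForm_smul_matrix (hessian f x) (-1) v
  rw [neg_one_smul] at this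
  rw [this, quadForm_hessian]; ring

theorem midpointLogConcave_of_thirdDerivBound {f : Param d → ℝ} {c : Param d} {r M lam z : ℝ}
    (h : ThirdDerivBound f c r M) (hM : 0 ≤ M)
    (hlam : ∀ v, lam * ‖v‖ ^ 2 ≤ quadForm (-hessian f c) v) :
    MidpointLogConcave (Metric.ball c r) (lam - r * M)
      ((Metric.ball c r).indicator fun x => z * Real.exp (f x)) := by
  intro x hx y hy
  have hmid : (1 / 2 : ℝ) • (x + y) ∈ Metric.ball c r := by
    have := ThirdDerivBound.lineMap_mem hx hy (t := 1 / 2) ⟨by norm_num, by norm_num⟩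
    convert this using 1
    module
  rw [Set.indicator_of_mem hx, Set.indicator_of_mem hy, Set.indicator_of_mem hmid]
  have h1 := h.midpoint_strongConcave hM (lam := lam) (fun v => by
    have := hlam v
    rw [quadForm_neg_hessian] at this
    linarith) hx hy
  have e1 : z * Real.exp (f x) * (z * Real.exp (f y)) = z ^ 2 * Real.exp (f x + f y) := by
    rw [Real.exp_add]; ring
  have e2 : Real.exp (-((lam - r * M) / 4 * ‖x - y‖ ^ 2)) *
      (z * Real.exp (f ((1 / 2 : ℝ) • (x + y)))) ^ 2 =
      z ^ 2 * Real.exp (-((lam - r * M) / 4 * ‖x - y‖ ^ 2) +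
        2 * f ((1 / 2 : ℝ) • (x + y))) := by
    rw [Real.exp_add, two_mul, Real.exp_add]; ring
  rw [e1, e2]
  refine mul_le_mul_of_nonneg_left (Real.exp_le_exp.2 ?_) (sq_nonneg z)
  linarith

/-- On a ball on which `f` has small third derivative, the law with density proportional to
`exp f` is close to the Gaussian law with the same Hessian at the maximizer. -/
theorem abs_gaussian_sub_le_on_ball {f : Param d → ℝ} (hf : Measurable f) {c : Param d}
    {r M lam z k : ℝ} (h : ThirdDerivBound f c r M) (hr : 0 < r) (hM : 0 ≤ M)
    (h0 : fderiv ℝ f c = 0) (hlam : ∀ v, lam * ‖v‖ ^ 2 ≤ quadForm (-hessian f c) v)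
    (hρ : r * M < lam) (hz : 0 < z) (hk : 0 < k) {P Q : Measure (Param d)}
    [IsProbabilityMeasure P] [IsProbabilityMeasure Q]
    (hP : P = volume.withDensity fun x => ENNReal.ofReal
      ((Metric.ball c r).indicator (fun x => z * Real.exp (f x)) x))
    (hQ : Q = volume.withDensity fun x => ENNReal.ofReal
      ((Metric.ball c r).indicator
        (fun x => k * Real.exp (-(1 / 2) * quadForm (-hessian f c) (x - c))) x))
    {B : Set (Param d)} (hB : MeasurableSet B) :
    |Q.real B - P.real B| ≤ M / 4 * √((∫ x, ‖x - c‖ ^ 4 ∂Q) / (lam - r * M)) := by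
  set K := Metric.ball c r
  set A := -hessian f c
  set D := fderiv ℝ (fderiv ℝ f) c with hD
  have hcK : c ∈ K := Metric.mem_ball_self hr
  have hKm : MeasurableSet K := Metric.isOpen_ball.measurableSet
  set L := (‖D‖ + M * r) / 2 with hL
  have hL0 : 0 ≤ L := by positivity
  have hhess : ∀ x ∈ K, ‖fderiv ℝ (fderiv ℝ f) x‖ ≤ 2 * L := fun x hx => by
    have := h.norm_hess_le hM hx
    rw [hL]; linarith
  set p : Param d → ℝ := K.indicator fun x => z * Real.exp (f x) with hp_def
  have hpm : Measurable p := Measurable.indicator (by fun_prop) hKm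
  have hp0 : ∀ x, 0 ≤ p x := fun x => Set.indicator_nonneg (fun x _ => by positivity) x
  have hps : ∀ x ∉ K, p x = 0 := fun x hx => Set.indicator_of_notMem hx _
  -- Logarithm of the density of `Q` relative to `P`. The law `P` proportional to e^f supplies the
  -- strong log-concavity, and the Gaussian `Q` supplies explicit moments.
  set w : Param d → ℝ := fun x => -(1 / 2) * quadForm A (x - c) - f x + Real.log (k / z)
  have hw : Measurable w := by
    have h1 : Measurable fun x => quadForm A (x - c) := by fun_prop
    exact ((h1.const_mul _).sub hf).add_const _
  -- The gradient of `w` at x is minus the first-order Taylor remainder of ∇f at c, because ∇f(c) =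
  -- 0 and A = -f''(c).
  set γ : Param d → ℝ := fun x => M / 2 * ‖x - c‖ ^ 2
  have hγ : Measurable γ := by fun_prop
  have hpw : ∀ x, p x * Real.exp (w x) =
      K.indicator (fun x => k * Real.exp (-(1 / 2) * quadForm A (x - c))) x := by
    intro x
    by_cases hx : x ∈ K
    · rw [hp_def, Set.indicator_of_mem hx, Set.indicator_of_mem hx]
      simp only [w]
      rw [Real.exp_add, Real.exp_sub, Real.exp_log (by positivity)]
      have := Real.exp_pos (f x)
      field_simp
    · rw [hp_def, Set.indicator_of_notMem hx, Set.indicator_of_notMem hx, zero_mul]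
  have hQP : Q = P.withDensity fun x => ENNReal.ofReal (Real.exp (w x)) := by
    rw [hQ, hP, ← withDensity_mul _ hpm.ennreal_ofReal (by fun_prop)]
    congr 1
    ext x
    rw [Pi.mul_apply, ← ENNReal.ofReal_mul (hp0 x), hpw x]
  have hnorm : ∀ x ∈ K, ‖x - c‖ ≤ r := fun x hx => by
    rw [← dist_eq_norm]; exact (Metric.mem_ball.1 hx).le
  have hquad : ∀ v, quadForm A v = -D v v := quadForm_neg_hessian f c
  have hDvv : ∀ u v, |D u v| ≤ ‖D‖ * ‖u‖ * ‖v‖ := fun u v => D.le_opNorm₂ u v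
  have hsymm : ∀ u v, D u v = D v u := fun u v =>
    (h.contDiffAt c hcK).isSymmSndFDerivAt (by simp; norm_num) u v
  have hmain := (midpointLogConcave_of_thirdDerivBound (z := z) h hM hlam).abs_real_sub_le
    (by linarith) hKm hpm hp0 hps hP hw hγ hQP
    (B := ‖D‖ * r ^ 2 + |f c| + L * r ^ 2 + |Real.log (k / z)| + M / 2 * r ^ 2)
    (L := ‖D‖ / 2 + L) (by positivity)
    (fun x hx => by
      have h1 := h.abs_sub_sub_fderiv_le hhess hcK hx
      rw [h0] at h1
      simp only [zero_apply, sub_zero] at h1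
      have h2 := hDvv (x - c) (x - c)
      have h3 := hnorm x hx
      have h4 : ‖x - c‖ ^ 2 ≤ r ^ 2 := pow_le_pow_left₀ (norm_nonneg _) h3 2
      have h5 : L * ‖x - c‖ ^ 2 ≤ L * r ^ 2 := mul_le_mul_of_nonneg_left h4 hL0
      have h6 : ‖D‖ * ‖x - c‖ ^ 2 ≤ ‖D‖ * r ^ 2 := by gcongr
      have h7 : 0 ≤ M / 2 * r ^ 2 := by positivity
      have h8 := abs_le.1 h1
      have h9 := abs_le.1 h2
      have h10 := neg_abs_le (f c)
      have h11 := le_abs_self (f c)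
      have h12 := neg_abs_le (Real.log (k / z))
      have h13 := le_abs_self (Real.log (k / z))
      have h14 : 0 ≤ ‖D‖ * ‖x - c‖ ^ 2 := by positivity
      simp only [w, hquad]
      rw [abs_le]
      constructor <;> nlinarith)
    (fun x => by positivity)
    (fun x hx => by
      have h3 := hnorm x hx
      have h4 : M / 2 * ‖x - c‖ ^ 2 ≤ M / 2 * r ^ 2 := by gcongr
      have : 0 ≤ ‖D‖ * r ^ 2 + |f c| + L * r ^ 2 + |Real.log (k / z)| := by positivity
      simp only [γ]
      linarith)
    (fun x hx y hy => by
      have h1 := (abs_le.1 (h.abs_sub_sub_fderiv_le hhess hx hy)).2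
      have h2 := (abs_le.1 (h.abs_fderiv_sub_le hx (y - x))).2
      rw [h0] at h2
      simp only [zero_apply, sub_zero] at h2
      have h3 := (abs_le.1 (hDvv (y - x) (y - x))).1
      have e : D (y - c) (y - c) = D (x - c) (x - c) + 2 * D (x - c) (y - x) +
          D (y - x) (y - x) := by
        have : y - c = (x - c) + (y - x) := by abel
        have e2 : D (x - c + (y - x)) = D (x - c) + D (y - x) := D.map_add _ _
        rw [this, e2, add_apply, map_add, map_add, hsymm (y - x) (x - c)]
        ring
      simp only [w, γ, hquad, e]
      rw [norm_sub_rev x y]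
      nlinarith) hB
  refine hmain.trans (le_of_eq ?_)
  have e1 : ∫ x, γ x ^ 2 ∂Q = (M / 2) ^ 2 * ∫ x, ‖x - c‖ ^ 4 ∂Q := by
    rw [← integral_const_mul]
    congr 1; ext x; simp only [γ]; ring
  rw [e1, mul_div_assoc, Real.sqrt_mul (sq_nonneg _), Real.sqrt_sq (by positivity)]
  ring

/-- The global normalization `a` cancels under conditioning, so on the ball the exact update has
density e^f up to a constant. -/
theorem cond_smul_withDensity {E : Param d → ℝ≥0∞} {a : ℝ≥0∞} (ha0 : a ≠ 0)
    (ha : a ≠ ∞) {K : Set (Param d)} (hK : MeasurableSet K) {e : Param d → ℝ}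
    (hE : ∀ x ∈ K, E x = ENNReal.ofReal (e x))
    (h0 : ∫⁻ x in K, E x ≠ 0) (h1 : ∫⁻ x in K, E x ≠ ∞) :
    (a • volume.withDensity E)[|K] = volume.withDensity fun x => ENNReal.ofReal
      (K.indicator (fun x => (∫⁻ x in K, E x).toReal⁻¹ * e x) x) := by
  have hz : 0 < (∫⁻ x in K, E x).toReal := ENNReal.toReal_pos h0 h1
  ext B hB
  rw [cond_apply hK, Measure.smul_apply, Measure.smul_apply, smul_eq_mul, smul_eq_mul,
    withDensity_apply _ hK, withDensity_apply _ (hK.inter hB), withDensity_apply _ hB,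
    ENNReal.mul_inv (.inl ha0) (.inl ha), mul_mul_mul_comm, ENNReal.inv_mul_cancel ha0 ha, one_mul,
    ← lintegral_indicator hB, ← lintegral_indicator (hK.inter hB)]
  rw [← lintegral_const_mul' _ _ (ENNReal.inv_ne_top.2 h0)]
  refine lintegral_congr fun x => ?_
  by_cases hxB : x ∈ B
  · by_cases hxK : x ∈ K
    · rw [Set.indicator_of_mem (show x ∈ K ∩ B from ⟨hxK, hxB⟩), Set.indicator_of_mem hxB,
        Set.indicator_of_mem hxK, ENNReal.ofReal_mul (inv_nonneg.2 hz.le),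
        ENNReal.ofReal_inv_of_pos hz, ENNReal.ofReal_toReal h1, hE x hxK]
    · rw [Set.indicator_of_notMem (show x ∉ K ∩ B from fun h => hxK h.1), Set.indicator_of_mem hxB,
        Set.indicator_of_notMem hxK]
      simp
  · rw [Set.indicator_of_notMem (show x ∉ K ∩ B from fun h => hxB h.2), Set.indicator_of_notMem hxB]
    simp

theorem integral_cond_le {μ : Measure (Param d)} (K : Set (Param d))
    {g : Param d → ℝ} (hg : Integrable g μ) (hg0 : ∀ x, 0 ≤ g x) :
    ∫ x, g x ∂(μ[|K]) ≤ (∫ x, g x ∂μ) / μ.real K := by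
  rw [ProbabilityTheory.cond, integral_smul_measure, ENNReal.toReal_inv, smul_eq_mul, inv_mul_eq_div]
  exact div_le_div_of_nonneg_right (setIntegral_le_integral hg (.of_forall hg0))
    measureReal_nonneg

end Truncated

/-! ### The exact update -/

section ExactUpdate

variable {d₁ d₂ : ℕ} {B : Block d₁ d₂}

/-- Unnormalized density of the exact update. -/
noncomputable def Block.weight (B : Block d₁ d₂) (θ : Param d₁) : ℝ≥0∞ :=
  ENNReal.ofReal (Real.exp (B.logLik θ)) * ENNReal.ofReal (B.prior θ)

theorem Block.exp_logPostE (B : Block d₁ d₂) (θ : Param d₁) :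
    EReal.exp (B.logPostE θ) = B.weight θ := by
  rw [Block.logPostE, EReal.exp_add, EReal.exp_coe, ENNReal.exp_log, Block.weight]

theorem Block.exactUpdate_eq (B : Block d₁ d₂) :
    B.exactUpdate = (∫⁻ θ, B.weight θ)⁻¹ • volume.withDensity B.weight := by
  simp only [Block.exactUpdate, Block.exp_logPostE]

theorem Block.WellPosed.measurable_logLik (h : B.WellPosed) : Measurable B.logLik := by
  have h1 : Measurable fun p : Param d₁ × Param d₂ =>
      B.factor p.2 * Real.log (Function.uncurry B.lik p) :=
    (h.factor_density.measurable.comp measurable_snd).mul (Real.measurable_log.comp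
      h.lik_measurable)
  exact (h1.stronglyMeasurable.integral_prod_right' (ν := volume)).measurable

theorem Block.WellPosed.measurable_weight (h : B.WellPosed) : Measurable B.weight := by
  have h1 := h.measurable_logLik
  have h2 := h.prior_density.measurable
  unfold Block.weight
  fun_prop

theorem Block.WellPosed.measurable_logPost (h : B.WellPosed) : Measurable B.logPost :=
  h.measurable_logLik.add (Real.measurable_log.comp h.prior_density.measurable)

theorem Block.weight_of_prior_pos {θ : Param d₁} (h : 0 < B.prior θ) :
    B.weight θ = ENNReal.ofReal (Real.exp (B.logPost θ)) := by
  rw [Block.weight, ← ENNReal.ofReal_mul (Real.exp_pos _).le, Block.logPost, Block.logPrior,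
    Real.exp_add, Real.exp_log h]

/-- The prior has total mass 1, so an upper bound on ℓ is enough even on unbounded sets. -/
theorem Block.WellPosed.setLIntegral_weight_le (h : B.WellPosed) {C : ℝ} {s : Set (Param d₁)}
    (hs : MeasurableSet s) (hC : ∀ θ ∈ s, B.logLik θ ≤ C) :
    ∫⁻ θ in s, B.weight θ ≤ ENNReal.ofReal (Real.exp C) := by
  calc ∫⁻ θ in s, B.weight θ
      ≤ ∫⁻ θ in s, ENNReal.ofReal (Real.exp C) * ENNReal.ofReal (B.prior θ) :=
        setLIntegral_mono' hs fun θ hθ =>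
          mul_le_mul' (ENNReal.ofReal_le_ofReal (Real.exp_le_exp.2 (hC θ hθ))) le_rfl
    _ ≤ ∫⁻ θ, ENNReal.ofReal (Real.exp C) * ENNReal.ofReal (B.prior θ) :=
        setLIntegral_le_lintegral _ _
    _ = ENNReal.ofReal (Real.exp C) := by
        rw [lintegral_const_mul _ h.prior_density.measurable.ennreal_ofReal,
          h.prior_density.lintegral_eq_one, mul_one]

theorem IsUniqueMax.le {X Y : Type*} [Preorder Y] {f : X → Y} {x : X} (h : IsUniqueMax f x)
    (y : X) : f y ≤ f x := by
  by_cases hy : y = x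
  · rw [hy]
  · exact (h y hy).le

theorem Block.WellPosed.lintegral_weight_ne_top (h : B.WellPosed) {θbar : Param d₁}
    (hmax : IsUniqueMax B.logLik θbar) : ∫⁻ θ, B.weight θ ≠ ∞ := by
  have := h.setLIntegral_weight_le MeasurableSet.univ (C := B.logLik θbar) fun θ _ => hmax.le θ
  rw [Measure.restrict_univ] at this
  exact ne_top_of_le_ne_top ENNReal.ofReal_ne_top this

theorem Block.isProbabilityMeasure_exactUpdate (h0 : ∫⁻ θ, B.weight θ ≠ 0)
    (h1 : ∫⁻ θ, B.weight θ ≠ ∞) : IsProbabilityMeasure B.exactUpdate := by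
  refine ⟨?_⟩
  rw [Block.exactUpdate_eq, Measure.smul_apply, withDensity_apply _ MeasurableSet.univ,
    Measure.restrict_univ, smul_eq_mul, ENNReal.inv_mul_cancel h0 h1]

theorem Block.exactUpdate_real_le {s : Set (Param d₁)} (hs : MeasurableSet s) {N D : ℝ}
    (hN : 0 ≤ N) (hD : 0 < D) (h1 : ∫⁻ θ in s, B.weight θ ≤ ENNReal.ofReal N)
    (h2 : ENNReal.ofReal D ≤ ∫⁻ θ, B.weight θ) : B.exactUpdate.real s ≤ N / D := by
  refine ENNReal.toReal_le_of_le_ofReal (div_nonneg hN hD.le) ?_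
  rw [Block.exactUpdate_eq, Measure.smul_apply, withDensity_apply _ hs, smul_eq_mul,
    ENNReal.ofReal_div_of_pos hD, mul_comm, ← div_eq_mul_inv]
  exact ENNReal.div_le_div h1 h2

end ExactUpdate

/-! ### Rescaled matrices -/

section Rescaled

variable {d : ℕ} {A : Matrix (Fin d) (Fin d) ℝ}

theorem inv_smul_matrix {k : ℝ} (hk : k ≠ 0) (hA : IsUnit A.det) :
    (k • A)⁻¹ = k⁻¹ • A⁻¹ := by
  refine Matrix.inv_eq_right_inv ?_
  rw [smul_mul_smul_comm, mul_inv_cancel₀ hk, Matrix.mul_nonsing_inv _ hA, one_smul]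

theorem isUnit_det_of_posDef (hA : A.PosDef) : IsUnit A.det :=
  (Matrix.isUnit_iff_isUnit_det _).1 hA.isUnit

theorem opNorm_smul {k : ℝ} (hk : 0 ≤ k) (A : Matrix (Fin d) (Fin d) ℝ) :
    opNorm (k • A) = k * opNorm A := by
  rw [opNorm, map_smul, norm_smul, Real.norm_of_nonneg hk, opNorm]

theorem sqrt_trace_inv_smul {n : ℕ} (hn : 1 ≤ n) (hA : A.PosDef) :
    √((n : ℝ) • A)⁻¹.trace = √A⁻¹.trace / √(n : ℝ) := by
  have hn' : (0 : ℝ) < n := by exact_mod_cast hn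
  rw [inv_smul_matrix hn'.ne' (isUnit_det_of_posDef hA), Matrix.trace_smul, smul_eq_mul,
    Real.sqrt_mul (inv_nonneg.2 hn'.le), Real.sqrt_inv, inv_mul_eq_div]

/-- Passing from A to nA divides the trace and the norm of the inverse by n. The exponent is
therefore the Gaussian concentration exponent for precision nA at the unscaled radius δ. -/
theorem tailExponent_eq {n : ℕ} (hn : 1 ≤ n) (hA : A.PosDef) (δ : ℝ) :
    tailExponent n δ A = -(1 / 2) * (δ - √((n : ℝ) • A)⁻¹.trace) ^ 2 *
      (opNorm ((n : ℝ) • A)⁻¹)⁻¹ := by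
  have hn' : (0 : ℝ) < n := by exact_mod_cast hn
  rw [sqrt_trace_inv_smul hn hA, inv_smul_matrix hn'.ne' (isUnit_det_of_posDef hA),
    opNorm_smul (inv_nonneg.2 hn'.le), tailExponent, mul_inv, inv_inv]
  have hs : 0 < √(n : ℝ) := Real.sqrt_pos.2 hn'
  have e : δ * √(n : ℝ) - √A⁻¹.trace = √(n : ℝ) * (δ - √A⁻¹.trace / √(n : ℝ)) := by
    field_simp
  rw [e, mul_pow, Real.sq_sqrt hn'.le]
  ring

theorem tailExponent_neg {n : ℕ} (hn : 1 ≤ n) (hd : 1 ≤ d) (hA : A.PosDef) {δ : ℝ}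
    (h : √((n : ℝ) • A)⁻¹.trace < δ) : tailExponent n δ A < 0 := by
  rw [tailExponent_eq hn hA]
  have hn' : (0 : ℝ) < n := by exact_mod_cast hn
  have h1 := opNorm_inv_pos hd (hA.smul hn')
  have h2 : 0 < (δ - √((n : ℝ) • A)⁻¹.trace) ^ 2 := pow_pos (by linarith) 2
  have h3 : 0 < (δ - √((n : ℝ) • A)⁻¹.trace) ^ 2 * (opNorm ((n : ℝ) • A)⁻¹)⁻¹ := by positivity
  linarith

/-- Gaussian mass outside a ball, on the scale of the sample size. -/
theorem multivariateGaussian_compl_ball_le {n : ℕ} (hn : 1 ≤ n) (hd : 1 ≤ d) (hA : A.PosDef)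
    (m : Param d) {δ : ℝ} (h : √((n : ℝ) • A)⁻¹.trace < δ) :
    (multivariateGaussian m ((n : ℝ) • A)⁻¹).real (Metric.ball m δ)ᶜ ≤
      Real.exp (tailExponent n δ A) := by
  have hn' : (0 : ℝ) < n := by exact_mod_cast hn
  have h1 := multivariateGaussian_norm_ge_le hd (hA.smul hn') m h
  rw [← tailExponent_eq hn hA] at h1
  have e : (Metric.ball m δ)ᶜ = {x | δ ≤ ‖x - m‖} := by
    ext x; simp [dist_eq_norm]
  rwa [e]

end Rescaled

/-! ### Lower bound for the normalizing constant -/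

section Normalizer

variable {d₁ d₂ : ℕ} {B : Block d₁ d₂} {n : ℕ} {θbar θhat : Param d₁} {c : Consts}

theorem LikelihoodRegular.thirdDerivBound (hn : 1 ≤ n) (h : LikelihoodRegular n B θbar c) :
    ThirdDerivBound B.logLik θbar c.δbar (n * c.Mbar₁) := by
  have hn' : (0 : ℝ) < n := by exact_mod_cast hn
  refine ThirdDerivBound.of_contDiffOn h.contDiffOn fun x hx => ?_
  have := h.third_le x hx
  rw [div_le_iff₀ hn'] at this
  rw [mul_comm]
  exact this

theorem LikelihoodRegular.fderiv_eq_zero (h : LikelihoodRegular n B θbar c) :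
    fderiv ℝ B.logLik θbar = 0 :=
  (isMaxOn_univ_iff.2 h.unique_max.le).isLocalMax univ_mem |>.fderiv_eq_zero

theorem smul_Hl (hn : 1 ≤ n) : (n : ℝ) • Hl n B θbar = -hessian B.logLik θbar := by
  have hn' : (n : ℝ) ≠ 0 := by positivity
  rw [Hl, smul_neg, smul_inv_smul₀ hn']

theorem smul_Hf (hn : 1 ≤ n) : (n : ℝ) • Hf n B θhat = -hessian B.logPost θhat := by
  have hn' : (n : ℝ) ≠ 0 := by positivity
  rw [Hf, smul_neg, smul_inv_smul₀ hn']

theorem posDef_of_smul {d n : ℕ} (hn : 1 ≤ n) {A : Matrix (Fin d) (Fin d) ℝ}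
    (h : ((n : ℝ) • A).PosDef) : A.PosDef := by
  have hn' : (0 : ℝ) < n := by exact_mod_cast hn
  have := h.smul (inv_pos.2 hn')
  rwa [inv_smul_smul₀ hn'.ne'] at this

/-- Second-order necessary condition: compare the Taylor lower bound at c + tv with the maximum,
divide by t² and let t decrease to 0. -/
theorem fderiv_fderiv_nonpos_of_isMax {E : Type*} [NormedAddCommGroup E] [NormedSpace ℝ E]
    {f : E → ℝ} {c : E} {R M : ℝ} (h : ThirdDerivBound f c R M) (hR : 0 < R)
    (hmax : ∀ x, f x ≤ f c) (h0 : fderiv ℝ f c = 0) (v : E) :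
    fderiv ℝ (fderiv ℝ f) c v v ≤ 0 := by
  have hlim : Tendsto (fun t : ℝ => fderiv ℝ (fderiv ℝ f) c v v - t * (M / 3 * ‖v‖ ^ 3))
      (𝓝[>] 0) (𝓝 (fderiv ℝ (fderiv ℝ f) c v v)) := by
    have : Continuous fun t : ℝ => fderiv ℝ (fderiv ℝ f) c v v - t * (M / 3 * ‖v‖ ^ 3) := by
      fun_prop
    have h1 := this.tendsto 0
    simp only [zero_mul, sub_zero] at h1
    exact h1.mono_left nhdsWithin_le_nhds
  have hmem : ∀ᶠ t : ℝ in 𝓝[>] 0, c + t • v ∈ Metric.ball c R := by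
    have : Continuous fun t : ℝ => c + t • v := by fun_prop
    have h1 := this.tendsto 0
    simp only [zero_smul, add_zero] at h1
    exact (h1.mono_left nhdsWithin_le_nhds).eventually (Metric.ball_mem_nhds c hR)
  refine le_of_tendsto hlim ?_
  filter_upwards [hmem, self_mem_nhdsWithin] with t ht ht0
  have ht0' : (0 : ℝ) < t := ht0
  have h1 := h.taylor_lower ht
  have h2 := hmax (c + t • v)
  rw [add_sub_cancel_left, h0, norm_smul, Real.norm_of_nonneg ht0'.le] at h1
  have e : fderiv ℝ (fderiv ℝ f) c (t • v) (t • v) = t ^ 2 * fderiv ℝ (fderiv ℝ f) c v v := by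
    rw [(fderiv ℝ (fderiv ℝ f) c).map_smul, smul_apply, map_smul, smul_eq_mul, smul_eq_mul]; ring
  rw [e] at h1
  simp only [zero_apply, add_zero] at h1
  have h3 : t ^ 2 * (fderiv ℝ (fderiv ℝ f) c v v - t * (M / 3 * ‖v‖ ^ 3)) ≤ 0 := by
    nlinarith
  by_contra hcon
  push Not at hcon
  exact absurd h3 (not_le.2 (mul_pos (by positivity) hcon))

theorem LikelihoodRegular.posDef (hn : 1 ≤ n) (h : LikelihoodRegular n B θbar c)
    (hu : IsUnit (hessian B.logLik θbar)) : (-hessian B.logLik θbar).PosDef := by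
  have hT := h.thirdDerivBound hn
  have hherm : (-hessian B.logLik θbar).IsHermitian :=
    (isHermitian_hessian (hT.contDiffAt _ (Metric.mem_ball_self h.δbar_pos))).neg
  have hpsd : (-hessian B.logLik θbar).PosSemidef := by
    refine Matrix.PosSemidef.of_dotProduct_mulVec_nonneg hherm fun x => ?_
    have h1 := quadForm_neg_hessian B.logLik θbar (WithLp.toLp 2 x)
    have h2 := fderiv_fderiv_nonpos_of_isMax hT h.δbar_pos h.unique_max.le h.fderiv_eq_zero
      (WithLp.toLp 2 x)
    rw [quadForm_eq_dotProduct] at h1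
    simp only [star_trivial]
    linarith
  exact hpsd.posDef_iff_isUnit.2 hu.neg

theorem Hl_posDef (hn : 1 ≤ n) (h : LikelihoodRegular n B θbar c)
    (hu : IsUnit (hessian B.logLik θbar)) : (Hl n B θbar).PosDef :=
  posDef_of_smul hn (by rw [smul_Hl hn]; exact h.posDef hn hu)

theorem Jmat_posDef (hn : 1 ≤ n) (h : LikelihoodRegular n B θbar c)
    (hu : IsUnit (hessian B.logLik θbar)) : (Jmat n B θbar c).PosDef := by
  have h1 := h.δbar_pos
  have h2 := h.Mbar₁_pos
  exact posDef_add_smul_one (Hl_posDef hn h hu) (by positivity)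

theorem sqrt_trace_inv_Jmat_lt (hn : 1 ≤ n) (h : LikelihoodRegular n B θbar c)
    (hu : IsUnit (hessian B.logLik θbar)) (hlt : √(-(hessian B.logLik θbar)⁻¹).trace < c.δbar) :
    √((n : ℝ) • Jmat n B θbar c)⁻¹.trace < c.δbar := by
  have h1 := h.δbar_pos
  have h2 := h.Mbar₁_pos
  have hH := Hl_posDef hn h hu
  refine lt_of_le_of_lt ?_ hlt
  have e : -(hessian B.logLik θbar)⁻¹ = ((n : ℝ) • Hl n B θbar)⁻¹ := by
    rw [smul_Hl hn]
    have := inv_smul_matrix (k := -1) (by norm_num) ((Matrix.isUnit_iff_isUnit_det _).1 hu)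
    rw [neg_one_smul] at this
    rw [this, inv_neg, inv_one, neg_one_smul]
  rw [e, sqrt_trace_inv_smul hn hH, sqrt_trace_inv_smul hn (Jmat_posDef hn h hu)]
  gcongr
  exact trace_inv_add_smul_one_le hH (by positivity)

theorem TbarJ_neg (hd : 1 ≤ d₁) (hn : 1 ≤ n) (h : LikelihoodRegular n B θbar c)
    (hu : IsUnit (hessian B.logLik θbar)) (hlt : √(-(hessian B.logLik θbar)⁻¹).trace < c.δbar) :
    TbarJ n B θbar c < 0 :=
  tailExponent_neg hn hd (Jmat_posDef hn h hu) (sqrt_trace_inv_Jmat_lt hn h hu hlt)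

theorem quadForm_smul_Jmat (hn : 1 ≤ n) (v : Param d₁) :
    quadForm ((n : ℝ) • Jmat n B θbar c) v = -fderiv ℝ (fderiv ℝ B.logLik) θbar v v +
      n * c.Mbar₁ * c.δbar / 3 * ‖v‖ ^ 2 := by
  rw [Jmat, smul_add, smul_Hl hn, smul_smul, quadForm_add_smul_one, quadForm_neg_hessian]
  ring

/-- On the ball of radius δ̄ the cubic Taylor term n M̄₁‖x‖³/6 is at most half of (n M̄₁ δ̄/3)‖x‖².
So ℓ lies above ℓ(θ̄) minus half the quadratic form of n J, while π ≥ 1/M̄₂. The Gaussian law with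
precision n J gives the ball mass at least 1 - exp(T̄_J). -/
theorem le_lintegral_weight (hd : 1 ≤ d₁) (hn : 1 ≤ n) (h : LikelihoodRegular n B θbar c)
    (hp : PriorBoundedBelow B θbar c) (hu : IsUnit (hessian B.logLik θbar))
    (hlt : √(-(hessian B.logLik θbar)⁻¹).trace < c.δbar) :
    ENNReal.ofReal (Real.exp (B.logLik θbar) * c.Mbar₂⁻¹ *
      (gaussConst ((n : ℝ) • Jmat n B θbar c))⁻¹ * (1 - Real.exp (TbarJ n B θbar c))) ≤
      ∫⁻ θ, B.weight θ := by
  set J := (n : ℝ) • Jmat n B θbar c with hJ_def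
  have hn' : (0 : ℝ) < n := by exact_mod_cast hn
  have hJ0 := Jmat_posDef hn h hu
  have hJ : J.PosDef := hJ0.smul hn'
  have hT := h.thirdDerivBound hn
  have hM2 := hp.Mbar₂_pos
  have hc := gaussConst_pos hJ
  set K := Metric.ball θbar c.δbar
  have hK : MeasurableSet K := Metric.isOpen_ball.measurableSet
  set a := Real.exp (B.logLik θbar) * c.Mbar₂⁻¹ * (gaussConst J)⁻¹ with ha_def
  have ha : 0 < a := by positivity
  have hγ : 1 - Real.exp (TbarJ n B θbar c) ≤ (multivariateGaussian θbar J⁻¹).real K := by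
    have h1 := multivariateGaussian_compl_ball_le hn hd hJ0 θbar
      (sqrt_trace_inv_Jmat_lt hn h hu hlt)
    rw [← hJ_def, probReal_compl_eq_one_sub hK] at h1
    have : TbarJ n B θbar c = tailExponent n c.δbar (Jmat n B θbar c) := rfl
    rw [this]
    linarith
  calc ENNReal.ofReal (a * (1 - Real.exp (TbarJ n B θbar c)))
      ≤ ENNReal.ofReal (a * (multivariateGaussian θbar J⁻¹).real K) :=
        ENNReal.ofReal_le_ofReal (mul_le_mul_of_nonneg_left hγ ha.le)
    _ = ENNReal.ofReal a * multivariateGaussian θbar J⁻¹ K := by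
        rw [ENNReal.ofReal_mul ha.le, ofReal_measureReal]
    _ = ∫⁻ θ in K, ENNReal.ofReal a * ENNReal.ofReal
          (gaussConst J * Real.exp (-(1 / 2) * quadForm J (θ - θbar))) := by
        rw [multivariateGaussian_eq_withDensity hJ, withDensity_apply _ hK,
          lintegral_const_mul _ (by fun_prop)]
    _ ≤ ∫⁻ θ in K, B.weight θ := by
        refine setLIntegral_mono' hK fun θ hθ => ?_
        have hθ' := Metric.ball_subset_closedBall hθ
        have hpos := hp.prior_pos θ hθ'
        have hinv := hp.inv_le θ hθ'
        rw [abs_of_pos (by positivity), one_div] at hinv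
        have hprior : c.Mbar₂⁻¹ ≤ B.prior θ := inv_le_of_inv_le₀ hpos hinv
        rw [← ENNReal.ofReal_mul ha.le, Block.weight, ← ENNReal.ofReal_mul (Real.exp_pos _).le]
        refine ENNReal.ofReal_le_ofReal ?_
        have e : a * (gaussConst J * Real.exp (-(1 / 2) * quadForm J (θ - θbar))) =
            Real.exp (B.logLik θbar + -(1 / 2) * quadForm J (θ - θbar)) * c.Mbar₂⁻¹ := by
          rw [Real.exp_add, ha_def]; field_simp
        rw [e]
        refine mul_le_mul (Real.exp_le_exp.2 ?_) hprior (by positivity) (Real.exp_pos _).le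
        have h1 := hT.taylor_lower hθ
        rw [h.fderiv_eq_zero] at h1
        simp only [zero_apply, add_zero] at h1
        have hr : ‖θ - θbar‖ ≤ c.δbar := by
          rw [← dist_eq_norm]; exact (Metric.mem_ball.1 hθ).le
        have h2 : n * c.Mbar₁ / 6 * ‖θ - θbar‖ ^ 3 ≤
            n * c.Mbar₁ / 6 * (c.δbar * ‖θ - θbar‖ ^ 2) := by
          have := h.Mbar₁_pos
          have e3 : ‖θ - θbar‖ ^ 3 = ‖θ - θbar‖ * ‖θ - θbar‖ ^ 2 := by ring
          rw [e3]
          gcongr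
        rw [hJ_def, quadForm_smul_Jmat hn]
        linarith
    _ ≤ ∫⁻ θ, B.weight θ := setLIntegral_le_lintegral _ _

end Normalizer

/-! ### The nonasymptotic bound -/

section Nonasymptotic

variable {d₁ d₂ : ℕ} {B : Block d₁ d₂} {n : ℕ} {θbar θhat : Param d₁} {c : Consts}

theorem PosteriorRegular.thirdDerivBound (hn : 1 ≤ n) (h : PosteriorRegular n B θhat c) :
    ThirdDerivBound B.logPost θhat c.δhat (n * c.Mhat₁) := by
  have hn' : (0 : ℝ) < n := by exact_mod_cast hn
  refine ThirdDerivBound.of_contDiffOn h.contDiffOn_logPost fun x hx => ?_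
  have := h.third_le x hx
  rw [div_le_iff₀ hn'] at this
  rw [mul_comm]
  exact this

/-- Maximality is assumed for the extended-real log-posterior. The real version agrees with it only
where π > 0, so the comparison is made on the ball. -/
theorem PosteriorRegular.logPost_le (h : PosteriorRegular n B θhat c) {θ : Param d₁}
    (hθ : θ ∈ Metric.closedBall θhat c.δhat) : B.logPost θ ≤ B.logPost θhat := by
  have h1 : B.weight θ ≤ B.weight θhat := by
    rw [← Block.exp_logPostE, ← Block.exp_logPostE]
    exact EReal.exp_monotone (h.unique_max.le θ)
  rw [Block.weight_of_prior_pos (h.prior_pos θ hθ), Block.weight_of_prior_pos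
    (h.prior_pos θhat (Metric.mem_closedBall_self h.δhat_pos.le)),
    ENNReal.ofReal_le_ofReal_iff (Real.exp_pos _).le, Real.exp_le_exp] at h1
  exact h1

theorem PosteriorRegular.fderiv_eq_zero (h : PosteriorRegular n B θhat c) :
    fderiv ℝ B.logPost θhat = 0 := by
  refine IsLocalMax.fderiv_eq_zero ?_
  filter_upwards [Metric.closedBall_mem_nhds θhat h.δhat_pos] with θ hθ using h.logPost_le hθ

theorem PosteriorRegular.lambdaMin_pos (h : PosteriorRegular n B θhat c) :
    0 < lambdaMin (Hf n B θhat) :=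
  (mul_pos h.δhat_pos h.Mhat₁_pos).trans h.lt_lambdaMin

theorem PosteriorRegular.Hf_posDef (hn : 1 ≤ n) (h : PosteriorRegular n B θhat c) :
    (Hf n B θhat).PosDef := by
  refine posDef_of_lambdaMin_pos ?_ h.lambdaMin_pos
  have h1 := isHermitian_hessian ((h.thirdDerivBound hn).contDiffAt _
    (Metric.mem_ball_self h.δhat_pos))
  have h2 : (((n : ℝ)⁻¹) • hessian B.logPost θhat).IsHermitian := h1.smul (by simp)
  exact h2.neg

theorem PosteriorRegular.sqrt_trace_lt (hn : 1 ≤ n) (h : PosteriorRegular n B θhat c)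
    (ht : √(-(hessian B.logPost θhat)⁻¹).trace < c.δhat) :
    √((n : ℝ) • Hf n B θhat)⁻¹.trace < c.δhat := by
  have hn' : (0 : ℝ) < n := by exact_mod_cast hn
  have hA : (-hessian B.logPost θhat).PosDef := by
    rw [← smul_Hf hn]; exact (h.Hf_posDef hn).smul hn'
  have := inv_smul_matrix (k := -1) (by norm_num) (isUnit_det_of_posDef hA)
  rw [neg_one_smul, neg_neg, inv_neg, inv_one, neg_one_smul] at this
  rwa [this, neg_neg, ← smul_Hf hn] at ht

theorem setLIntegral_weight_pos {K : Set (Param d₁)} (hw : B.WellPosed) (hK : IsOpen K)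
    (hne : K.Nonempty) (hpos : ∀ θ ∈ K, 0 < B.prior θ) : ∫⁻ θ in K, B.weight θ ≠ 0 := by
  rw [← pos_iff_ne_zero, setLIntegral_pos_iff hw.measurable_weight]
  refine (hK.measure_pos volume hne).trans_le (measure_mono fun θ hθ => ⟨?_, hθ⟩)
  rw [Function.mem_support, Block.weight_of_prior_pos (hpos θ hθ)]
  simpa using Real.exp_pos _

theorem rpow_neg_half (n : ℕ) : (n : ℝ) ^ (-(1 / 2) : ℝ) = (√(n : ℝ))⁻¹ := by
  rw [Real.rpow_neg (Nat.cast_nonneg n), Real.sqrt_eq_rpow]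

/-- Error of the Laplace update in terms of a ball around the maximizer: the error on the ball, the
Gaussian mass outside, and the mass of the exact update outside. -/
theorem laplaceError_le_of_ball (hd : 1 ≤ d₁) (hn : 1 ≤ n) (hw : B.WellPosed) {r M lam : ℝ}
    (hT : ThirdDerivBound B.logPost θhat r (n * M)) (hM : 0 ≤ M) (hr : 0 < r)
    (hpos : ∀ θ ∈ Metric.ball θhat r, 0 < B.prior θ) (h0 : fderiv ℝ B.logPost θhat = 0)
    (hH : (Hf n B θhat).PosDef) (hlam : ∀ v, lam * ‖v‖ ^ 2 ≤ quadForm (Hf n B θhat) v)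
    (hρ : r * M < lam) (htr : √((n : ℝ) • Hf n B θhat)⁻¹.trace < r)
    (htop : ∫⁻ θ, B.weight θ ≠ ∞) :
    laplaceError n B θhat ≤ √3 * (Hf n B θhat)⁻¹.trace * M /
      (4 * √((lam - r * M) * (1 - Real.exp (tailExponent n r (Hf n B θhat))))) *
        (n : ℝ) ^ (-(1 / 2) : ℝ) +
      Real.exp (tailExponent n r (Hf n B θhat)) +
      B.exactUpdate.real (Metric.ball θhat r)ᶜ := by
  have hn' : (0 : ℝ) < n := by exact_mod_cast hn
  set H := Hf n B θhat
  set A := (n : ℝ) • H with hA_def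
  have hAhess : A = -hessian B.logPost θhat := smul_Hf hn
  have hA : A.PosDef := hH.smul hn'
  set T := tailExponent n r H
  have hTneg : T < 0 := tailExponent_neg hn hd hH htr
  have hexpT : Real.exp T < 1 := Real.exp_lt_one_iff.2 hTneg
  set K := Metric.ball θhat r
  have hKm : MeasurableSet K := Metric.isOpen_ball.measurableSet
  set γ := multivariateGaussian θhat A⁻¹ with hγ_def
  have hγK : γ.real Kᶜ ≤ Real.exp T := multivariateGaussian_compl_ball_le hn hd hH θhat htr
  have hγKr : 1 - Real.exp T ≤ γ.real K := by
    rw [probReal_compl_eq_one_sub hKm] at hγK; linarith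
  have hγK0 : γ K ≠ 0 := fun h => by
    rw [Measure.real, h, ENNReal.toReal_zero] at hγKr; linarith
  have hzK0 := setLIntegral_weight_pos hw Metric.isOpen_ball ⟨θhat, Metric.mem_ball_self hr⟩ hpos
  have hz0 : ∫⁻ θ, B.weight θ ≠ 0 := fun h => hzK0 (le_antisymm
    ((setLIntegral_le_lintegral _ _).trans h.le) bot_le)
  have hzKtop : ∫⁻ θ in K, B.weight θ ≠ ∞ :=
    ne_top_of_le_ne_top htop (setLIntegral_le_lintegral _ _)
  have hprob := Block.isProbabilityMeasure_exactUpdate hz0 htop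
  set ν := B.exactUpdate with hν_def
  have hνK0 : ν K ≠ 0 := by
    rw [hν_def, Block.exactUpdate_eq, Measure.smul_apply, withDensity_apply _ hKm, smul_eq_mul]
    exact mul_ne_zero (ENNReal.inv_ne_zero.2 htop) hzK0
  have hPprob : IsProbabilityMeasure (ν[|K]) := cond_isProbabilityMeasure hνK0
  have hQprob : IsProbabilityMeasure (γ[|K]) := cond_isProbabilityMeasure hγK0
  have hP : ν[|K] = volume.withDensity fun x => ENNReal.ofReal
      (K.indicator (fun x => (∫⁻ x in K, B.weight x).toReal⁻¹ * Real.exp (B.logPost x)) x) := by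
    rw [hν_def, Block.exactUpdate_eq]
    exact cond_smul_withDensity (ENNReal.inv_ne_zero.2 htop) (ENNReal.inv_ne_top.2 hz0) hKm
      (fun x hx => Block.weight_of_prior_pos (hpos x hx)) hzK0 hzKtop
  have hγd : γ = volume.withDensity fun x =>
      ENNReal.ofReal (gaussConst A * Real.exp (-(1 / 2) * quadForm A (x - θhat))) :=
    multivariateGaussian_eq_withDensity hA θhat
  set g := ∫⁻ x in K, ENNReal.ofReal
    (gaussConst A * Real.exp (-(1 / 2) * quadForm A (x - θhat))) with hg_def
  have hg : g = γ K := by rw [hγd, withDensity_apply _ hKm]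
  have hg0 : g ≠ 0 := hg ▸ hγK0
  have hgt : g ≠ ∞ := hg ▸ measure_ne_top _ _
  have hQ : γ[|K] = volume.withDensity fun x => ENNReal.ofReal (K.indicator
      (fun x => g.toReal⁻¹ * gaussConst A *
        Real.exp (-(1 / 2) * quadForm (-hessian B.logPost θhat) (x - θhat))) x) := by
    have h1 := cond_smul_withDensity (a := 1) one_ne_zero ENNReal.one_ne_top hKm
      (E := fun x => ENNReal.ofReal
        (gaussConst A * Real.exp (-(1 / 2) * quadForm A (x - θhat))))
      (e := fun x => gaussConst A * Real.exp (-(1 / 2) * quadForm A (x - θhat)))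
      (fun x _ => rfl) hg0 hgt
    rw [one_smul, ← hγd] at h1
    rw [h1, ← hAhess]
    simp only [mul_assoc]
    rfl
  have hmom := integral_norm_pow_four_multivariateGaussian_le hA.inv θhat
  -- Conditioning on the ball costs at most the factor 1/γ(K), which is where 1 - e^T in the
  -- denominator of `C₁` comes from.
  have hI : ∫ x, ‖x - θhat‖ ^ 4 ∂(γ[|K]) ≤ 3 * A⁻¹.trace ^ 2 / (1 - Real.exp T) := by
    refine (integral_cond_le K hmom.1 fun x => by positivity).trans ?_
    exact div_le_div₀ (by positivity) hmom.2 (by linarith) hγKr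
  have htrA : A⁻¹.trace = H⁻¹.trace / n := by
    rw [hA_def, inv_smul_matrix hn'.ne' (isUnit_det_of_posDef hH), Matrix.trace_smul, smul_eq_mul,
      inv_mul_eq_div]
  have htrH : 0 ≤ H⁻¹.trace := (trace_inv_pos hd hH).le
  have hlamA : ∀ v, n * lam * ‖v‖ ^ 2 ≤ quadForm (-hessian B.logPost θhat) v := fun v => by
    rw [← hAhess, hA_def, quadForm_smul_matrix, mul_assoc]
    exact mul_le_mul_of_nonneg_left (hlam v) hn'.le
  have hgap : 0 < lam - r * M := by linarith
  have hgap2 : 0 < 1 - Real.exp T := by linarith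
  have hball : ∀ S, MeasurableSet S → |(γ[|K]).real S - (ν[|K]).real S| ≤
      √3 * H⁻¹.trace * M / (4 * √((lam - r * M) * (1 - Real.exp T))) *
        (n : ℝ) ^ (-(1 / 2) : ℝ) := by
    intro S hS
    have h1 := abs_gaussian_sub_le_on_ball hw.measurable_logPost hT hr (by positivity) h0 hlamA
      (by nlinarith) (inv_pos.2 (ENNReal.toReal_pos hzK0 hzKtop))
      (mul_pos (inv_pos.2 (ENNReal.toReal_pos hg0 hgt)) (gaussConst_pos hA)) hP hQ hS
    refine h1.trans ?_
    have e1 : n * lam - r * (n * M) = n * (lam - r * M) := by ring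
    have h2 : √((∫ x, ‖x - θhat‖ ^ 4 ∂(γ[|K])) / (n * lam - r * (n * M))) ≤
        √3 * (H⁻¹.trace / n) / (√((lam - r * M) * (1 - Real.exp T)) * √(n : ℝ)) := by
      rw [← Real.sqrt_mul (by positivity)]
      refine (Real.sqrt_le_sqrt (y := (√3 * (H⁻¹.trace / n)) ^ 2 /
        ((lam - r * M) * (1 - Real.exp T) * n)) ?_).trans (le_of_eq ?_)
      · rw [e1, mul_pow, Real.sq_sqrt (by norm_num)]
        refine (div_le_div_of_nonneg_right hI (by positivity)).trans (le_of_eq ?_)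
        rw [htrA]
        field_simp
      · rw [Real.sqrt_div (sq_nonneg _), Real.sqrt_sq (by positivity)]
    refine (mul_le_mul_of_nonneg_left h2 (by positivity)).trans (le_of_eq ?_)
    rw [rpow_neg_half]
    have hs1 : 0 < √((lam - r * M) * (1 - Real.exp T)) := Real.sqrt_pos.2 (by positivity)
    have hs2 : 0 < √(n : ℝ) := Real.sqrt_pos.2 hn'
    field_simp
  have hmeas : Measurable fun θ : Param d₁ => √(n : ℝ) • (θ - θhat) := by fun_prop
  refine tvDist_le fun S hS => ?_
  have hlap : laplaceUpdate B θhat = γ := by rw [laplaceUpdate, hγ_def, hAhess]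
  rw [rescale, rescale, map_measureReal_apply hmeas hS, map_measureReal_apply hmeas hS, hlap]
  set S' := (fun θ : Param d₁ => √(n : ℝ) • (θ - θhat)) ⁻¹' S
  have hS' : MeasurableSet S' := hmeas hS
  -- Triangle inequality along γ, γ|K, ν|K, ν.
  have h1 := abs_real_sub_cond_le (μ := γ) hKm hγK0 S'
  have h2 := abs_real_sub_cond_le (μ := ν) hKm hνK0 S'
  have h3 := hball S' hS'
  rw [abs_sub_comm] at h2
  have h4 := abs_sub_le (γ.real S') ((γ[|K]).real S') (ν.real S')
  have h5 := abs_sub_le ((γ[|K]).real S') ((ν[|K]).real S') (ν.real S')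
  linarith

theorem abs_det_inv_rpow {d : ℕ} {A : Matrix (Fin d) (Fin d) ℝ} (hA : A.PosDef) :
    |A⁻¹.det| ^ (-(1 / 2) : ℝ) = √A.det := by
  have hdet := hA.det_pos
  rw [Matrix.det_nonsing_inv, Ring.inverse_eq_inv', abs_of_pos (inv_pos.2 hdet),
    Real.inv_rpow hdet.le, Real.rpow_neg hdet.le, inv_inv, Real.sqrt_eq_rpow]

theorem gaussConst_smul {n : ℕ} {d : ℕ} (A : Matrix (Fin d) (Fin d) ℝ) (hA : A.PosDef) :
    gaussConst ((n : ℝ) • A) = |A⁻¹.det| ^ (-(1 / 2) : ℝ) * (n : ℝ) ^ ((d : ℝ) / 2) /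
      (2 * Real.pi) ^ ((d : ℝ) / 2) := by
  have hdet := hA.det_pos
  have h1 := abs_det_inv_rpow hA
  have h2 : ∀ x : ℝ, 0 ≤ x → x ^ ((d : ℝ) / 2) = √x ^ d := fun x hx => by
    rw [Real.sqrt_eq_rpow, ← Real.rpow_natCast, ← Real.rpow_mul hx]
    congr 1; ring
  have hpi := Real.pi_pos
  rw [h1, h2 _ (Nat.cast_nonneg n), h2 _ (by positivity), gaussConst, Matrix.det_smul,
    Fintype.card_fin, Real.sqrt_mul (by positivity)]
  have h3 : √((n : ℝ) ^ d) = √(n : ℝ) ^ d := by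
    rw [← Real.sqrt_sq (by positivity : (0 : ℝ) ≤ √(n : ℝ) ^ d), ← pow_mul, mul_comm d 2, pow_mul,
      Real.sq_sqrt (Nat.cast_nonneg n)]
  rw [h3]
  ring

theorem Assumptions.lintegral_weight_ne_zero (hw : B.WellPosed)
    (h : Assumptions n B θbar θhat c) : ∫⁻ θ, B.weight θ ≠ 0 := fun h0 =>
  setLIntegral_weight_pos hw (Metric.isOpen_ball (x := θhat) (ε := c.δhat))
    ⟨θhat, Metric.mem_ball_self h.posterior.δhat_pos⟩
    (fun θ hθ => h.posterior.prior_pos θ (Metric.ball_subset_closedBall hθ))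
    (le_antisymm ((setLIntegral_le_lintegral _ _).trans h0.le) bot_le)

theorem Assumptions.lintegral_weight_ne_top (hw : B.WellPosed)
    (h : Assumptions n B θbar θhat c) : ∫⁻ θ, B.weight θ ≠ ∞ :=
  hw.lintegral_weight_ne_top h.likelihood.unique_max

/-- Mass of the exact update outside the ball around `θhat`. -/
theorem Assumptions.exactUpdate_compl_ball_le (hd : 1 ≤ d₁) (hn : 1 ≤ n) (hw : B.WellPosed)
    (h : Assumptions n B θbar θhat c) :
    2 * B.exactUpdate.real (Metric.ball θhat c.δhat)ᶜ ≤
      C₂ n B θbar c * (n : ℝ) ^ ((d₁ : ℝ) / 2) * Real.exp (-(n * c.κhat)) := by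
  have hn' : (0 : ℝ) < n := by exact_mod_cast hn
  have hJ0 := Jmat_posDef hn h.likelihood h.trace.lik_isUnit
  have hJ := hJ0.smul hn'
  have hM2 := h.prior.Mbar₂_pos
  have hT := TbarJ_neg hd hn h.likelihood h.trace.lik_isUnit h.trace.lik_lt
  have hexp : 0 < 1 - Real.exp (TbarJ n B θbar c) := by
    linarith [Real.exp_lt_one_iff.2 hT]
  have hg := gaussConst_pos hJ
  have hlow := le_lintegral_weight hd hn h.likelihood h.prior h.trace.lik_isUnit h.trace.lik_lt
  have hclosed : ∫⁻ θ in (Metric.ball θhat c.δhat)ᶜ, B.weight θ ≤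
      ENNReal.ofReal (Real.exp (B.logLik θbar - n * c.κhat)) := by
    -- The tail assumption has a strict inequality and need not cover the sphere, which is a null
    -- set.
    have hae : ((Metric.ball θhat c.δhat)ᶜ : Set (Param d₁)) =ᵐ[volume]
        ((Metric.closedBall θhat c.δhat)ᶜ : Set (Param d₁)) := by
      refine Filter.EventuallyEq.compl ?_
      rw [← Metric.ball_union_sphere]
      exact (union_ae_eq_left_of_ae_eq_empty (ae_eq_empty.2
        (Measure.addHaar_sphere_of_ne_zero volume θhat h.posterior.δhat_pos.ne'))).symm
    rw [setLIntegral_congr hae]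
    refine hw.setLIntegral_weight_le Metric.isClosed_closedBall.measurableSet.compl
      fun θ hθ => ?_
    have h1 : c.δhat < ‖θ - θhat‖ := by
      rw [← dist_eq_norm]; simpa using hθ
    have h2 : ‖θ - θhat‖ ≤ ‖θ - θbar‖ + ‖θbar - θhat‖ := norm_sub_le_norm_sub_add_norm_sub _ _ _
    have h3 := h.tail.decay θ (by linarith)
    rw [div_le_iff₀ hn'] at h3
    linarith
  have h1 := Block.exactUpdate_real_le Metric.isOpen_ball.measurableSet.compl (Real.exp_pos _).le
    (by positivity) hclosed hlow
  refine (mul_le_mul_of_nonneg_left h1 (by norm_num : (0 : ℝ) ≤ 2)).trans (le_of_eq ?_)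
  have hpi := Real.pi_pos
  have hpow : 0 < (2 * Real.pi) ^ ((d₁ : ℝ) / 2) := Real.rpow_pos_of_pos (by positivity) _
  have e := gaussConst_smul (n := n) (Jmat n B θbar c) hJ0
  have hE := Real.exp_pos (B.logLik θbar)
  rw [C₂, Real.exp_sub, Real.exp_neg]
  have e2 : Real.exp (B.logLik θbar) / Real.exp (n * c.κhat) /
      (Real.exp (B.logLik θbar) * c.Mbar₂⁻¹ * (gaussConst ((n : ℝ) • Jmat n B θbar c))⁻¹ *
        (1 - Real.exp (TbarJ n B θbar c))) =
      gaussConst ((n : ℝ) • Jmat n B θbar c) * c.Mbar₂ / Real.exp (n * c.κhat) /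
        (1 - Real.exp (TbarJ n B θbar c)) := by
    field_simp
  rw [e2, e]
  field_simp

/-- The nonasymptotic bound on the error of the Laplace update. -/
theorem Assumptions.laplaceError_le_errorBound (hd : 1 ≤ d₁) (hn : 1 ≤ n) (hw : B.WellPosed)
    (h : Assumptions n B θbar θhat c) :
    laplaceError n B θhat ≤ errorBound n B θbar θhat c := by
  have hH := h.posterior.Hf_posDef hn
  have h1 := laplaceError_le_of_ball hd hn hw (h.posterior.thirdDerivBound hn)
    h.posterior.Mhat₁_pos.le h.posterior.δhat_pos
    (fun θ hθ => h.posterior.prior_pos θ (Metric.ball_subset_closedBall hθ))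
    h.posterior.fderiv_eq_zero hH (lambdaMin_mul_norm_sq_le_quadForm hH.isHermitian)
    h.posterior.lt_lambdaMin
    (h.posterior.sqrt_trace_lt hn ((le_max_right _ _).trans_lt h.trace.post_lt))
    (h.lintegral_weight_ne_top hw)
  have h2 := h.exactUpdate_compl_ball_le hd hn hw
  -- The ball estimate contains each outside mass once, whereas the stated bound allows it twice;
  -- nonnegativity covers the difference.
  have h3 : 0 ≤ B.exactUpdate.real (Metric.ball θhat c.δhat)ᶜ := measureReal_nonneg
  have h4 := Real.exp_pos (That n B θhat c)
  rw [errorBound, C₁]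
  change _ ≤ _ + Real.exp (That n B θhat c) + _ at h1
  have h5 : laplaceError n B θhat ≤ √3 * ((Hf n B θhat)⁻¹).trace * c.Mhat₁ /
    (4 * √((lambdaMin (Hf n B θhat) - c.δhat * c.Mhat₁) *
      (1 - Real.exp (That n B θhat c)))) * (n : ℝ) ^ (-(1 / 2) : ℝ) +
      Real.exp (That n B θhat c) + B.exactUpdate.real (Metric.ball θhat c.δhat)ᶜ := h1
  linarith

end Nonasymptotic

/-! ### The limit of large sample size -/

section Asymptotic

/-- Bound for `exp (tailExponent n δ A)` when `A ≥ s`. -/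
noncomputable def tailBound (d n : ℕ) (δ s : ℝ) : ℝ :=
  Real.exp (-(1 / 2) * (δ * √(n : ℝ) - √(d * s⁻¹)) ^ 2 * s)

theorem tendsto_mul_sqrt_sub_atTop {δ : ℝ} (hδ : 0 < δ) (C : ℝ) :
    Tendsto (fun n : ℕ => δ * √(n : ℝ) - C) atTop atTop :=
  tendsto_atTop_add_const_right _ (-C) ((Real.tendsto_sqrt_atTop.comp
    tendsto_natCast_atTop_atTop).const_mul_atTop hδ)

theorem tendsto_tailBound (d : ℕ) {δ s : ℝ} (hδ : 0 < δ) (hs : 0 < s) :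
    Tendsto (fun n => tailBound d n δ s) atTop (𝓝 0) := by
  refine Real.tendsto_exp_atBot.comp ?_
  have h1 : Tendsto (fun n : ℕ => (δ * √(n : ℝ) - √(d * s⁻¹)) ^ 2) atTop atTop :=
    (tendsto_pow_atTop two_ne_zero).comp (tendsto_mul_sqrt_sub_atTop hδ _)
  have h2 := h1.const_mul_atTop_of_neg (by linarith : -(1 / 2) * s < 0)
  refine h2.congr fun n => ?_
  ring

/-- If A ≥ s, then tr A⁻¹ ≤ d/s and ‖A⁻¹‖ ≤ 1/s, so A enters only through s. The last hypothesis
makes the base of the square nonnegative. -/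
theorem exp_tailExponent_le {d n : ℕ} (hd : 1 ≤ d) {A : Matrix (Fin d) (Fin d) ℝ} (hA : A.PosDef)
    {s δ : ℝ} (hs : 0 < s) (hAs : ∀ v, s * ‖v‖ ^ 2 ≤ quadForm A v)
    (h : √(d * s⁻¹) ≤ δ * √(n : ℝ)) :
    Real.exp (tailExponent n δ A) ≤ tailBound d n δ s := by
  refine Real.exp_le_exp.2 ?_
  rw [tailExponent]
  have h1 : √A⁻¹.trace ≤ √(d * s⁻¹) := Real.sqrt_le_sqrt (trace_inv_le hA hs hAs)
  have h2 : (δ * √(n : ℝ) - √(d * s⁻¹)) ^ 2 ≤ (δ * √(n : ℝ) - √A⁻¹.trace) ^ 2 :=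
    pow_le_pow_left₀ (by linarith) (by linarith) 2
  have h3 : s ≤ (opNorm A⁻¹)⁻¹ := by
    rw [le_inv_comm₀ hs (opNorm_inv_pos hd hA)]
    exact opNorm_inv_le hA hs hAs
  have h4 := mul_le_mul h2 h3 hs.le (sq_nonneg _)
  linarith

theorem sqrt_trace_inv_smul_lt {d n : ℕ} (hn : 1 ≤ n) {A : Matrix (Fin d) (Fin d) ℝ}
    (hA : A.PosDef) {s δ : ℝ} (hs : 0 < s) (hAs : ∀ v, s * ‖v‖ ^ 2 ≤ quadForm A v)
    (h : √(d * s⁻¹) < δ * √(n : ℝ)) : √((n : ℝ) • A)⁻¹.trace < δ := by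
  have hn' : (0 : ℝ) < n := by exact_mod_cast hn
  rw [sqrt_trace_inv_smul hn hA, div_lt_iff₀ (Real.sqrt_pos.2 hn')]
  exact (Real.sqrt_le_sqrt (trace_inv_le hA hs hAs)).trans_lt h

variable {d₁ d₂ : ℕ} {B : Block d₁ d₂} {n : ℕ} {θbar θhat : Param d₁} {c : Consts}

theorem PosteriorRegular.mul_norm_sq_le_quadForm_Hf (hn : 1 ≤ n)
    (h : PosteriorRegular n B θhat c) (v : Param d₁) :
    c.δhat * c.Mhat₁ * ‖v‖ ^ 2 ≤ quadForm (Hf n B θhat) v :=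
  (mul_le_mul_of_nonneg_right h.lt_lambdaMin.le (sq_nonneg _)).trans
    (lambdaMin_mul_norm_sq_le_quadForm (h.Hf_posDef hn).isHermitian v)

theorem mul_norm_sq_le_quadForm_Jmat (hn : 1 ≤ n) (h : LikelihoodRegular n B θbar c)
    (hu : IsUnit (hessian B.logLik θbar)) (v : Param d₁) :
    c.Mbar₁ * c.δbar / 3 * ‖v‖ ^ 2 ≤ quadForm (Jmat n B θbar c) v := by
  have h1 := mul_norm_sq_le_quadForm (Hl_posDef hn h hu).isHermitian (c := 0)
    (fun i => ((Hl_posDef hn h hu).eigenvalues_pos i).le) v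
  rw [Jmat, quadForm_add_smul_one]
  linarith

theorem lintegral_comp_add_two_smul {d : ℕ} (m : Param d) {F : Param d → ℝ≥0∞}
    (hF : Measurable F) :
    ∫⁻ x, F x = 2 ^ d * ∫⁻ k, F (m + (2 : ℝ) • k) := by
  have hmap := Measure.map_addHaar_smul (volume : Measure (Param d)) (two_ne_zero (α := ℝ))
  have h1 : ∫⁻ k, F (m + (2 : ℝ) • k) =
      ∫⁻ y, F (m + y) ∂(Measure.map (fun k : Param d => (2 : ℝ) • k) volume) :=
    (lintegral_map (f := fun y => F (m + y)) (by fun_prop) (by fun_prop)).symm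
  have h2 : Measure.map (fun k : Param d => (2 : ℝ) • k) volume =
      Measure.map (((2 : ℝ) • ·) : Param d → Param d) volume := rfl
  rw [h1, h2, hmap, lintegral_smul_measure, lintegral_add_left_eq_self F m, smul_eq_mul,
    finrank_euclideanSpace_fin, ← mul_assoc]
  have h3 : (2 : ℝ≥0∞) ^ d * ENNReal.ofReal |((2 : ℝ) ^ d)⁻¹| = 1 := by
    rw [abs_of_pos (by positivity), ENNReal.ofReal_inv_of_pos (by positivity),
      ENNReal.ofReal_pow (by norm_num), ENNReal.ofReal_ofNat]
    exact ENNReal.mul_inv_cancel (by simp) (ENNReal.pow_ne_top (by simp))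
  rw [h3, one_mul]

/-- Mass of the exact update in the annulus between half the radius and the full radius. -/
theorem Assumptions.exactUpdate_annulus_le (hn : 1 ≤ n) (hw : B.WellPosed)
    (h : Assumptions n B θbar θhat c) :
    B.exactUpdate.real (Metric.ball θhat c.δhat \ Metric.ball θhat (c.δhat / 2)) ≤
      2 ^ d₁ * Real.exp (-(n * (c.δhat * c.Mhat₁ * c.δhat ^ 2 / 128))) := by
  have hn' : (0 : ℝ) < n := by exact_mod_cast hn
  have hδ := h.posterior.δhat_pos
  have hM := h.posterior.Mhat₁_pos
  set R := c.δhat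
  set M := c.Mhat₁
  set f := B.logPost
  have hT := h.posterior.thirdDerivBound hn
  have hlam : ∀ v, fderiv ℝ (fderiv ℝ f) θhat v v ≤ -(n * (R * M) * ‖v‖ ^ 2) := fun v => by
    have h1 := h.posterior.mul_norm_sq_le_quadForm_Hf hn v
    have h2 := quadForm_smul_matrix (Hf n B θhat) n v
    rw [smul_Hf hn, quadForm_neg_hessian] at h2
    have h3 := mul_le_mul_of_nonneg_left h1 hn'.le
    linarith
  have hmem : ∀ k : Param d₁, ∀ r, ‖k‖ < r → θhat + k ∈ Metric.ball θhat r := fun k r hk => by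
    simpa [dist_eq_norm] using hk
  -- Concavity on the full ball, where the guaranteed constant is just 0, gives f(θ̂ + 2k) ≤ 2f(θ̂ +
  -- k) - f(θ̂). On the half ball the constant is nRM/2, so f(θ̂ + k) ≤ f(θ̂) - nRM‖k‖²/8. With ‖k‖
  -- ≥ R/4 the loss is at least nRM · R²/128.
  have hdecay : ∀ k : Param d₁, R / 4 ≤ ‖k‖ → ‖k‖ < R / 2 →
      f (θhat + (2 : ℝ) • k) ≤ f (θhat + k) - n * (R * M * R ^ 2 / 128) := by
    intro k hk1 hk2
    have h2k : ‖(2 : ℝ) • k‖ < R := by rw [norm_smul]; norm_num; linarith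
    have h1 := hT.midpoint_strongConcave (by positivity) hlam (hmem _ _ h2k)
      (Metric.mem_ball_self hδ)
    have e1 : (1 / 2 : ℝ) • (θhat + (2 : ℝ) • k + θhat) = θhat + k := by module
    have e2 : n * (R * M) - R * (n * M) = 0 := by ring
    rw [e1, e2] at h1
    have h2 := (hT.mono (by linarith : R / 2 ≤ R)).midpoint_strongConcave (by positivity) hlam
      (hmem k _ hk2) (Metric.mem_ball_self (by linarith))
    have h3 : f ((1 / 2 : ℝ) • (θhat + k + θhat)) ≤ f θhat := by
      have e3 : (1 / 2 : ℝ) • (θhat + k + θhat) = θhat + (1 / 2 : ℝ) • k := by module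
      rw [e3]
      refine h.posterior.logPost_le (Metric.ball_subset_closedBall (hmem _ _ ?_))
      rw [norm_smul]; norm_num; linarith
    rw [add_sub_cancel_left] at h2
    have e4 : n * (R * M) - R / 2 * (n * M) = n * (R * M) / 2 := by ring
    rw [e4] at h2
    have h4 : (R / 4) ^ 2 ≤ ‖k‖ ^ 2 := pow_le_pow_left₀ (by positivity) hk1 2
    have h5 : n * (R * M) / 2 / 4 * (R / 4) ^ 2 ≤ n * (R * M) / 2 / 4 * ‖k‖ ^ 2 := by gcongr
    have e5 : n * (R * M) / 2 / 4 * (R / 4) ^ 2 = n * (R * M * R ^ 2 / 128) := by ring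
    linarith
  set S := Metric.ball θhat R \ Metric.ball θhat (R / 2)
  have hS : MeasurableSet S :=
    Metric.isOpen_ball.measurableSet.diff Metric.isOpen_ball.measurableSet
  set q := Real.exp (-(n * (R * M * R ^ 2 / 128)))
  have hpt : ∀ k : Param d₁, S.indicator B.weight (θhat + (2 : ℝ) • k) ≤
      ENNReal.ofReal q * B.weight (θhat + k) := by
    intro k
    by_cases hk : θhat + (2 : ℝ) • k ∈ S
    · rw [Set.indicator_of_mem hk]
      have h1 : ‖(2 : ℝ) • k‖ < R := by simpa [dist_eq_norm] using hk.1
      have h2 : R / 2 ≤ ‖(2 : ℝ) • k‖ := by simpa [dist_eq_norm] using hk.2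
      have hk1 := h1
      have hk2 := h2
      rw [norm_smul] at h1 h2
      norm_num at h1 h2
      have hpos : ∀ v : Param d₁, ‖v‖ < R → 0 < B.prior (θhat + v) := fun v hv =>
        h.posterior.prior_pos _ (Metric.ball_subset_closedBall (hmem v _ hv))
      rw [Block.weight_of_prior_pos (hpos _ hk1), Block.weight_of_prior_pos (hpos k (by linarith)),
        ← ENNReal.ofReal_mul (Real.exp_pos _).le, ← Real.exp_add]
      refine ENNReal.ofReal_le_ofReal (Real.exp_le_exp.2 ?_)
      have := hdecay k (by linarith) (by linarith)
      linarith
    · rw [Set.indicator_of_notMem hk]; exact bot_le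
  -- The dilation by 2 about θ̂ has Jacobian 2^{d₁} and compares the annulus with its contracted
  -- image, whose mass is at most the total.
  have hint : ∫⁻ θ in S, B.weight θ ≤ ENNReal.ofReal (2 ^ d₁ * q) * ∫⁻ θ, B.weight θ := by
    rw [← lintegral_indicator hS,
      lintegral_comp_add_two_smul θhat (hw.measurable_weight.indicator hS)]
    calc _ ≤ (2 : ℝ≥0∞) ^ d₁ * ∫⁻ k, ENNReal.ofReal q * B.weight (θhat + k) := by
          gcongr with k; exact hpt k
      _ = _ := by
          rw [lintegral_const_mul' _ _ ENNReal.ofReal_ne_top,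
            lintegral_add_left_eq_self B.weight θhat, ENNReal.ofReal_mul (by positivity),
            ENNReal.ofReal_pow (by norm_num), ENNReal.ofReal_ofNat, mul_assoc]
  refine ENNReal.toReal_le_of_le_ofReal (by positivity) ?_
  have h0 := h.lintegral_weight_ne_zero hw
  have htop := h.lintegral_weight_ne_top hw
  rw [Block.exactUpdate_eq, Measure.smul_apply, withDensity_apply _ hS, smul_eq_mul]
  calc _ ≤ (∫⁻ θ, B.weight θ)⁻¹ * (ENNReal.ofReal (2 ^ d₁ * q) * ∫⁻ θ, B.weight θ) := by gcongr
    _ = ENNReal.ofReal (2 ^ d₁ * q) := by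
        rw [mul_left_comm, ENNReal.inv_mul_cancel h0 htop, mul_one]

/-- Bound for `C₂` in terms of a bound `K` on the normalized curvature. -/
noncomputable def C₂Bound (d : ℕ) (c : Consts) (K : ℝ) : ℝ :=
  2 * √((K + c.Mbar₁ * c.δbar / 3) ^ d) * c.Mbar₂ / ((2 * Real.pi) ^ ((d : ℝ) / 2) * (1 / 2))

/-- The curvature bound controls det J. The denominator needs no such bound, because J ≥ M̄₁ δ̄/3 in
all cases. -/
theorem Assumptions.C₂_le (hd : 1 ≤ d₁) (hn : 1 ≤ n) (h : Assumptions n B θbar θhat c) {K : ℝ}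
    (hK : opNorm (Hl n B θbar) ≤ K)
    (h1 : √(d₁ * (c.Mbar₁ * c.δbar / 3)⁻¹) < c.δbar * √(n : ℝ))
    (h2 : tailBound d₁ n c.δbar (c.Mbar₁ * c.δbar / 3) ≤ 1 / 2) :
    C₂ n B θbar c ≤ C₂Bound d₁ c K := by
  have hδ := h.likelihood.δbar_pos
  have hM := h.likelihood.Mbar₁_pos
  have hM2 := h.prior.Mbar₂_pos
  have hpi := Real.pi_pos
  have hu := h.trace.lik_isUnit
  have hJ := Jmat_posDef hn h.likelihood hu
  have hT := exp_tailExponent_le hd hJ (by positivity)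
    (mul_norm_sq_le_quadForm_Jmat hn h.likelihood hu) h1.le
  have hT' : Real.exp (TbarJ n B θbar c) ≤ 1 / 2 := hT.trans h2
  have hdet : (Jmat n B θbar c).det ≤ (K + c.Mbar₁ * c.δbar / 3) ^ d₁ :=
    det_add_smul_one_le (Hl_posDef hn h.likelihood hu) (by positivity) hK
  rw [C₂, C₂Bound, abs_det_inv_rpow hJ]
  have hpow : 0 < (2 * Real.pi) ^ ((d₁ : ℝ) / 2) := Real.rpow_pos_of_pos (by positivity) _
  gcongr
  linarith

/-- Bound for the error on a ball whose radius leaves a curvature gap `η`. -/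
noncomputable def ballErrorBound (d n : ℕ) (c : Consts) (η : ℝ) : ℝ :=
  √3 * (d * (c.δhat * c.Mhat₁)⁻¹) * c.Mhat₁ / (4 * √(η * (1 / 2))) * (n : ℝ) ^ (-(1 / 2) : ℝ)

theorem PosteriorRegular.ballError_le (hn : 1 ≤ n) (h : PosteriorRegular n B θhat c)
    {gap η T : ℝ} (hη : 0 < η) (hgap : η ≤ gap) (hT : Real.exp T ≤ 1 / 2) :
    √3 * ((Hf n B θhat)⁻¹).trace * c.Mhat₁ / (4 * √(gap * (1 - Real.exp T))) *
      (n : ℝ) ^ (-(1 / 2) : ℝ) ≤ ballErrorBound d₁ n c η := by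
  have hδ := h.δhat_pos
  have hM := h.Mhat₁_pos
  have htr := trace_inv_le (h.Hf_posDef hn) (by positivity) (h.mul_norm_sq_le_quadForm_Hf hn)
  rw [ballErrorBound]
  gcongr
  all_goals linarith

/-- The constants are positive. -/
structure Consts.Pos (c : Consts) : Prop where
  δbar : 0 < c.δbar
  δhat : 0 < c.δhat
  Mbar₁ : 0 < c.Mbar₁
  Mhat₁ : 0 < c.Mhat₁
  κhat : 0 < c.κhat

theorem Assumptions.consts_pos (h : Assumptions n B θbar θhat c) : c.Pos :=
  ⟨h.likelihood.δbar_pos, h.posterior.δhat_pos, h.likelihood.Mbar₁_pos, h.posterior.Mhat₁_pos,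
    h.tail.κhat_pos⟩

theorem tendsto_ballErrorBound (d : ℕ) (c : Consts) (η : ℝ) :
    Tendsto (fun n => ballErrorBound d n c η) atTop (𝓝 0) := by
  have h1 : Tendsto (fun n : ℕ => (n : ℝ) ^ (-(1 / 2) : ℝ)) atTop (𝓝 0) :=
    (tendsto_rpow_neg_atTop (by norm_num : (0 : ℝ) < 1 / 2)).comp tendsto_natCast_atTop_atTop
  have h2 := h1.const_mul (√3 * (d * (c.δhat * c.Mhat₁)⁻¹) * c.Mhat₁ / (4 * √(η * (1 / 2))))
  rw [mul_zero] at h2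
  exact h2

theorem tendsto_const_mul_rpow_mul_exp (d : ℕ) (C : ℝ) {κ : ℝ} (hκ : 0 < κ) :
    Tendsto (fun n : ℕ => C * (n : ℝ) ^ ((d : ℝ) / 2) * Real.exp (-(n * κ))) atTop (𝓝 0) := by
  have h1 := (tendsto_rpow_mul_exp_neg_mul_atTop_nhds_zero ((d : ℝ) / 2) κ hκ).comp
    tendsto_natCast_atTop_atTop
  have h2 := h1.const_mul C
  rw [mul_zero] at h2
  refine h2.congr fun n => ?_
  simp only [Function.comp_apply]
  rw [mul_assoc]
  congr 3; ring

/-- Uniformly over all blocks with the given constants and normalized curvature at most `K`, the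
error of the Laplace update tends to zero. -/
theorem exists_laplaceError_le (hd : 1 ≤ d₁) (d₂ : ℕ) (hc : c.Pos) (K : ℝ) :
    ∃ b : ℕ → ℝ, Tendsto b atTop (𝓝 0) ∧ ∀ᶠ n in atTop, ∀ (B : Block d₁ d₂) (θbar θhat : Param d₁),
      B.WellPosed → Assumptions n B θbar θhat c → opNorm (Hl n B θbar) ≤ K →
      laplaceError n B θhat ≤ b n := by
  have hδ := hc.δhat
  have hδb := hc.δbar
  have hM := hc.Mhat₁
  have hMb := hc.Mbar₁
  set s := c.δhat * c.Mhat₁ with hs_def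
  have hs : 0 < s := by positivity
  set j := c.Mbar₁ * c.δbar / 3
  have hj : 0 < j := by positivity
  -- At half the radius the curvature gap is at least s - s/2 = s/2, although at the full radius it
  -- may be arbitrarily small.
  have hr : 0 < c.δhat / 2 := by positivity
  refine ⟨fun n => ballErrorBound d₁ n c (s / 2) + tailBound d₁ n (c.δhat / 2) s +
    (C₂Bound d₁ c K * (n : ℝ) ^ ((d₁ : ℝ) / 2) * Real.exp (-(n * c.κhat)) +
      -- The trivial power of n brings the annulus term into the form of
      -- `tendsto_const_mul_rpow_mul_exp`.
      2 ^ d₁ * (n : ℝ) ^ (((0 : ℕ) : ℝ) / 2) * Real.exp (-(n * (s * c.δhat ^ 2 / 128)))), ?_, ?_⟩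
  · have h1 := ((tendsto_ballErrorBound d₁ c (s / 2)).add (tendsto_tailBound d₁ hr hs)).add
      ((tendsto_const_mul_rpow_mul_exp d₁ (C₂Bound d₁ c K) hc.κhat).add
        (tendsto_const_mul_rpow_mul_exp 0 (2 ^ d₁) (by positivity : 0 < s * c.δhat ^ 2 / 128)))
    simpa only [add_zero] using h1
  filter_upwards [eventually_ge_atTop 1,
    (tendsto_mul_sqrt_sub_atTop hr √(d₁ * s⁻¹)).eventually_gt_atTop 0,
    (tendsto_mul_sqrt_sub_atTop hδb √(d₁ * j⁻¹)).eventually_gt_atTop 0,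
    (tendsto_tailBound d₁ hr hs).eventually (Iic_mem_nhds (by norm_num : (0 : ℝ) < 1 / 2)),
    (tendsto_tailBound d₁ hδb hj).eventually (Iic_mem_nhds (by norm_num : (0 : ℝ) < 1 / 2))]
    with n hn h1 h2 h3 h4 B θbar θhat hw h hK
  have hpost := h.posterior
  have hH := hpost.Hf_posDef hn
  have hT3 := (hpost.thirdDerivBound hn).mono (by linarith : c.δhat / 2 ≤ c.δhat)
  have hTexp := exp_tailExponent_le hd hH hs (hpost.mul_norm_sq_le_quadForm_Hf hn)
    (δ := c.δhat / 2) (n := n) (by linarith)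
  have hmain := laplaceError_le_of_ball hd hn hw hT3 hM.le hr
    (fun θ hθ => hpost.prior_pos θ (Metric.ball_subset_closedBall
      (Metric.ball_subset_ball (by linarith) hθ)))
    hpost.fderiv_eq_zero hH (hpost.mul_norm_sq_le_quadForm_Hf hn) (by nlinarith)
    (sqrt_trace_inv_smul_lt hn hH hs (hpost.mul_norm_sq_le_quadForm_Hf hn) (by linarith))
    (h.lintegral_weight_ne_top hw)
  have hb := hpost.ballError_le hn (gap := s - c.δhat / 2 * c.Mhat₁) (η := s / 2)
    (T := tailExponent n (c.δhat / 2) (Hf n B θhat)) (by positivity)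
    (le_of_eq (by rw [hs_def]; ring)) (hTexp.trans h3)
  have hprob := Block.isProbabilityMeasure_exactUpdate (h.lintegral_weight_ne_zero hw)
    (h.lintegral_weight_ne_top hw)
  have hsub : (Metric.ball θhat (c.δhat / 2))ᶜ ⊆ (Metric.ball θhat c.δhat)ᶜ ∪
      (Metric.ball θhat c.δhat \ Metric.ball θhat (c.δhat / 2)) := fun θ hθ => by
    by_cases hθ' : θ ∈ Metric.ball θhat c.δhat
    · exact .inr ⟨hθ', hθ⟩
    · exact .inl hθ'
  have hmass := (measureReal_mono (μ := B.exactUpdate) hsub).trans (measureReal_union_le _ _)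
  have hann := h.exactUpdate_annulus_le hn hw
  have htail := h.exactUpdate_compl_ball_le hd hn hw
  have hnn : 0 ≤ B.exactUpdate.real (Metric.ball θhat c.δhat)ᶜ := measureReal_nonneg
  have hC2 := h.C₂_le hd hn hK (by linarith) h4
  have hC2' : C₂ n B θbar c * (n : ℝ) ^ ((d₁ : ℝ) / 2) * Real.exp (-(n * c.κhat)) ≤
      C₂Bound d₁ c K * (n : ℝ) ^ ((d₁ : ℝ) / 2) * Real.exp (-(n * c.κhat)) := by gcongr
  simp only [Nat.cast_zero, zero_div, Real.rpow_zero, mul_one]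
  linarith

/-- Uniformly over all blocks with the given constants, normalized curvature at most `K` and
curvature gap at least `η`, the explicit error bound tends to zero. -/
theorem exists_errorBound_le (hd : 1 ≤ d₁) (d₂ : ℕ) (hc : c.Pos) (K : ℝ) {η : ℝ} (hη : 0 < η) :
    ∃ b : ℕ → ℝ, Tendsto b atTop (𝓝 0) ∧ ∀ᶠ n in atTop, ∀ (B : Block d₁ d₂) (θbar θhat : Param d₁),
      Assumptions n B θbar θhat c → opNorm (Hl n B θbar) ≤ K →
      η ≤ lambdaMin (Hf n B θhat) - c.δhat * c.Mhat₁ → errorBound n B θbar θhat c ≤ b n := by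
  have hδ := hc.δhat
  have hδb := hc.δbar
  have hM := hc.Mhat₁
  have hMb := hc.Mbar₁
  set s := c.δhat * c.Mhat₁ with hs_def
  have hs : 0 < s := by positivity
  set j := c.Mbar₁ * c.δbar / 3
  have hj : 0 < j := by positivity
  refine ⟨fun n => ballErrorBound d₁ n c η + 2 * tailBound d₁ n c.δhat s +
    C₂Bound d₁ c K * (n : ℝ) ^ ((d₁ : ℝ) / 2) * Real.exp (-(n * c.κhat)), ?_, ?_⟩
  · have h1 := ((tendsto_ballErrorBound d₁ c η).add ((tendsto_tailBound d₁ hδ hs).const_mul 2)).add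
      (tendsto_const_mul_rpow_mul_exp d₁ (C₂Bound d₁ c K) hc.κhat)
    simpa only [add_zero, mul_zero] using h1
  filter_upwards [eventually_ge_atTop 1,
    (tendsto_mul_sqrt_sub_atTop hδ √(d₁ * s⁻¹)).eventually_gt_atTop 0,
    (tendsto_mul_sqrt_sub_atTop hδb √(d₁ * j⁻¹)).eventually_gt_atTop 0,
    (tendsto_tailBound d₁ hδ hs).eventually (Iic_mem_nhds (by norm_num : (0 : ℝ) < 1 / 2)),
    (tendsto_tailBound d₁ hδb hj).eventually (Iic_mem_nhds (by norm_num : (0 : ℝ) < 1 / 2))]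
    with n hn h1 h2 h3 h4 B θbar θhat h hK hgap
  have hpost := h.posterior
  have hTexp : Real.exp (That n B θhat c) ≤ tailBound d₁ n c.δhat s :=
    exp_tailExponent_le hd (hpost.Hf_posDef hn) hs (hpost.mul_norm_sq_le_quadForm_Hf hn)
      (by linarith)
  have hb : C₁ n B θhat c * (n : ℝ) ^ (-(1 / 2) : ℝ) ≤ ballErrorBound d₁ n c η :=
    hpost.ballError_le hn hη hgap (hTexp.trans h3)
  have hC2 := h.C₂_le hd hn hK (by linarith) h4
  have hC2' : C₂ n B θbar c * (n : ℝ) ^ ((d₁ : ℝ) / 2) * Real.exp (-(n * c.κhat)) ≤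
      C₂Bound d₁ c K * (n : ℝ) ^ ((d₁ : ℝ) / 2) * Real.exp (-(n * c.κhat)) := by gcongr
  rw [errorBound]
  linarith

/-- The exceptional events and the null sequence may depend on ε, as they must: the bounds K and η
furnished by boundedness in probability do. -/
theorem tendstoInMeasure_zero_of_forall_exists_bound {Ω : Type*} [MeasurableSpace Ω] {P : Measure Ω}
    {Z : ℕ → Ω → ℝ} (h : ∀ ε : ℝ≥0∞, 0 < ε → ∃ (bad : ℕ → Set Ω) (b : ℕ → ℝ),
      Tendsto b atTop (𝓝 0) ∧ (∀ᶠ n in atTop, P (bad n) ≤ ε) ∧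
      ∀ᶠ n in atTop, ∀ ω ∉ bad n, |Z n ω| ≤ b n) :
    TendstoInMeasure P Z atTop (fun _ => 0) := by
  intro ε hε
  rw [ENNReal.tendsto_nhds_zero]
  intro δ hδ
  obtain ⟨bad, b, hb, hbad, hZ⟩ := h δ hδ
  have hb' : Tendsto (fun n => ENNReal.ofReal (b n)) atTop (𝓝 0) := by
    simpa using ENNReal.tendsto_ofReal hb
  filter_upwards [hbad, hZ, hb'.eventually (Iio_mem_nhds hε)] with n h1 h2 h3
  refine (measure_mono fun ω hω => ?_).trans h1
  by_contra hcon
  have h4 : ε ≤ edist (Z n ω) 0 := hω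
  rw [edist_dist, Real.dist_eq, sub_zero] at h4
  exact absurd (h4.trans (ENNReal.ofReal_le_ofReal (h2 ω hcon))) (not_le.2 h3)

theorem laplaceError_nonneg (n : ℕ) (B : Block d₁ d₂) (θhat : Param d₁) :
    0 ≤ laplaceError n B θhat :=
  tvDist_nonneg _ _

end Asymptotic

/-- Union bound for a null event, an event of vanishing probability, and two events of small
probability. -/
theorem eventually_measure_union_le {Ω : Type*} [MeasurableSpace Ω] {P : Measure Ω}
    {N A D E : ℕ → Set Ω} (hN : ∀ n, P (N n) = 0) (hA : Tendsto (fun n => P (A n)) atTop (𝓝 0))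
    {ε : ℝ≥0∞} (hε : 0 < ε) (hD : ∀ᶠ n in atTop, P (D n) ≤ ε / 3)
    (hE : ∀ᶠ n in atTop, P (E n) ≤ ε / 3) :
    ∀ᶠ n in atTop, P (N n ∪ A n ∪ D n ∪ E n) ≤ ε := by
  have h3 : 0 < ε / 3 := ENNReal.div_pos hε.ne' (by norm_num)
  filter_upwards [ENNReal.tendsto_nhds_zero.1 hA _ h3, hD, hE] with n h1 h2 h4
  calc P (N n ∪ A n ∪ D n ∪ E n) ≤ P (N n) + P (A n) + P (D n) + P (E n) :=
        (measure_union_le _ _).trans (add_le_add_left ((measure_union_le _ _).trans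
          (add_le_add_left (measure_union_le _ _) _)) _)
    _ ≤ 0 + ε / 3 + ε / 3 + ε / 3 := by gcongr; exact (hN n).le
    _ = ε := by rw [zero_add, ENNReal.add_thirds]

end CALVI

/-! ### Assembly of the nonasymptotic bound and the limit -/

theorem theorem1 {d₁ d₂ : ℕ} (hd₁ : 1 ≤ d₁) :
    -- the nonasymptotic bound, for one sample size and one realization of the data
    (∀ (n : ℕ) (B : CALVI.Block d₁ d₂) (θbar θhat : CALVI.Param d₁) (c : CALVI.Consts),
      1 ≤ n → B.WellPosed → CALVI.Assumptions n B θbar θhat c →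
        (-CALVI.hessian B.logPost θhat).PosDef ∧
        IsProbabilityMeasure B.exactUpdate ∧
        CALVI.laplaceError n B θhat ≤ CALVI.errorBound n B θbar θhat c) ∧
    -- the limit `n → ∞`, with constants and prior that do not depend on `n`
    (∀ {Ω : Type*} [MeasurableSpace Ω] (P : Measure Ω) [IsProbabilityMeasure P]
      (𝒴 : ℕ → Type*) (Y : ∀ n, Ω → 𝒴 n)
      (prior : CALVI.Param d₁ → ℝ)
      (lik : ∀ n, 𝒴 n → CALVI.Param d₁ → CALVI.Param d₂ → ℝ)
      (factor : ℕ → Ω → CALVI.Param d₂ → ℝ)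
      (B : ℕ → Ω → CALVI.Block d₁ d₂)
      (θbar θhat : ℕ → Ω → CALVI.Param d₁) (c : CALVI.Consts),
      (∀ n ω, B n ω = ⟨prior, lik n (Y n ω), factor n ω⟩) →
      (∀ n, ∀ᵐ ω ∂P, (B n ω).WellPosed) →
      Tendsto (fun n => P {ω | ¬ CALVI.Assumptions n (B n ω) (θbar n ω) (θhat n ω) c})
        atTop (𝓝 0) →
      CALVI.BoundedAboveInProb P
        (fun n ω => CALVI.opNorm (CALVI.Hl n (B n ω) (θbar n ω))) →
        TendstoInMeasure P (fun n ω => CALVI.laplaceError n (B n ω) (θhat n ω)) atTop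
          (fun _ => 0) ∧
        (CALVI.BoundedAwayFromZeroInProb P
            (fun n ω => CALVI.lambdaMin (CALVI.Hf n (B n ω) (θhat n ω)) - c.δhat * c.Mhat₁) →
          TendstoInMeasure P
            (fun n ω => CALVI.errorBound n (B n ω) (θbar n ω) (θhat n ω) c) atTop
            (fun _ => 0))) := by
  refine ⟨fun n B θbar θhat c hn hw h => ⟨?_, ?_, h.laplaceError_le_errorBound hd₁ hn hw⟩, ?_⟩
  · have hn' : (0 : ℝ) < n := by exact_mod_cast hn
    rw [← CALVI.smul_Hf hn]
    exact (h.posterior.Hf_posDef hn).smul hn'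
  · exact CALVI.Block.isProbabilityMeasure_exactUpdate (h.lintegral_weight_ne_zero hw)
      (h.lintegral_weight_ne_top hw)
  intro Ω _ P _ 𝒴 Y prior lik factor B θbar θhat c _ hw hA hK
  have hN : ∀ n, P {ω | ¬ (B n ω).WellPosed} = 0 := fun n => ae_iff.1 (hw n)
  constructor
  · refine CALVI.tendstoInMeasure_zero_of_forall_exists_bound fun ε hε => ?_
    obtain ⟨K, hK⟩ := hK (ε / 3) (ENNReal.div_pos hε.ne' (by norm_num))
    have hbad := CALVI.eventually_measure_union_le (E := fun _ => ∅) hN hA hε hK (by simp)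
    -- Positivity of the constants is only known through the assumptions at some outcome. If it
    -- fails, the bad event is the whole space and nothing remains to be bounded.
    by_cases hc : c.Pos
    · obtain ⟨b, hb, hle⟩ := CALVI.exists_laplaceError_le hd₁ d₂ hc K
      refine ⟨_, b, hb, hbad, hle.mono fun n hn ω hω => ?_⟩
      simp only [Set.mem_union, Set.mem_ofPred_eq, not_or, not_not, not_lt] at hω
      obtain ⟨⟨⟨h1, h2⟩, h3⟩, -⟩ := hω
      rw [abs_of_nonneg (CALVI.laplaceError_nonneg _ _ _)]
      exact hn _ _ _ h1 h2 h3
    · refine ⟨_, fun _ => 0, tendsto_const_nhds, hbad, .of_forall fun n ω hω => ?_⟩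
      simp only [Set.mem_union, Set.mem_ofPred_eq, not_or, not_not, not_lt] at hω
      exact absurd hω.1.1.2.consts_pos hc
  · intro hgap
    refine CALVI.tendstoInMeasure_zero_of_forall_exists_bound fun ε hε => ?_
    have hε3 : 0 < ε / 3 := ENNReal.div_pos hε.ne' (by norm_num)
    obtain ⟨K, hK⟩ := hK (ε / 3) hε3
    obtain ⟨η, hη, hgap⟩ := hgap (ε / 3) hε3
    have hbad := CALVI.eventually_measure_union_le hN hA hε hK hgap
    by_cases hc : c.Pos
    · obtain ⟨b, hb, hle⟩ := CALVI.exists_errorBound_le hd₁ d₂ hc K hη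
      refine ⟨_, b, hb, hbad, (hle.and (eventually_ge_atTop 1)).mono fun n hn ω hω => ?_⟩
      simp only [Set.mem_union, Set.mem_ofPred_eq, not_or, not_not, not_lt] at hω
      obtain ⟨⟨⟨h1, h2⟩, h3⟩, h4⟩ := hω
      -- The explicit bound is nonnegative because it dominates a total variation distance, which
      -- requires n ≥ 1.
      rw [abs_of_nonneg ((CALVI.laplaceError_nonneg _ _ _).trans
        (h2.laplaceError_le_errorBound hd₁ hn.2 h1))]
      exact hn.1 _ _ _ h2 h3 h4
    · refine ⟨_, fun _ => 0, tendsto_const_nhds, hbad, .of_forall fun n ω hω => ?_⟩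
      simp only [Set.mem_union, Set.mem_ofPred_eq, not_or, not_not, not_lt] at hω
      exact absurd hω.1.1.2.consts_pos hc
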